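/- All digraphs are finite, without loops and without parallel arcs. A digraph $D$ is *strong* if for all vertices $x,y$ there is a directed path from $x$ to $y$; it is *semicomplete* if any two distinct vertices are joined by at least one arc; it is *quasi-transitive* if, for all distinct vertices $x,y,z$ such that $xy$ and $yz$ are arcs, $xz$ or $zx$ is an arc. For a digraph $D$ with vertices $u_1,\dots,u_t$ and non-empty digraphs $H_1,\dots,H_t$, the *composition* $D[H_1,\dots,H_t]$ is obtained from the disjoint union of $H_1,\dots,H_t$ by adding, for every arc $u_iu_j$ of $D$, all arcs from $V(H_i)$ to $V(H_j)$. A *canonical decomposition* of a strong quasi-transitive digraph $Q$ is a representation $Q\cong D[H_1,\dots,H_t]$ in which $D$ is a strong semicomplete digraph and every $H_i$ is a quasi-transitive digraph that is a single vertex or non-strong; put $n_0=\min_{1\le i\le t}|V(H_i)|$. Let $\mathcal Q_0$ consist of the digraphs isomorphic to one of $$\overrightarrow{C}_3[\overline{K_2},\overline{K_2},\overline{K_2}],\qquad \overrightarrow{C}_3[\overrightarrow{P_2},\overline{K_2},\overline{K_2}],\qquad \overrightarrow{C}_3[\overline{K_2},\overline{K_2},\overline{K_3}],$$ where $\overrightarrow{C}_3$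 is the directed $3$-cycle, $\overrightarrow{P_2}$ the directed path on two vertices and $\overline{K_r}$ the digraph with $r$ vertices and no arcs. For $S\subseteq V(Q)$, an *$S$-strong subgraph* of $Q$ is a strong subgraph of $Q$ whose vertex set contains $S$. **Corollary.** There is an algorithm that, given a strong quasi-transitive digraph $Q\notin\mathcal Q_0$ and a set $S\subseteq V(Q)$ with $2\le|S|\le|V(Q)|$, finds in time polynomial in $|V(Q)|$ a family of pairwise arc-disjoint $S$-strong subgraphs of $Q$ with at least $n_0$ members. Here $Q$ has at least one canonical decomposition, and the bound holds with the value $n_0$ of each of its canonical decompositions. -/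

import Mathlib

/-! ## Digraphs

A digraph is a loopless `Digraph`; looplessness is stated separately. -/

namespace Digraph

variable {V : Type*}

/-- No arc from a vertex to itself. -/
def IsLoopless (G : Digraph V) : Prop := ∀ x, ¬ G.Adj x x

/-- Every vertex can be reached from every vertex by a directed path. -/
def IsStrong (G : Digraph V) : Prop := ∀ x y, Relation.ReflTransGen G.Adj x y

/-- Any two distinct vertices are joined by an arc in at least one direction. -/
def IsSemicomplete (G : Digraph V) : Prop := ∀ x y, x ≠ y → G.Adj x y ∨ G.Adj y x

/-- If `xy` and `yz` are arcs and `x, y, z` are distinct, then `xz` or `zx` is an arc. -/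
def IsQuasiTransitive (G : Digraph V) : Prop :=
  ∀ x y z, x ≠ y → y ≠ z → x ≠ z → G.Adj x y → G.Adj y z → G.Adj x z ∨ G.Adj z x

/-- The composition `D[H i : i]`: every vertex `i` of `D` is replaced by the digraph `H i`, and
every arc `ij` of `D` by all arcs from the vertices of `H i` to the vertices of `H j`. -/
def composition {ι : Type*} {W : ι → Type*} (D : Digraph ι) (H : ∀ i, Digraph (W i)) :
    Digraph (Σ i, W i) where
  Adj x y := (∃ (i : ι) (a b : W i), (H i).Adj a b ∧ x = ⟨i, a⟩ ∧ y = ⟨i, b⟩) ∨ D.Adj x.1 y.1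

/-- The directed cycle on three vertices. -/
def dicycle3 : Digraph (Fin 3) where
  Adj i j := j = i + 1

/-- The directed path on two vertices. -/
def dipath2 : Digraph (Fin 2) where
  Adj i j := i = 0 ∧ j = 1

/-- `G` is isomorphic to one of the three exceptional digraphs
`C₃[K̄₂, K̄₂, K̄₂]`, `C₃[P₂, K̄₂, K̄₂]`, `C₃[K̄₂, K̄₂, K̄₃]`. Here `⊥` is the digraph without arcs. -/
def IsExceptional (G : Digraph V) : Prop :=
  Nonempty (G.Adj ≃r
    (composition dicycle3 (fun _ => (⊥ : Digraph (Fin 2)))).Adj) ∨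
  Nonempty (G.Adj ≃r
    (composition dicycle3 (fun i => if i = 0 then dipath2 else (⊥ : Digraph (Fin 2)))).Adj) ∨
  Nonempty (G.Adj ≃r
    (composition dicycle3 (fun i => (⊥ : Digraph (Fin ((![2, 2, 3] : Fin 3 → ℕ) i))))).Adj)

/-- A canonical decomposition of a strong quasi-transitive digraph `G`: a strong semicomplete
digraph `D` on `t` vertices and quasi-transitive digraphs `H i` of order `size i ≥ 1`, each of them
a single vertex or non-strong, such that `G = D[H i : i]`. -/
structure CanonicalDecomposition (G : Digraph V) where
  /-- the order of the quotient -/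
  t : ℕ
  /-- the quotient -/
  D : Digraph (Fin t)
  /-- the orders of the parts -/
  size : Fin t → ℕ
  /-- the parts -/
  H : ∀ i, Digraph (Fin (size i))
  /-- the isomorphism of `G` with the composition -/
  iso : G.Adj ≃r (composition D H).Adj
  loopless_D : D.IsLoopless
  strong_D : D.IsStrong
  semicomplete_D : D.IsSemicomplete
  size_pos : ∀ i, 1 ≤ size i
  loopless_H : ∀ i, (H i).IsLoopless
  quasiTransitive_H : ∀ i, (H i).IsQuasiTransitive
  vertex_or_not_strong : ∀ i, size i = 1 ∨ ¬ (H i).IsStrong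

/-- The smallest order of a part. -/
noncomputable def CanonicalDecomposition.minSize {G : Digraph V}
    (C : CanonicalDecomposition G) : ℕ := ⨅ i, C.size i

/-- A subgraph of `G`: a set of vertices and a set of arcs of `G` between them. -/
structure Subdigraph (G : Digraph V) where
  /-- the vertices -/
  verts : Set V
  /-- the arcs -/
  Adj : V → V → Prop
  adj_sub : ∀ {x y}, Adj x y → G.Adj x y
  fst_mem : ∀ {x y}, Adj x y → x ∈ verts
  snd_mem : ∀ {x y}, Adj x y → y ∈ verts

/-- An `S`-strong subgraph: a strong subgraph whose vertex set contains `S`. -/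
def Subdigraph.IsStrongOn {G : Digraph V} (H : Subdigraph G) (S : Set V) : Prop :=
  S ⊆ H.verts ∧ ∀ x ∈ H.verts, ∀ y ∈ H.verts, Relation.ReflTransGen H.Adj x y

/-- Two subgraphs without a common arc. -/
def Subdigraph.ArcDisjoint {G : Digraph V} (H K : Subdigraph G) : Prop :=
  ∀ x y, ¬ (H.Adj x y ∧ K.Adj x y)

end Digraph

/-! ## Random access machines

A structured random access machine over the natural numbers with registers and
three-dimensional arrays. Addition and truncated subtraction are the only arithmetical operations
(in particular there is no multiplication), so that in `T` steps only numbers of `O(T)` more bits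
than the input arise, and polynomial time is the same as for Turing machines. -/

namespace RAM

/-- The contents of the registers `reg x` and of the cells `cell a i j k` (the entry with indices
`i, j, k` of array `a`). -/
structure State where
  /-- registers -/
  reg : ℕ → ℕ
  /-- array cells -/
  cell : ℕ → ℕ → ℕ → ℕ → ℕ

/-- Expressions. -/
inductive Expr : Type
  | const (m : ℕ) : Expr
  | reg (x : ℕ) : Expr
  | cell (a : ℕ) (i j k : Expr) : Expr
  | add (e f : Expr) : Expr
  | sub (e f : Expr) : Expr

/-- The value of an expression; subtraction is truncated at `0`. -/
def Expr.eval (s : State) : Expr → ℕ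
  | .const m => m
  | .reg x => s.reg x
  | .cell a i j k => s.cell a (i.eval s) (j.eval s) (k.eval s)
  | .add e f => e.eval s + f.eval s
  | .sub e f => e.eval s - f.eval s

/-- Assign `v` to register `x`. -/
def State.setReg (s : State) (x v : ℕ) : State where
  reg := Function.update s.reg x v
  cell := s.cell

/-- Write `v` into the cell `(a, i, j, k)`. -/
def State.setCell (s : State) (a i j k v : ℕ) : State where
  reg := s.reg
  cell := fun a' i' j' k' =>
    if a' = a ∧ i' = i ∧ j' = j ∧ k' = k then v else s.cell a' i' j' k'

/-- Programs. A test of an expression asks whether its value is different from `0`. -/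
inductive Program : Type
  | skip : Program
  | assign (x : ℕ) (e : Expr) : Program
  | store (a : ℕ) (i j k e : Expr) : Program
  | seq (c d : Program) : Program
  | ite (e : Expr) (c d : Program) : Program
  | loop (e : Expr) (c : Program) : Program

/-- `Run c s s' T`: the program `c`, started in the state `s`, halts in the state `s'` after `T`
steps. Every `skip`, assignment, store and test counts as one step (a fixed program contains
finitely many expressions, so evaluating one of them takes a bounded number of operations). -/
inductive Run : Program → State → State → ℕ → Prop
  | skip (s : State) : Run .skip s s 1
  | assign (s : State) (x : ℕ) (e : Expr) : Run (.assign x e) s (s.setReg x (e.eval s)) 1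
  | store (s : State) (a : ℕ) (i j k e : Expr) :
      Run (.store a i j k e) s (s.setCell a (i.eval s) (j.eval s) (k.eval s) (e.eval s)) 1
  | seq {c d : Program} {s s' s'' : State} {T T' : ℕ} :
      Run c s s' T → Run d s' s'' T' → Run (.seq c d) s s'' (T + T')
  | ite_true {e : Expr} {c d : Program} {s s' : State} {T : ℕ} :
      e.eval s ≠ 0 → Run c s s' T → Run (.ite e c d) s s' (T + 1)
  | ite_false {e : Expr} {c d : Program} {s s' : State} {T : ℕ} :
      e.eval s = 0 → Run d s s' T → Run (.ite e c d) s s' (T + 1)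
  | loop_true {e : Expr} {c : Program} {s s' s'' : State} {T T' : ℕ} :
      e.eval s ≠ 0 → Run c s s' T → Run (.loop e c) s' s'' T' →
      Run (.loop e c) s s'' (T + T' + 1)
  | loop_false {e : Expr} {c : Program} {s : State} :
      e.eval s = 0 → Run (.loop e c) s s 1

open Classical in
/-- The initial state for a digraph `Q` on `{0, …, n - 1}` and a set `S` of its vertices: register
`0` holds `n`, array `0` the adjacency matrix of `Q` (entry `i, j, 0`), array `1` the
characteristic vector of `S` (entry `i, 0, 0`). Everything else is `0`. -/
noncomputable def input {n : ℕ} (Q : Digraph (Fin n)) (S : Finset (Fin n)) : State where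
  reg x := if x = 0 then n else 0
  cell a i j k :=
    if (a = 0 ∧ k = 0 ∧ ∃ u v : Fin n, i = u ∧ j = v ∧ Q.Adj u v) ∨
       (a = 1 ∧ j = 0 ∧ k = 0 ∧ ∃ u ∈ S, i = (u : ℕ)) then 1 else 0

/-- The state `s` displays the family `H 0, …, H (m - 1)` of subgraphs: register `1` holds `m`,
array `2` the characteristic vectors of the vertex sets (entry `k, u, 0`) and array `3` the
adjacency matrices (entry `k, u, v`). -/
def Displays {n m : ℕ} {Q : Digraph (Fin n)} (s : State) (H : Fin m → Digraph.Subdigraph Q) :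
    Prop :=
  s.reg 1 = m ∧
  (∀ (k : Fin m) (u : Fin n), s.cell 2 k u 0 = 1 ↔ u ∈ (H k).verts) ∧
  (∀ (k : Fin m) (u v : Fin n), s.cell 3 k u v = 1 ↔ (H k).Adj u v)

end RAM

/-! Call a set of vertices a module if no outside vertex distinguishes its elements, and call two
vertices equivalent if they are equal or lie in a common module that induces a non-strong digraph.
Two non-strong modules that meet have a non-strong union (`not_strongIn_union`), so this is an
equivalence relation; its classes are the blocks. In a quasi-transitive digraph every component of
the non-adjacency graph is a module, and it is non-strong if it has at least two vertices
(`not_isStrong_of_connected_nonAdj`). Hence vertices of different blocks are adjacent, and the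
blocks form a canonical decomposition. Conversely, each part of any canonical decomposition lies
inside a block, so every value of $n_0$ is at most the order $r$ of the smallest block. It therefore
suffices to find $r$ arc-disjoint spanning strong subgraphs, and the set $S$ plays no role.

Number the vertices of each block by ranks $0, 1, \dots$. Arcs between blocks whose two ends have
rank below $r$ receive one of $r$ colours, in such a way that in every colour each low vertex has a
low successor in every out-neighbouring block and a low predecessor in every in-neighbouring block.
A vertex of rank at least $r$ is joined, in colour $k$, to the vertices of rank $k$ in the
neighbouring blocks. Walks of blocks can then be followed within a colour, so a colour is strong
once the low vertices of a single block reach each other in it (`colourArc_reflTransGen`).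

If the quotient has a directed cycle of length two or four, the colour of $uv$ is the sum of the two
ranks modulo $r$, lowered by one on a single arc of that cycle. An arc of colour $k$ sends rank $x$
to $k - x$; after an even number of arcs, one of them shifted, the rank has become $x + 1$, which
gives a cyclic permutation (`goodRule_reflTransGen`). Otherwise the quotient is a directed triangle
(`isTriangle_blockType`). For $r \ne 2$ three explicit Latin squares, one for each side of the
triangle and depending on $r$ modulo $4$, make the walk around the triangle a single $r$-cycle in
every colour (`latinRound_reflTransGen`). For $r = 2$ two arc-disjoint closed walks are written down
in each of six situations, which use arcs inside blocks or blocks with more than two vertices; if no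
situation occurs in any rotation of the triangle, the digraph is exceptional
(`isExceptional_of_not_fits`).

For the running time, every notion above is expressed by formulas with quantifiers and sums over the
vertices, together with an $n$-fold iteration for module closures and for reachability. Such
formulas are compiled into programs with a polynomial time bound (`run_compile`, `Solves.fill`,
`Solves.iterate`), and the family is computed as a fixed sequence of array fillings. -/

open Finset

/-! ### Expressions with bounded summation and their compilation -/

namespace RAM

/-- Arithmetical expressions in variables and array cells with bounded summation. -/
inductive Ex : Type
  | size : Ex
  | const (m : ℕ) : Ex
  | var (x : ℕ) : Ex
  | cell (a : ℕ) (i j k : Ex) : Ex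
  | add (e f : Ex) : Ex
  | sub (e f : Ex) : Ex
  | cond (e f g : Ex) : Ex
  | sum (x : ℕ) (e : Ex) : Ex

namespace Ex

/-- The value of an expression, for the arrays `A`, the range `n` of summation and the values `ρ`
of the variables. -/
def eval (A : ℕ → ℕ → ℕ → ℕ → ℕ) (n : ℕ) : (ℕ → ℕ) → Ex → ℕ
  | _, size => n
  | _, const m => m
  | ρ, var x => ρ x
  | ρ, cell a i j k => A a (eval A n ρ i) (eval A n ρ j) (eval A n ρ k)
  | ρ, add e f => eval A n ρ e + eval A n ρ f
  | ρ, sub e f => eval A n ρ e - eval A n ρ f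
  | ρ, cond e f g => if eval A n ρ e ≠ 0 then eval A n ρ f else eval A n ρ g
  | ρ, sum x e => ∑ i ∈ range n, eval A n (Function.update ρ x i) e

/-- A strict upper bound for the variables that occur. -/
def bound : Ex → ℕ
  | size => 0
  | const _ => 0
  | var x => x + 1
  | cell _ i j k => max (bound i) (max (bound j) (bound k))
  | add e f => max (bound e) (bound f)
  | sub e f => max (bound e) (bound f)
  | cond e f g => max (bound e) (max (bound f) (bound g))
  | sum x e => max (x + 1) (bound e)

theorem eval_congr {A : ℕ → ℕ → ℕ → ℕ → ℕ} {n : ℕ} (e : Ex) :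
    ∀ {ρ σ : ℕ → ℕ}, (∀ x < e.bound, ρ x = σ x) → e.eval A n ρ = e.eval A n σ := by
  induction e with
  | size => intros; rfl
  | const m => intros; rfl
  | var x => intro ρ σ h; exact h x (Nat.lt_succ_self x)
  | cell a i j k hi hj hk =>
    intro ρ σ h
    simp only [bound, lt_max_iff] at h
    simp only [eval]
    rw [hi fun x hx => h x (.inl hx), hj fun x hx => h x (.inr (.inl hx)),
      hk fun x hx => h x (.inr (.inr hx))]
  | add e f he hf =>
    intro ρ σ h
    simp only [bound, lt_max_iff] at h
    simp only [eval]
    rw [he fun x hx => h x (.inl hx), hf fun x hx => h x (.inr hx)]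
  | sub e f he hf =>
    intro ρ σ h
    simp only [bound, lt_max_iff] at h
    simp only [eval]
    rw [he fun x hx => h x (.inl hx), hf fun x hx => h x (.inr hx)]
  | cond e f g he hf hg =>
    intro ρ σ h
    simp only [bound, lt_max_iff] at h
    simp only [eval]
    rw [he fun x hx => h x (.inl hx), hf fun x hx => h x (.inr (.inl hx)),
      hg fun x hx => h x (.inr (.inr hx))]
  | sum x e he =>
    intro ρ σ h
    simp only [bound, lt_max_iff] at h
    simp only [eval]
    refine Finset.sum_congr rfl fun i _ => he fun y hy => ?_
    by_cases hyx : y = x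
    · subst hyx; simp
    · simp [Function.update_of_ne hyx, h y (.inr hy)]

end Ex

/-- Counting register `x` from `0` up to the value of register `0`. -/
def Program.for (x : ℕ) (c : Program) : Program :=
  .seq (.assign x (.const 0))
    (.loop (.sub (.reg 0) (.reg x)) (.seq c (.assign x (.add (.reg x) (.const 1)))))

theorem State.setReg_reg (s : State) (x v y : ℕ) :
    (s.setReg x v).reg y = if y = x then v else s.reg y := by
  simp [State.setReg, Function.update_apply]

@[simp] theorem State.setReg_self (s : State) (x v : ℕ) : (s.setReg x v).reg x = v := by
  simp [State.setReg]

theorem State.setReg_ne (s : State) {x y : ℕ} (v : ℕ) (h : y ≠ x) :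
    (s.setReg x v).reg y = s.reg y := by
  simp [State.setReg, h]

@[simp] theorem State.setReg_cell (s : State) (x v : ℕ) : (s.setReg x v).cell = s.cell := rfl

@[simp] theorem State.setCell_reg (s : State) (a i j k v : ℕ) :
    (s.setCell a i j k v).reg = s.reg := rfl

/-- An invariant rule for counting loops: `I i` speaks of the state in which the counter has just
become `i`. Each round costs the body, the test and the increment; the additional `2` pays for the
initialisation and the last, failing test. -/
theorem run_for {x n B : ℕ} (hx : x ≠ 0) {c : Program} (I : ℕ → State → Prop)
    (hI : ∀ i < n, ∀ s, s.reg 0 = n → s.reg x = i → I i s → ∃ s' T, Run c s s' T ∧ T ≤ B ∧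
      s'.reg 0 = n ∧ s'.reg x = i ∧ I (i + 1) (s'.setReg x (i + 1)))
    (s : State) (h0 : s.reg 0 = n) (hs : I 0 (s.setReg x 0)) :
    ∃ s' T, Run (.for x c) s s' T ∧ T ≤ 2 + n * (B + 2) ∧ s'.reg 0 = n ∧ I n s' := by
  -- Induction on the number `d` of rounds that remain.
  have key : ∀ d i s, i + d = n → s.reg 0 = n → s.reg x = i → I i s → ∃ s' T,
      Run (.loop (.sub (.reg 0) (.reg x)) (.seq c (.assign x (.add (.reg x) (.const 1)))))
        s s' T ∧ T ≤ 1 + d * (B + 2) ∧ s'.reg 0 = n ∧ I n s' := by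
    intro d
    induction d with
    | zero =>
      intro i s hi h0 hx hs
      refine ⟨s, 1, .loop_false ?_, by omega, h0, ?_⟩
      · simp only [Expr.eval]; omega
      · obtain rfl : i = n := by omega
        exact hs
    | succ d ih =>
      intro i s hi h0 hxi hs
      obtain ⟨s1, T1, r1, ht1, h01, hx1, hI1⟩ := hI i (by omega) s h0 hxi hs
      obtain ⟨s2, T2, r2, ht2, h02, hI2⟩ := ih (i + 1) (s1.setReg x (i + 1)) (by omega)
        (by rw [State.setReg_ne _ _ hx.symm, h01]) (by simp) hI1
      refine ⟨s2, T1 + 1 + T2 + 1, .loop_true ?_ (.seq r1 ?_) r2, ?_, h02, hI2⟩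
      · simp only [Expr.eval]; omega
      · have := Run.assign s1 x (.add (.reg x) (.const 1))
        simpa [Expr.eval, hx1] using this
      · have : (d + 1) * (B + 2) = d * (B + 2) + (B + 2) := by ring
        omega
  obtain ⟨s', T, r, hT, h0', hI'⟩ := key n 0 (s.setReg x 0) (by omega)
    (by rw [State.setReg_ne _ _ hx.symm, h0]) (by simp) hs
  exact ⟨s', 1 + T, .seq (.assign s x (.const 0)) r, by omega, h0', hI'⟩

namespace Ex

/-- The program that computes the value of an expression into register `N`; the registers from `N`
on are used, and variable `x` is kept in register `x + 2`. -/
def compile : Ex → ℕ → Program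
  | size, N => .assign N (.reg 0)
  | const m, N => .assign N (.const m)
  | var x, N => .assign N (.reg (x + 2))
  | cell a i j k, N => .seq (compile i N) (.seq (compile j (N + 1)) (.seq (compile k (N + 2))
      (.assign N (.cell a (.reg N) (.reg (N + 1)) (.reg (N + 2))))))
  | add e f, N => .seq (compile e N) (.seq (compile f (N + 1))
      (.assign N (.add (.reg N) (.reg (N + 1)))))
  | sub e f, N => .seq (compile e N) (.seq (compile f (N + 1))
      (.assign N (.sub (.reg N) (.reg (N + 1)))))
  | cond e f g, N => .seq (compile e N) (.ite (.reg N) (compile f N) (compile g N))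
  | sum x e, N => .seq (.assign N (.reg (x + 2))) (.seq (.assign (N + 1) (.const 0))
      (.seq (.for (x + 2) (.seq (compile e (N + 2))
          (.assign (N + 1) (.add (.reg (N + 1)) (.reg (N + 2))))))
        (.seq (.assign (x + 2) (.reg N)) (.assign N (.reg (N + 1))))))

open Polynomial in
/-- A bound for the time that the evaluation takes. -/
noncomputable def cost : Ex → Polynomial ℕ
  | size => 1
  | const _ => 1
  | var _ => 1
  | cell _ i j k => cost i + cost j + cost k + 1
  | add e f => cost e + cost f + 1
  | sub e f => cost e + cost f + 1
  | cond e f g => cost e + cost f + cost g + 1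
  | sum _ e => X * (cost e + 3) + 6

/-- Induction on the expression. That registers below `N` and all arrays survive is what allows
subexpressions to be evaluated one after another, each with its own, higher scratch area. -/
theorem run_compile (e : Ex) : ∀ (N : ℕ), e.bound + 2 ≤ N → ∀ s : State, ∃ s' T,
    Run (e.compile N) s s' T ∧ T ≤ e.cost.eval (s.reg 0) ∧
      s'.reg N = e.eval s.cell (s.reg 0) (fun x => s.reg (x + 2)) ∧ s'.cell = s.cell ∧
      ∀ x < N, s'.reg x = s.reg x := by
  induction e with
  | size =>
    intro N hN s
    exact ⟨_, _, .assign s _ _, by simp [cost], by simp [Expr.eval, eval], rfl,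
      fun x hx => State.setReg_ne _ _ hx.ne⟩
  | const m =>
    intro N hN s
    exact ⟨_, _, .assign s _ _, by simp [cost], by simp [Expr.eval, eval], rfl,
      fun x hx => State.setReg_ne _ _ hx.ne⟩
  | var x =>
    intro N hN s
    exact ⟨_, _, .assign s _ _, by simp [cost], by simp [Expr.eval, eval], rfl,
      fun x hx => State.setReg_ne _ _ hx.ne⟩
  | cell a i j k hi hj hk =>
    intro N hN s
    simp only [bound] at hN
    obtain ⟨s1, T1, r1, t1, v1, c1, e1⟩ := hi N (by omega) s
    obtain ⟨s2, T2, r2, t2, v2, c2, e2⟩ := hj (N + 1) (by omega) s1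
    obtain ⟨s3, T3, r3, t3, v3, c3, e3⟩ := hk (N + 2) (by omega) s2
    refine ⟨_, _, .seq r1 (.seq r2 (.seq r3 (.assign _ _ _))), ?_, ?_, ?_, ?_⟩
    · rw [e2 0 (by omega), e1 0 (by omega)] at t3
      rw [e1 0 (by omega)] at t2
      simp only [cost, Polynomial.eval_add, Polynomial.eval_one]
      omega
    · simp only [State.setReg_self, Expr.eval, eval]
      rw [e3 N (by omega), e2 N (by omega), v1, e3 (N + 1) (by omega), v2, v3, c3, c2, c1,
        e2 0 (by omega), e1 0 (by omega),
        eval_congr j fun x hx => e1 (x + 2) (by omega),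
        eval_congr k fun x hx => (e2 (x + 2) (by omega)).trans (e1 (x + 2) (by omega))]
    · simp [c3, c2, c1]
    · intro x hx
      rw [State.setReg_ne _ _ hx.ne, e3 x (by omega), e2 x (by omega), e1 x hx]
  | add e f he hf =>
    intro N hN s
    simp only [bound] at hN
    obtain ⟨s1, T1, r1, t1, v1, c1, e1⟩ := he N (by omega) s
    obtain ⟨s2, T2, r2, t2, v2, c2, e2⟩ := hf (N + 1) (by omega) s1
    refine ⟨_, _, .seq r1 (.seq r2 (.assign _ _ _)), ?_, ?_, ?_, ?_⟩
    · rw [e1 0 (by omega)] at t2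
      simp only [cost, Polynomial.eval_add, Polynomial.eval_one]
      omega
    · simp only [State.setReg_self, Expr.eval, eval]
      rw [e2 N (by omega), v1, v2, c1, e1 0 (by omega),
        eval_congr f fun x hx => e1 (x + 2) (by omega)]
    · simp [c2, c1]
    · intro x hx
      rw [State.setReg_ne _ _ hx.ne, e2 x (by omega), e1 x hx]
  | sub e f he hf =>
    intro N hN s
    simp only [bound] at hN
    obtain ⟨s1, T1, r1, t1, v1, c1, e1⟩ := he N (by omega) s
    obtain ⟨s2, T2, r2, t2, v2, c2, e2⟩ := hf (N + 1) (by omega) s1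
    refine ⟨_, _, .seq r1 (.seq r2 (.assign _ _ _)), ?_, ?_, ?_, ?_⟩
    · rw [e1 0 (by omega)] at t2
      simp only [cost, Polynomial.eval_add, Polynomial.eval_one]
      omega
    · simp only [State.setReg_self, Expr.eval, eval]
      rw [e2 N (by omega), v1, v2, c1, e1 0 (by omega),
        eval_congr f fun x hx => e1 (x + 2) (by omega)]
    · simp [c2, c1]
    · intro x hx
      rw [State.setReg_ne _ _ hx.ne, e2 x (by omega), e1 x hx]
  | cond e f g he hf hg =>
    intro N hN s
    simp only [bound] at hN
    obtain ⟨s1, T1, r1, t1, v1, c1, e1⟩ := he N (by omega) s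
    by_cases h : s1.reg N = 0
    · obtain ⟨s2, T2, r2, t2, v2, c2, e2⟩ := hg N (by omega) s1
      refine ⟨_, _, .seq r1 (.ite_false h r2), ?_, ?_, c2.trans c1, ?_⟩
      · rw [e1 0 (by omega)] at t2
        simp only [cost, Polynomial.eval_add, Polynomial.eval_one]
        omega
      · rw [v2, c1, e1 0 (by omega), eval_congr g fun x hx => e1 (x + 2) (by omega)]
        simp [eval, ← v1, h]
      · intro x hx
        rw [e2 x hx, e1 x hx]
    · obtain ⟨s2, T2, r2, t2, v2, c2, e2⟩ := hf N (by omega) s1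
      refine ⟨_, _, .seq r1 (.ite_true h r2), ?_, ?_, c2.trans c1, ?_⟩
      · rw [e1 0 (by omega)] at t2
        simp only [cost, Polynomial.eval_add, Polynomial.eval_one]
        omega
      · rw [v2, c1, e1 0 (by omega), eval_congr f fun x hx => e1 (x + 2) (by omega)]
        simp [eval, ← v1, h]
      · intro x hx
        rw [e2 x hx, e1 x hx]
  | sum x e he =>
    intro N hN s
    simp only [bound] at hN
    set s1 := (s.setReg N (s.reg (x + 2))).setReg (N + 1) 0 with hs1
    have h1 : ∀ y < N, s1.reg y = s.reg y := fun y hy => by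
      rw [hs1, State.setReg_ne _ _ (by omega), State.setReg_ne _ _ (by omega)]
    have h1N : s1.reg N = s.reg (x + 2) := by
      rw [hs1, State.setReg_ne _ _ (by omega), State.setReg_self]
    have h10 : s1.reg 0 = s.reg 0 := h1 0 (by omega)
    -- Register `N` saves the outer value of the summation variable and `N + 1` holds the partial
    -- sum. Register `x + 2` is exempt from preservation because it is the loop counter; it is
    -- restored from `N` after the loop.
    let I : ℕ → State → Prop := fun i t => t.cell = s.cell ∧ t.reg N = s.reg (x + 2) ∧
      (∀ y < N, y ≠ x + 2 → t.reg y = s.reg y) ∧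
      t.reg (N + 1) = ∑ m ∈ range i,
        eval s.cell (s.reg 0) (Function.update (fun y => s.reg (y + 2)) x m) e
    obtain ⟨s2, T2, r2, t2, h20, hc2, hN2, he2, hv2⟩ := run_for (x := x + 2) (n := s.reg 0)
      (B := e.cost.eval (s.reg 0) + 1) (by omega)
      (c := .seq (compile e (N + 2)) (.assign (N + 1) (.add (.reg (N + 1)) (.reg (N + 2))))) I
      (by
        rintro i hi t ht0 htx ⟨hc, hN', hy, hv⟩
        obtain ⟨t1, T1, r1, ht1, v1, c1, e1⟩ := he (N + 2) (by omega) t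
        refine ⟨_, _, .seq r1 (.assign _ _ _), ?_, ?_, ?_, ?_, ?_, ?_, ?_⟩
        · rw [ht0] at ht1; omega
        · rw [State.setReg_ne _ _ (by omega), e1 0 (by omega), ht0]
        · rw [State.setReg_ne _ _ (by omega), e1 _ (by omega), htx]
        · simp [c1, hc]
        · rw [State.setReg_ne _ _ (by omega), State.setReg_ne _ _ (by omega), e1 _ (by omega), hN']
        · intro y hyN hyx
          rw [State.setReg_ne _ _ hyx, State.setReg_ne _ _ (by omega), e1 _
            (by omega), hy y hyN hyx]
        · rw [State.setReg_ne _ _ (by omega), State.setReg_self]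
          simp only [Expr.eval]
          rw [e1 (N + 1) (by omega), hv, v1, hc, ht0, Finset.sum_range_succ]
          congr 1
          refine eval_congr e fun y hyb => ?_
          by_cases hyx : y = x
          · subst hyx; simp [htx]
          · rw [Function.update_of_ne hyx]
            exact hy _ (by omega) (by omega))
      s1 h10 (by
        refine ⟨rfl, ?_, ?_, ?_⟩
        · rw [State.setReg_ne _ _ (by omega), h1N]
        · intro y hy hyx
          rw [State.setReg_ne _ _ hyx, h1 y hy]
        · rw [State.setReg_ne _ _ (by omega)]
          simp [hs1])
    refine ⟨_, _, .seq (.assign _ _ _) (.seq (.assign _ _ _) (.seq r2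
      (.seq (.assign _ _ _) (.assign _ _ _)))), ?_, ?_, ?_, ?_⟩
    · simp only [cost, Polynomial.eval_add, Polynomial.eval_mul, Polynomial.eval_X,
        Polynomial.eval_ofNat]
      have : s.reg 0 * (e.cost.eval (s.reg 0) + 1 + 2) = s.reg 0 * (e.cost.eval (s.reg 0) + 3) := by
        ring
      omega
    · simp only [State.setReg_self, Expr.eval, eval]
      rw [State.setReg_ne _ _ (by omega), hv2]
    · simpa using hc2
    · intro y hy
      rw [State.setReg_ne _ _ (by omega), State.setReg_reg]
      split_ifs with h
      · simp [Expr.eval, hN2, h]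
      · exact he2 y hy h

end Ex

end RAM

/-! ### Filling and iterating arrays in polynomial time -/

namespace RAM

open Classical in
/-- The arrays `A` with the entries of array `a` at the indices in `D` replaced by those of `f`. -/
noncomputable def patch (A : ℕ → ℕ → ℕ → ℕ → ℕ) (a : ℕ) (D : ℕ → ℕ → ℕ → Prop)
    (f : ℕ → ℕ → ℕ → ℕ) : ℕ → ℕ → ℕ → ℕ → ℕ :=
  fun b i j k => if b = a ∧ D i j k then f i j k else A b i j k

theorem patch_of_ne {A : ℕ → ℕ → ℕ → ℕ → ℕ} {a : ℕ} {D : ℕ → ℕ → ℕ → Prop}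
    {f : ℕ → ℕ → ℕ → ℕ} {b : ℕ} (h : b ≠ a) : patch A a D f b = A b := by
  funext i j k; simp [patch, h]

theorem patch_congr {A : ℕ → ℕ → ℕ → ℕ → ℕ} {a : ℕ} {D D' : ℕ → ℕ → ℕ → Prop}
    {f : ℕ → ℕ → ℕ → ℕ} (h : ∀ i j k, D i j k ↔ D' i j k) : patch A a D f = patch A a D' f := by
  have : D = D' := by funext i j k; exact propext (h i j k)
  rw [this]

theorem patch_setCell {s : State} {A : ℕ → ℕ → ℕ → ℕ → ℕ} {a : ℕ} {D D' : ℕ → ℕ → ℕ → Prop}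
    {f : ℕ → ℕ → ℕ → ℕ} {i j k : ℕ} (hs : s.cell = patch A a D f)
    (h : ∀ i' j' k', D' i' j' k' ↔ D i' j' k' ∨ (i' = i ∧ j' = j ∧ k' = k)) :
    (s.setCell a i j k (f i j k)).cell = patch A a D' f := by
  funext b i' j' k'
  have hD := h i' j' k'
  by_cases hb : b = a ∧ i' = i ∧ j' = j ∧ k' = k
  · have hb' := hb
    obtain ⟨rfl, rfl, rfl, rfl⟩ := hb'
    have : D' i' j' k' := hD.2 (.inr ⟨rfl, rfl, rfl⟩)
    simp [State.setCell, patch, this]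
  · have hc : (s.setCell a i j k (f i j k)).cell b i' j' k' = s.cell b i' j' k' := if_neg hb
    rw [hc, hs]
    by_cases hba : b = a
    · have : D' i' j' k' ↔ D i' j' k' := by
        rw [hD, or_iff_left fun h => hb ⟨hba, h⟩]
      unfold patch
      by_cases hd : D i' j' k'
      · rw [if_pos ⟨hba, hd⟩, if_pos ⟨hba, this.2 hd⟩]
      · rw [if_neg fun h => hd h.2, if_neg fun h => hd (this.1 h.2)]
    · simp [patch, hba]

namespace Program

/-- The scratch registers for the evaluation of `e` begin here. -/
def base (e : Ex) : ℕ := max e.bound 3 + 2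

/-- Set the entries `i, j, k` of array `a` to the value of `e`, the variables `0, 1, 2` being
`i, j, k`. -/
def fill (a : ℕ) (e : Ex) : Program :=
  .for 2 (.for 3 (.for 4 (.seq (e.compile (base e))
    (.store a (.reg 2) (.reg 3) (.reg 4) (.reg (base e))))))

/-- Repeat as often as register `0` says: replace the entries of array `a` by the value of `e`,
with array `b` as a buffer. -/
def iterate (a b : ℕ) (e : Ex) : Program :=
  .for 1 (.seq (fill b e) (fill a (.cell b (.var 0) (.var 1) (.var 2))))

end Program

open Polynomial in
/-- A bound for the time that filling an array takes. -/
noncomputable def fillCost (e : Ex) : Polynomial ℕ :=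
  2 + X * (2 + X * (2 + X * (e.cost + 1 + 2) + 2) + 2)

/-- The value of `e` has to be right whatever array `a` contains, because this array is already
partly overwritten when `e` is evaluated. The invariants of the three nested loops describe the
triples treated so far, in lexicographic order. -/
theorem run_fill (a : ℕ) (e : Ex) (f : ℕ → ℕ → ℕ → ℕ) (s : State)
    (hf : ∀ A, (∀ b, b ≠ a → A b = s.cell b) → ∀ i < s.reg 0, ∀ j < s.reg 0, ∀ k < s.reg 0,
      ∀ ρ : ℕ → ℕ, ρ 0 = i → ρ 1 = j → ρ 2 = k → e.eval A (s.reg 0) ρ = f i j k) :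
    ∃ s' T, Run (.fill a e) s s' T ∧ T ≤ (fillCost e).eval (s.reg 0) ∧ s'.reg 0 = s.reg 0 ∧
      s'.reg 1 = s.reg 1 ∧ s'.cell = patch s.cell a
        (fun i j k => i < s.reg 0 ∧ j < s.reg 0 ∧ k < s.reg 0) f := by
  set n := s.reg 0 with hn
  set A := s.cell with hA
  set r := s.reg 1 with hr
  -- Scratch registers begin at `5` or later, so the order in register `0`, the iteration counter in
  -- register `1` and the three indices are not disturbed.
  have hb : 5 ≤ Program.base e := by simp only [Program.base]; omega
  have hb' : e.bound + 2 ≤ Program.base e := by simp only [Program.base]; omega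
  obtain ⟨s', T, h1, h2, h3, h4, h5⟩ := run_for (x := 2) (n := n)
    (B := 2 + n * (2 + n * (e.cost.eval n + 1 + 2) + 2)) (by decide)
    (c := .for 3 (.for 4 (.seq (e.compile (Program.base e))
      (.store a (.reg 2) (.reg 3) (.reg 4) (.reg (Program.base e))))))
    (fun i t => t.reg 1 = r ∧
      t.cell = patch A a (fun i' j' k' => i' < i ∧ j' < n ∧ k' < n) f)
    (by
      rintro i hi t ht0 htx ⟨ht1, htc⟩
      obtain ⟨t', T, h1, h2, h3, h4, h5, h6⟩ := run_for (x := 3) (n := n)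
        (B := 2 + n * (e.cost.eval n + 1 + 2)) (by decide)
        (c := .for 4 (.seq (e.compile (Program.base e))
          (.store a (.reg 2) (.reg 3) (.reg 4) (.reg (Program.base e)))))
        (fun j t => t.reg 1 = r ∧ t.reg 2 = i ∧
          t.cell = patch A a (fun i' j' k' => (i' < i ∧ j' < n ∧ k' < n) ∨
            (i' = i ∧ j' < j ∧ k' < n)) f)
        (by
          rintro j hj u hu0 hux ⟨hu1, hu2, huc⟩
          obtain ⟨u', T, h1, h2, h3, h4, h5, h6, h7⟩ := run_for (x := 4) (n := n)
            (B := e.cost.eval n + 1) (by decide)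
            (c := .seq (e.compile (Program.base e))
              (.store a (.reg 2) (.reg 3) (.reg 4) (.reg (Program.base e))))
            (fun k t => t.reg 1 = r ∧ t.reg 2 = i ∧ t.reg 3 = j ∧
              t.cell = patch A a (fun i' j' k' => ((i' < i ∧ j' < n ∧ k' < n) ∨
                (i' = i ∧ j' < j ∧ k' < n)) ∨ (i' = i ∧ j' = j ∧ k' < k)) f)
            (by
              rintro k hk v hv0 hvx ⟨hv1, hv2, hv3, hvc⟩
              obtain ⟨w, T, h1, h2, h3, h4, h5⟩ := e.run_compile (Program.base e) hb' v
              have hval : w.reg (Program.base e) = f i j k := by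
                rw [h3, hv0]
                exact hf _ (fun b hb => by rw [hvc, patch_of_ne hb]) i hi j hj k hk _ hv2 hv3 hvx
              have hcell : (w.setCell a (w.reg 2) (w.reg 3) (w.reg 4)
                  (w.reg (Program.base e))).cell =
                  patch A a (fun i' j' k' => ((i' < i ∧ j' < n ∧ k' < n) ∨
                (i' = i ∧ j' < j ∧ k' < n)) ∨ (i' = i ∧ j' = j ∧ k' < k + 1)) f := by
                rw [hval, h5 2 (by omega), h5 3 (by omega), h5 4 (by omega), hv2, hv3, hvx]
                refine patch_setCell (h4.trans hvc) fun i' j' k' => ?_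
                omega
              refine ⟨_, _, .seq h1 (.store _ _ _ _ _ _), ?_, ?_, ?_, ?_, ?_, ?_, ?_⟩
              · rw [hv0] at h2; omega
              · rw [State.setCell_reg, h5 0 (by omega), hv0]
              · rw [State.setCell_reg, h5 4 (by omega), hvx]
              · rw [State.setReg_ne _ _ (by omega), State.setCell_reg, h5 1 (by omega), hv1]
              · rw [State.setReg_ne _ _ (by omega), State.setCell_reg, h5 2 (by omega), hv2]
              · rw [State.setReg_ne _ _ (by omega), State.setCell_reg, h5 3 (by omega), hv3]
              · rw [State.setReg_cell]; exact hcell)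
            u hu0 (by
              refine ⟨?_, ?_, ?_, ?_⟩
              · rw [State.setReg_ne _ _ (by omega), hu1]
              · rw [State.setReg_ne _ _ (by omega), hu2]
              · rw [State.setReg_ne _ _ (by omega), hux]
              · rw [State.setReg_cell, huc]
                exact patch_congr fun i' j' k' => by omega)
          refine ⟨u', T, h1, h2, h3, h6, ?_, ?_, ?_⟩
          · rw [State.setReg_ne _ _ (by omega), h4]
          · rw [State.setReg_ne _ _ (by omega), h5]
          · rw [State.setReg_cell, h7]
            exact patch_congr fun i' j' k' => by omega)
        t ht0 (by
          refine ⟨?_, ?_, ?_⟩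
          · rw [State.setReg_ne _ _ (by omega), ht1]
          · rw [State.setReg_ne _ _ (by omega), htx]
          · rw [State.setReg_cell, htc]
            exact patch_congr fun i' j' k' => by omega)
      refine ⟨t', T, h1, h2, h3, h5, ?_, ?_⟩
      · rw [State.setReg_ne _ _ (by omega), h4]
      · rw [State.setReg_cell, h6]
        exact patch_congr fun i' j' k' => by omega)
    s rfl (by
      refine ⟨?_, ?_⟩
      · rw [State.setReg_ne _ _ (by omega)]
      · rw [State.setReg_cell]
        funext b i j k
        simp [patch, hA])
  refine ⟨s', T, h1, ?_, h3, h4, h5⟩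
  simpa [fillCost] using h2

/-- A family of three-dimensional arrays that depends on a digraph. -/
abbrev Spec : Type := ∀ n, Digraph (Fin n) → Fin n → Fin n → Fin n → ℕ

/-- For all pairs `(a, f)` in the list, array `a` is `f`. -/
def Knows (L : List (ℕ × Spec)) (n : ℕ) (Q : Digraph (Fin n)) (A : ℕ → ℕ → ℕ → ℕ → ℕ) : Prop :=
  ∀ p ∈ L, ∀ i j k : Fin n, A p.1 i j k = p.2 n Q i j k

/-- There is a program that produces in polynomial time the arrays in `L'` from those in `L`. -/
def Solves (L L' : List (ℕ × Spec)) : Prop :=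
  ∃ (c : Program) (p : Polynomial ℕ), ∀ (n : ℕ) (Q : Digraph (Fin n)) (s : State),
    s.reg 0 = n → Knows L n Q s.cell →
    ∃ s' T, Run c s s' T ∧ T ≤ p.eval n ∧ s'.reg 0 = n ∧ Knows L' n Q s'.cell

theorem Solves.trans {L₁ L₂ L₃ : List (ℕ × Spec)} (h : Solves L₁ L₂) (h' : Solves L₂ L₃) :
    Solves L₁ L₃ := by
  obtain ⟨c, p, hc⟩ := h
  obtain ⟨d, q, hd⟩ := h'
  refine ⟨.seq c d, p + q, fun n Q s h0 hs => ?_⟩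
  obtain ⟨s1, T1, r1, t1, h1, k1⟩ := hc n Q s h0 hs
  obtain ⟨s2, T2, r2, t2, h2, k2⟩ := hd n Q s1 h1 k1
  exact ⟨s2, T1 + T2, .seq r1 r2, by rw [Polynomial.eval_add]; omega, h2, k2⟩

theorem Knows.congr {L : List (ℕ × Spec)} {n : ℕ} {Q : Digraph (Fin n)}
    {A A' : ℕ → ℕ → ℕ → ℕ → ℕ} (h : Knows L n Q A) (hA : ∀ p ∈ L, A' p.1 = A p.1) :
    Knows L n Q A' := fun p hp i j k => by rw [hA p hp, h p hp]

theorem Knows.mono {L L' : List (ℕ × Spec)} {n : ℕ} {Q : Digraph (Fin n)}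
    {A : ℕ → ℕ → ℕ → ℕ → ℕ} (h : Knows L n Q A) (hL : L' ⊆ L) : Knows L' n Q A :=
  fun p hp => h p (hL hp)

theorem Knows.cons {L : List (ℕ × Spec)} {n : ℕ} {Q : Digraph (Fin n)} {a : ℕ} {f : Spec}
    {A : ℕ → ℕ → ℕ → ℕ → ℕ} (h : Knows L n Q A) (hf : ∀ i j k : Fin n, A a i j k = f n Q i j k) :
    Knows ((a, f) :: L) n Q A := by
  intro p hp
  rcases List.mem_cons.1 hp with rfl | hp
  · exact hf
  · exact h p hp

/-- `e` evaluates to `f` when the arrays are as in `L`. -/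
def Ex.Is (L : List (ℕ × Spec)) (e : Ex) (f : Spec) : Prop :=
  ∀ n Q A, Knows L n Q A → ∀ (ρ : ℕ → ℕ) (i j k : Fin n), ρ 0 = i → ρ 1 = j → ρ 2 = k →
    e.eval A n ρ = f n Q i j k

theorem run_fill_knows {L : List (ℕ × Spec)} {a : ℕ} {e : Ex} {f : Spec} (ha : ∀ p ∈ L, p.1 ≠ a)
    (he : e.Is L f) {n : ℕ} {Q : Digraph (Fin n)} {s : State} (h0 : s.reg 0 = n)
    (hs : Knows L n Q s.cell) :
    ∃ s' T, Run (.fill a e) s s' T ∧ T ≤ (fillCost e).eval n ∧ s'.reg 0 = n ∧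
      s'.reg 1 = s.reg 1 ∧ Knows ((a, f) :: L) n Q s'.cell := by
  subst h0
  obtain ⟨s', T, h1, h2, h3, h4, h5⟩ := run_fill a e (fun i j k =>
      if h : i < s.reg 0 ∧ j < s.reg 0 ∧ k < s.reg 0 then
        f (s.reg 0) Q ⟨i, h.1⟩ ⟨j, h.2.1⟩ ⟨k, h.2.2⟩ else 0) s (by
    intro A hA i hi j hj k hk ρ h0 h1 h2
    rw [dif_pos ⟨hi, hj, hk⟩]
    exact he _ Q A (hs.congr fun p hp => hA _ (ha p hp)) ρ ⟨i, hi⟩ ⟨j, hj⟩ ⟨k, hk⟩ h0 h1 h2)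
  refine ⟨s', T, h1, h2, h3, h4, (hs.congr fun p hp => ?_).cons fun i j k => ?_⟩
  · rw [h5, patch_of_ne (ha p hp)]
  · rw [h5]
    simp [patch]

theorem Solves.fill {L : List (ℕ × Spec)} (a : ℕ) (e : Ex) (f : Spec) (ha : ∀ p ∈ L, p.1 ≠ a)
    (he : e.Is L f) : Solves L ((a, f) :: L) := by
  refine ⟨.fill a e, fillCost e, fun n Q s h0 hs => ?_⟩
  obtain ⟨s', T, h1, h2, h3, -, h4⟩ := run_fill_knows ha he h0 hs
  exact ⟨s', T, h1, h2, h3, h4⟩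

/-- A round needs the whole previous content of array `a`, so the new content is written to the
buffer `b` and then copied back. In `f n n` the first `n` is the number of rounds and the second the
order of the digraph. -/
theorem Solves.iterate {L : List (ℕ × Spec)} (a b : ℕ) (e : Ex) (f : ℕ → Spec) (hab : a ≠ b)
    (ha : ∀ p ∈ L, p.1 ≠ a) (hb : ∀ p ∈ L, p.1 ≠ b)
    (he : ∀ m, e.Is ((a, f m) :: L) (f (m + 1))) :
    Solves ((a, f 0) :: L) ((a, fun n => f n n) :: L) := by
  refine ⟨.iterate a b e, 2 + Polynomial.X * (fillCost e +
    fillCost (.cell b (.var 0) (.var 1) (.var 2)) + 2), fun n Q s h0 hs => ?_⟩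
  obtain ⟨s', T, h1, h2, h3, h4⟩ := run_for (x := 1) (n := n)
    (B := (fillCost e).eval n + (fillCost (.cell b (.var 0) (.var 1) (.var 2))).eval n)
    (by decide)
    (c := .seq (.fill b e) (.fill a (.cell b (.var 0) (.var 1) (.var 2))))
    (fun m t => Knows ((a, f m) :: L) n Q t.cell)
    (by
      intro i hi t ht0 ht1 hk
      obtain ⟨s1, T1, r1, t1, z1, o1, k1⟩ := run_fill_knows (a := b) (e := e) (f := f (i + 1))
        (L := (a, f i) :: L) (by
          intro p hp
          rcases List.mem_cons.1 hp with rfl | hp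
          · exact hab
          · exact hb p hp) (he i) ht0 hk
      obtain ⟨s2, T2, r2, t2, z2, o2, k2⟩ := run_fill_knows (a := a)
        (e := .cell b (.var 0) (.var 1) (.var 2)) (f := f (i + 1))
        (L := (b, f (i + 1)) :: L) (by
          intro p hp
          rcases List.mem_cons.1 hp with rfl | hp
          · exact hab.symm
          · exact ha p hp) (by
          intro n Q A hA ρ i' j k h0 h1 h2
          simp only [Ex.eval, h0, h1, h2]
          exact hA _ (List.mem_cons_self ..) i' j k) z1
        (k1.mono (by intro p hp; simp only [List.mem_cons] at hp ⊢; tauto))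
      refine ⟨s2, T1 + T2, .seq r1 r2, by omega, z2, by rw [o2, o1, ht1], ?_⟩
      refine k2.mono ?_
      intro p hp; simp only [List.mem_cons] at hp ⊢; tauto)
    s h0 hs
  refine ⟨s', T, h1, by simpa using h2, h3, ?_⟩
  exact Knows.cons (fun p hp => h4 p (List.mem_cons_of_mem _ hp)) (h4 _ (List.mem_cons_self ..))

namespace Ex

/-- `e` has a value different from `0`. -/
def Sat (A : ℕ → ℕ → ℕ → ℕ → ℕ) (n : ℕ) (ρ : ℕ → ℕ) (e : Ex) : Prop := e.eval A n ρ ≠ 0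

/-- Conjunction. -/
def and (e f : Ex) : Ex := .cond e f (.const 0)
/-- Disjunction. -/
def or (e f : Ex) : Ex := .add e f
/-- Negation. -/
def not (e : Ex) : Ex := .cond e (.const 0) (.const 1)
/-- The first expression has a smaller value than the second. -/
def lt (e f : Ex) : Ex := .sub f e
/-- The two expressions have equal values. -/
def eq (e f : Ex) : Ex := .not (.add (.sub e f) (.sub f e))
/-- Existential quantifier over the numbers smaller than `n`. -/
def ex (x : ℕ) (e : Ex) : Ex := .sum x e
/-- The truth value, `0` or `1`. -/
def bool (e : Ex) : Ex := .cond e (.const 1) (.const 0)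
/-- The value of the first expression is at most that of the second. -/
def le (e f : Ex) : Ex := .not (.lt f e)

variable {A : ℕ → ℕ → ℕ → ℕ → ℕ} {n : ℕ} {ρ : ℕ → ℕ} {e f : Ex}

theorem sat_and : (e.and f).Sat A n ρ ↔ e.Sat A n ρ ∧ f.Sat A n ρ := by
  simp only [Sat, and, eval]
  split_ifs with h <;> simp [h]

theorem sat_or : (e.or f).Sat A n ρ ↔ e.Sat A n ρ ∨ f.Sat A n ρ := by
  simp only [Sat, or, eval]
  omega

theorem sat_not : e.not.Sat A n ρ ↔ ¬ e.Sat A n ρ := by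
  simp only [Sat, not, eval]
  split_ifs with h <;> simp [h]

theorem sat_lt : (e.lt f).Sat A n ρ ↔ e.eval A n ρ < f.eval A n ρ := by
  simp only [Sat, lt, eval]
  omega

theorem sat_le : (e.le f).Sat A n ρ ↔ e.eval A n ρ ≤ f.eval A n ρ := by
  rw [le, sat_not, sat_lt, not_lt]

theorem sat_eq : (e.eq f).Sat A n ρ ↔ e.eval A n ρ = f.eval A n ρ := by
  rw [eq, sat_not]
  simp only [Sat, eval]
  omega

theorem sat_ex {x : ℕ} :
    (e.ex x).Sat A n ρ ↔ ∃ i : Fin n, e.Sat A n (Function.update ρ x (i : ℕ)) := by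
  simp only [Sat, ex, eval, ne_eq, Finset.sum_eq_zero_iff, Finset.mem_range, not_forall]
  constructor
  · rintro ⟨i, hi, h⟩; exact ⟨⟨i, hi⟩, h⟩
  · rintro ⟨i, h⟩; exact ⟨i, i.2, h⟩

open Classical in
theorem eval_bool : e.bool.eval A n ρ = if e.Sat A n ρ then 1 else 0 := by
  simp only [bool, eval, Sat]
  by_cases h : eval A n ρ e = 0 <;> simp [h]

open Classical in
theorem eval_sum_bool {x : ℕ} : (Ex.sum x e.bool).eval A n ρ =
    #{i : Fin n | e.Sat A n (Function.update ρ x (i : ℕ))} := by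
  simp only [eval, eval_bool]
  rw [Finset.sum_range (fun i => if e.Sat A n (Function.update ρ x i) then 1 else 0)]
  simp

end Ex

/-- Copy the entry `0, 0, 0` of array `a` to register `1`. -/
theorem Solves.finish {L L' : List (ℕ × Spec)} (h : Solves L L') {a : ℕ} {f : Spec}
    (hf : (a, f) ∈ L') : ∃ (c : Program) (p : Polynomial ℕ), ∀ (n : ℕ) (hn : 0 < n)
    (Q : Digraph (Fin n)) (s : State), s.reg 0 = n → Knows L n Q s.cell →
    ∃ s' T, Run c s s' T ∧ T ≤ p.eval n ∧ Knows L' n Q s'.cell ∧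
      s'.reg 1 = f n Q ⟨0, hn⟩ ⟨0, hn⟩ ⟨0, hn⟩ := by
  obtain ⟨c, p, hc⟩ := h
  refine ⟨.seq c (.assign 1 (.cell a (.const 0) (.const 0) (.const 0))), p + 1,
    fun n hn Q s h0 hs => ?_⟩
  obtain ⟨s1, T1, r1, t1, h1, k1⟩ := hc n Q s h0 hs
  refine ⟨_, _, .seq r1 (.assign _ _ _), ?_, k1, ?_⟩
  · simpa using t1
  · simp only [State.setReg_self, Expr.eval]
    exact k1 _ hf ⟨0, hn⟩ ⟨0, hn⟩ ⟨0, hn⟩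

end RAM

/-! ### Modules, blocks and quasi-transitivity -/

namespace Digraph

variable {V : Type*} {Q : Digraph V} {M N : Set V}

/-- Reachability by a directed path inside `M`. -/
def ReachIn (Q : Digraph V) (M : Set V) (x y : V) : Prop :=
  Relation.ReflTransGen (fun a b => a ∈ M ∧ b ∈ M ∧ Q.Adj a b) x y

/-- The subgraph induced by `M` is strong. -/
def StrongIn (Q : Digraph V) (M : Set V) : Prop := ∀ x ∈ M, ∀ y ∈ M, Q.ReachIn M x y

/-- All vertices in `M` have the same adjacencies to each vertex outside `M`. -/
def IsModule (Q : Digraph V) (M : Set V) : Prop :=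
  ∀ u ∈ M, ∀ v ∈ M, ∀ w ∉ M, (Q.Adj u w ↔ Q.Adj v w) ∧ (Q.Adj w u ↔ Q.Adj w v)

/-- Two vertices are equal or lie in a common non-strong module. -/
def SameBlock (Q : Digraph V) (u v : V) : Prop :=
  u = v ∨ ∃ M, Q.IsModule M ∧ ¬ Q.StrongIn M ∧ u ∈ M ∧ v ∈ M

theorem not_reachIn_of_closed {X : Set V} (h : ∀ a ∈ X, ∀ b ∈ M, b ∉ X → ¬ Q.Adj a b) {x y : V}
    (hx : x ∈ X) (hy : y ∉ X) : ¬ Q.ReachIn M x y := by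
  intro hr
  have : y ∈ X := by
    unfold ReachIn at hr
    induction hr with
    | refl => exact hx
    | tail _ hbc ih =>
      by_contra hc
      exact h _ (by_contra fun hb => by exact hb (ih hb)) _ hbc.2.1 hc hbc.2.2
  exact hy this

theorem IsModule.union (hM : Q.IsModule M) (hN : Q.IsModule N) {z : V} (hzM : z ∈ M)
    (hzN : z ∈ N) : Q.IsModule (M ∪ N) := by
  have key : ∀ u ∈ M ∪ N, ∀ w ∉ M ∪ N, (Q.Adj u w ↔ Q.Adj z w) ∧ (Q.Adj w u ↔ Q.Adj w z) := by
    rintro u (hu | hu) w hw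
    · exact hM u hu z hzM w fun h => hw (.inl h)
    · exact hN u hu z hzN w fun h => hw (.inr h)
  intro u hu v hv w hw
  exact ⟨(key u hu w hw).1.trans (key v hv w hw).1.symm,
    (key u hu w hw).2.trans (key v hv w hw).2.symm⟩

/-- Let neither set contain the other, with `a` in `M` only and `b` in `N` only. The module property
makes all pairs from `M \ N` and `N`, and from `M` and `N \ M`, look like `a, b`. If both arcs
between `a` and `b` exist, then `M \ N` and the non-empty `M ∩ N` are joined completely in both
directions and `M` is strong, a contradiction. If `ab` is missing, no arc leaves `M` inside the
union; if `ba` is missing, none leaves `N`. -/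
theorem not_strongIn_union (hM : Q.IsModule M) (hN : Q.IsModule N) (hM' : ¬ Q.StrongIn M)
    (hN' : ¬ Q.StrongIn N) {z : V} (hzM : z ∈ M) (hzN : z ∈ N) : ¬ Q.StrongIn (M ∪ N) := by
  by_cases hMN : M ⊆ N
  · rwa [Set.union_eq_right.2 hMN]
  by_cases hNM : N ⊆ M
  · rwa [Set.union_eq_left.2 hNM]
  obtain ⟨a, ha, haN⟩ := Set.not_subset.1 hMN
  obtain ⟨b, hb, hbM⟩ := Set.not_subset.1 hNM
  have h1 : ∀ x ∈ M, x ∉ N → ∀ y ∈ N, (Q.Adj x y ↔ Q.Adj a b) ∧ (Q.Adj y x ↔ Q.Adj b a) :=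
    fun x hx hxN y hy => ⟨((hN y hy b hb x hxN).2).trans (hM x hx a ha b hbM).1,
      ((hN y hy b hb x hxN).1).trans (hM x hx a ha b hbM).2⟩
  have h2 : ∀ x ∈ M, ∀ y ∈ N, y ∉ M → (Q.Adj x y ↔ Q.Adj a b) ∧ (Q.Adj y x ↔ Q.Adj b a) :=
    fun x hx y hy hyM => ⟨((hM x hx a ha y hyM).1).trans (hN y hy b hb a haN).2,
      ((hM x hx a ha y hyM).2).trans (hN y hy b hb a haN).1⟩
  by_cases hba : Q.Adj b a
  · by_cases hab : Q.Adj a b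
    · exfalso
      apply hM'
      have s1 : ∀ x ∈ M, x ∉ N → ∀ y ∈ M, y ∈ N → Q.ReachIn M x y ∧ Q.ReachIn M y x :=
        fun x hx hxN y hy hyN => ⟨.single ⟨hx, hy, (h1 x hx hxN y hyN).1.2 hab⟩,
          .single ⟨hy, hx, (h1 x hx hxN y hyN).2.2 hba⟩⟩
      intro x hx y hy
      by_cases hxN : x ∈ N <;> by_cases hyN : y ∈ N
      · exact (s1 a ha haN x hx hxN).2.trans (s1 a ha haN y hy hyN).1
      · exact (s1 y hy hyN x hx hxN).2
      · exact (s1 x hx hxN y hy hyN).1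
      · exact (s1 x hx hxN z hzM hzN).1.trans (s1 y hy hyN z hzM hzN).2
    · intro h
      refine not_reachIn_of_closed (X := M) ?_ ha hbM (h a (.inl ha) b (.inr hb))
      rintro x hx y (hy | hy) hyM
      · exact absurd hy hyM
      · rwa [(h2 x hx y hy hyM).1]
  · intro h
    refine not_reachIn_of_closed (X := N) ?_ hb haN (h b (.inr hb) a (.inl ha))
    rintro y hy x (hx | hx) hxN
    · rwa [(h1 x hx hxN y hy).2]
    · exact absurd hx hxN

/-- Only transitivity has content: the two modules share the middle vertex, so their union serves as
a witness. -/
theorem sameBlock_equivalence (Q : Digraph V) : Equivalence Q.SameBlock where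
  refl _ := .inl rfl
  symm := by
    rintro u v (h | ⟨M, h1, h2, h3, h4⟩)
    · exact .inl h.symm
    · exact .inr ⟨M, h1, h2, h4, h3⟩
  trans := by
    rintro u v w (rfl | ⟨M, h1, h2, h3, h4⟩) (rfl | ⟨N, k1, k2, k3, k4⟩)
    · exact .inl rfl
    · exact .inr ⟨N, k1, k2, k3, k4⟩
    · exact .inr ⟨M, h1, h2, h3, h4⟩
    · exact .inr ⟨M ∪ N, h1.union k1 h4 k3, not_strongIn_union h1 k1 h2 k2 h4 k3, .inl h3, .inr k4⟩

theorem SameBlock.adj_iff_left {u v w : V} (h : Q.SameBlock u v) (hw : ¬ Q.SameBlock u w) :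
    (Q.Adj u w ↔ Q.Adj v w) ∧ (Q.Adj w u ↔ Q.Adj w v) := by
  rcases h with rfl | ⟨M, h1, h2, h3, h4⟩
  · exact ⟨Iff.rfl, Iff.rfl⟩
  · exact h1 u h3 v h4 w fun hwM => hw (.inr ⟨M, h1, h2, h3, hwM⟩)

/-- A block with at least two vertices is a non-strong module. -/
theorem block_not_strongIn [Finite V] {u v : V} (huv : u ≠ v) (h : Q.SameBlock u v) :
    Q.IsModule {w | Q.SameBlock u w} ∧ ¬ Q.StrongIn {w | Q.SameBlock u w} := by
  obtain ⟨M₀, h1, h2, h3, -⟩ := h.resolve_left huv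
  have hfin : {M : Set V | Q.IsModule M ∧ ¬ Q.StrongIn M ∧ u ∈ M}.Finite := Set.toFinite _
  -- A maximal non-strong module through `u` absorbs every other one through `u`, again by taking
  -- unions, and is therefore the whole block.
  obtain ⟨M, ⟨hM1, hM2, hM3⟩, hmax⟩ := hfin.exists_maximal ⟨M₀, h1, h2, h3⟩
  have hM : {w | Q.SameBlock u w} = M := by
    ext w
    constructor
    · rintro (rfl | ⟨N, k1, k2, k3, k4⟩)
      · exact hM3
      · exact hmax ⟨hM1.union k1 hM3 k3, not_strongIn_union hM1 k1 hM2 k2 hM3 k3, .inl hM3⟩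
          Set.subset_union_left (.inr k4)
    · exact fun hw => .inr ⟨M, hM1, hM2, hM3, hw⟩
  rw [hM]
  exact ⟨hM1, hM2⟩

theorem reachIn_univ {x y : V} : Q.ReachIn Set.univ x y ↔ Relation.ReflTransGen Q.Adj x y := by
  simp [ReachIn]

/-- If the block of `u` were everything, the whole digraph would be a non-strong module. -/
theorem IsStrong.exists_not_sameBlock [Finite V] [Nontrivial V] (hQ : Q.IsStrong) (u : V) :
    ∃ v, ¬ Q.SameBlock u v := by
  by_contra! h
  obtain ⟨v, hv⟩ := exists_ne u
  have := (block_not_strongIn hv.symm (h v)).2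
  rw [show {w | Q.SameBlock u w} = Set.univ from Set.eq_univ_of_forall h] at this
  exact this fun x _ y _ => reachIn_univ.2 (hQ x y)

/-- The subgraph induced by a set of vertices. -/
def inducedOn (Q : Digraph V) (M : Set V) : Digraph M where
  Adj a b := Q.Adj a b

theorem isStrong_inducedOn : (Q.inducedOn M).IsStrong ↔ Q.StrongIn M := by
  constructor
  · intro h x hx y hy
    exact (h ⟨x, hx⟩ ⟨y, hy⟩).lift (fun a : M => (a : V)) fun a b hab => ⟨a.2, b.2, hab⟩
  · rintro h ⟨x, hx⟩ ⟨y, hy⟩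
    have key : ∀ z, Q.ReachIn M x z → ∀ hz : z ∈ M,
        Relation.ReflTransGen (Q.inducedOn M).Adj ⟨x, hx⟩ ⟨z, hz⟩ := by
      intro z hz
      induction hz with
      | refl => exact fun _ => .refl
      | tail _ hbc ih => exact fun hz => (ih hbc.1).tail hbc.2.2
    exact key y (h x hx y hy) hy

/-- The graph in which non-adjacent vertices are joined. -/
def nonAdj (Q : Digraph V) : SimpleGraph V where
  Adj u v := u ≠ v ∧ ¬ Q.Adj u v ∧ ¬ Q.Adj v u
  symm := ⟨fun _ _ h => ⟨h.1.symm, h.2.2, h.2.1⟩⟩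
  loopless := ⟨fun _ h => h.1 rfl⟩

theorem nonAdj_inducedOn : (Q.inducedOn M).nonAdj = Q.nonAdj.induce M := by
  ext a b
  simp [nonAdj, inducedOn, Subtype.ext_iff]

theorem IsQuasiTransitive.inducedOn (h : Q.IsQuasiTransitive) : (Q.inducedOn M).IsQuasiTransitive :=
  fun x y z hxy hyz hxz => h x y z (Subtype.coe_ne_coe.2 hxy) (Subtype.coe_ne_coe.2 hyz)
    (Subtype.coe_ne_coe.2 hxz)

theorem IsLoopless.inducedOn (h : Q.IsLoopless) : (Q.inducedOn M).IsLoopless := fun x => h x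

theorem IsLoopless.ne (h : Q.IsLoopless) {x y : V} (hxy : Q.Adj x y) : x ≠ y := by
  rintro rfl; exact h _ hxy

/-- Let `p` follow `x` on the path. If `y` reaches `p`, then `x` dominates everything reachable from
`p`, arc by arc: quasi-transitivity makes `x` adjacent to the next vertex, and an arc back to `x`
would let `y` reach `x`. If `y` does not reach `p`, induction gives the arc `py`, and
quasi-transitivity applies to `x, p, y`. -/
theorem IsQuasiTransitive.adj_of_reachIn (hl : Q.IsLoopless) (hq : Q.IsQuasiTransitive) {x y : V}
    (hxy : Q.ReachIn M x y) (hyx : ¬ Q.ReachIn M y x) : x ∈ M ∧ Q.Adj x y := by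
  unfold ReachIn at hxy
  induction hxy using Relation.ReflTransGen.head_induction_on with
  | refl => exact absurd .refl hyx
  | head hxp hpy ih =>
    rename_i x p
    obtain ⟨hxM, hpM, hadj⟩ := hxp
    refine ⟨hxM, ?_⟩
    have hne : ∀ {z}, Q.ReachIn M y z → x ≠ z := by
      rintro z hz rfl; exact hyx hz
    by_cases hyp : Q.ReachIn M y p
    · have : ∀ q, Q.ReachIn M p q → Q.Adj x q := by
        intro q hq'
        induction hq' with
        | refl => exact hadj
        | @tail q r hpq hqr ih' =>
          have hyq : Q.ReachIn M y q := hyp.trans hpq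
          have hyr : Q.ReachIn M y r := hyq.tail hqr
          refine (hq x q r (hl.ne ih') (hl.ne hqr.2.2) (hne hyr) ih' hqr.2.2).resolve_right ?_
          exact fun hrx => hyx (hyr.tail ⟨hqr.2.1, hxM, hrx⟩)
      exact this y hpy
    · obtain ⟨-, hpy'⟩ := ih hyp
      refine (hq x p y (hl.ne hadj) (hl.ne hpy') (hne .refl) hadj hpy').resolve_right ?_
      refine fun hyx' => hyx (.single ⟨?_, hxM, hyx'⟩)
      rcases Relation.ReflTransGen.cases_tail hpy with h | ⟨c, -, h⟩
      · rw [h]; exact hpM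
      · exact h.2.1

/-- A strong quasi-transitive digraph has two vertices that are not joined by a path in the
graph of non-adjacencies. -/
theorem IsQuasiTransitive.not_isStrong_of_connected_nonAdj [Finite V] [Nontrivial V]
    (hl : Q.IsLoopless) (hq : Q.IsQuasiTransitive) (hc : Q.nonAdj.Connected) : ¬ Q.IsStrong := by
  obtain ⟨m, hm⟩ : ∃ m, Nat.card V = m := ⟨_, rfl⟩
  induction m using Nat.strong_induction_on generalizing V with
  | _ m ih =>
  intro hs
  -- Delete a vertex `v` that does not disconnect the non-adjacency graph. By induction the rest is
  -- not strong; the remaining argument shows that it is. The vertex `w` is a non-neighbour of `v`.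
  obtain ⟨v, hv⟩ := hc.exists_preconnected_induce_compl_singleton_of_finite
  obtain ⟨w₀, hw₀⟩ := exists_ne v
  obtain ⟨w, hvw⟩ : ∃ w, Q.nonAdj.Adj v w := by
    exact (hc.preconnected v w₀).elim fun p => by
      cases p with
      | nil => exact absurd rfl hw₀
      | cons h _ => exact ⟨_, h⟩
  have hwv : w ∈ ({v}ᶜ : Set V) := hvw.1.symm
  have hnot : ¬ Q.StrongIn {v}ᶜ := by
    rw [← isStrong_inducedOn]
    rcases subsingleton_or_nontrivial ({v}ᶜ : Set V) with hsub | hnt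
    · exfalso
      rcases Relation.ReflTransGen.cases_head (hs v w) with h | ⟨x, hx, -⟩
      · exact hvw.1 h
      · have : (⟨x, (hl.ne hx).symm⟩ : ({v}ᶜ : Set V)) = ⟨w, hwv⟩ := Subsingleton.elim _ _
        have hxw : x = w := congrArg Subtype.val this
        exact hvw.2.1 (hxw ▸ hx)
    · refine ih (Nat.card ({v}ᶜ : Set V)) ?_ hl.inducedOn hq.inducedOn ?_ rfl
      · rw [← hm, ← Nat.card_univ (α := V), Nat.card_coe_set_eq]
        exact Set.ncard_lt_ncard (by simp [Set.ssubset_univ_iff]) (Set.toFinite _)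
      · rw [nonAdj_inducedOn]
        exact ⟨hv⟩
  have from_v : ∀ x, Relation.ReflTransGen Q.Adj v x →
      x = v ∨ ∃ s, Q.Adj v s ∧ Q.ReachIn {v}ᶜ s x := by
    intro x hx
    induction hx with
    | refl => exact .inl rfl
    | @tail b c _ hbc ih' =>
      by_cases hcv : c = v
      · exact .inl hcv
      · rcases ih' with rfl | ⟨s, h1, h2⟩
        · exact .inr ⟨c, hbc, .refl⟩
        · by_cases hbv : b = v
          · exact .inr ⟨c, hbv ▸ hbc, .refl⟩
          · exact .inr ⟨s, h1, h2.tail ⟨hbv, hcv, hbc⟩⟩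
  have to_v : ∀ x, Relation.ReflTransGen Q.Adj x v →
      x = v ∨ ∃ t, Q.Adj t v ∧ Q.ReachIn {v}ᶜ x t := by
    intro x hx
    induction hx using Relation.ReflTransGen.head_induction_on with
    | refl => exact .inl rfl
    | @head c b hcb _ ih' =>
      by_cases hcv : c = v
      · exact .inl hcv
      · by_cases hbv : b = v
        · exact .inr ⟨c, hbv ▸ hcb, .refl⟩
        · obtain ⟨t, h1, h2⟩ := ih'.resolve_left hbv
          exact .inr ⟨t, h1, .head ⟨hcv, hbv, hcb⟩ h2⟩
  -- If `w` did not reach `s` back, then `sw` would be an arc, and `v → s → w` would make the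
  -- non-neighbours `v, w` adjacent. `F2` is the same argument with arcs reversed.
  have F1 : ∀ s, Q.Adj v s → Q.ReachIn {v}ᶜ s w → Q.ReachIn {v}ᶜ w s := by
    intro s hvs hsw
    by_contra hws
    have hsw' := (hq.adj_of_reachIn hl hsw hws).2
    rcases hq v s w (hl.ne hvs) (hl.ne hsw') hvw.1 hvs hsw' with h | h
    · exact hvw.2.1 h
    · exact hvw.2.2 h
  have F2 : ∀ t, Q.Adj t v → Q.ReachIn {v}ᶜ w t → Q.ReachIn {v}ᶜ t w := by
    intro t htv hwt
    by_contra htw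
    have hwt' := (hq.adj_of_reachIn hl hwt htw).2
    rcases hq w t v (hl.ne hwt') (hl.ne htv) hvw.1.symm hwt' htv with h | h
    · exact hvw.2.2 h
    · exact hvw.2.1 h
  obtain ⟨s, hvs, hsw⟩ := (from_v w (hs v w)).resolve_left hvw.1.symm
  obtain ⟨t, htv, hwt⟩ := (to_v w (hs w v)).resolve_left hvw.1.symm
  have hws := F1 s hvs hsw
  have htw := F2 t htv hwt
  apply hnot
  suffices H : ∀ x, x ≠ v → Q.ReachIn {v}ᶜ x w ∧ Q.ReachIn {v}ᶜ w x from
    fun x hx y hy => (H x hx).1.trans (H y hy).2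
  have step : ∀ {a b}, a ≠ v → b ≠ v → Q.Adj a b → Q.ReachIn {v}ᶜ a b :=
    fun ha hb h => .single ⟨ha, hb, h⟩
  -- From `t → v → s'` the vertices `t` and `s'` are adjacent. As `t` reaches `w`, the only harmful
  -- direction is `t → s'`, so `w` reaches `s'`. A path from `s'` back to `v` enters `v` from some
  -- `t'` that `w` reaches, and `F2` brings `t'` back to `w`. `G2` is dual.
  have G1 : ∀ s', Q.Adj v s' → Q.ReachIn {v}ᶜ s' w := by
    intro s' hvs'
    by_contra hn
    have hts' : t ≠ s' := by rintro rfl; exact hn htw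
    have hs'v : s' ≠ v := (hl.ne hvs').symm
    have hws' : Q.ReachIn {v}ᶜ w s' := by
      rcases hq t v s' (hl.ne htv) (hl.ne hvs') hts' htv hvs' with h | h
      · exact hwt.trans (step (hl.ne htv) hs'v h)
      · exact absurd ((step hs'v (hl.ne htv) h).trans htw) hn
    obtain ⟨t', h1, h2⟩ := (to_v s' (hs s' v)).resolve_left hs'v
    exact hn (h2.trans (F2 t' h1 (hws'.trans h2)))
  have G2 : ∀ t', Q.Adj t' v → Q.ReachIn {v}ᶜ w t' := by
    intro t' htv'
    by_contra hn
    have hts' : t' ≠ s := by rintro rfl; exact hn hws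
    have ht'v : t' ≠ v := hl.ne htv'
    have htw' : Q.ReachIn {v}ᶜ t' w := by
      rcases hq t' v s ht'v (hl.ne hvs) hts' htv' hvs with h | h
      · exact (step ht'v (hl.ne hvs).symm h).trans hsw
      · exact absurd (hws.trans (step (hl.ne hvs).symm ht'v h)) hn
    obtain ⟨s', h1, h2⟩ := (from_v t' (hs v t')).resolve_left ht'v
    exact hn ((F1 s' h1 (h2.trans htw')).trans h2)
  intro x hx
  obtain ⟨s', h1, h2⟩ := (from_v x (hs v x)).resolve_left hx
  obtain ⟨t', h3, h4⟩ := (to_v x (hs x v)).resolve_left hx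
  exact ⟨h4.trans (F2 t' h3 (G2 t' h3)), (F1 s' h1 (G1 s' h1)).trans h2⟩

/-- Non-adjacent vertices of a quasi-transitive digraph lie in the same block. -/
theorem IsQuasiTransitive.sameBlock_of_nonAdj [Finite V] (hl : Q.IsLoopless)
    (hq : Q.IsQuasiTransitive) {u v : V} (h : Q.nonAdj.Adj u v) : Q.SameBlock u v := by
  set C := Q.nonAdj.connectedComponentMk u with hC
  have hv : v ∈ C.supp := SimpleGraph.ConnectedComponent.sound h.symm.reachable
  have hu : u ∈ C.supp := rfl
  refine .inr ⟨C.supp, ?_, ?_, hu, hv⟩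
  · have key : ∀ w ∉ C.supp, ∀ a b, a ∈ C.supp → Q.nonAdj.Adj a b →
        (Q.Adj a w → Q.Adj b w) ∧ (Q.Adj w a → Q.Adj w b) := by
      intro w hw a b ha hab
      have hb : b ∈ C.supp := (SimpleGraph.ConnectedComponent.mem_supp_congr_adj C hab).1 ha
      have hwa : a ≠ w := by rintro rfl; exact hw ha
      have hwb : b ≠ w := by rintro rfl; exact hw hb
      have hwb' : ¬ Q.nonAdj.Adj b w := fun h =>
        hw ((SimpleGraph.ConnectedComponent.mem_supp_congr_adj C h).1 hb)
      have hor : Q.Adj b w ∨ Q.Adj w b := by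
        by_contra! hn; exact hwb' ⟨hwb, hn.1, hn.2⟩
      constructor
      · intro haw
        refine hor.resolve_right fun hwb'' => ?_
        rcases hq a w b hwa hwb.symm hab.1 haw hwb'' with h | h
        · exact hab.2.1 h
        · exact hab.2.2 h
      · intro haw
        refine hor.resolve_left fun hwb'' => ?_
        rcases hq b w a hwb hwa.symm hab.1.symm hwb'' haw with h | h
        · exact hab.2.2 h
        · exact hab.2.1 h
    have key2 : ∀ w ∉ C.supp, ∀ a b, a ∈ C.supp → Q.nonAdj.Reachable a b →
        (Q.Adj a w → Q.Adj b w) ∧ (Q.Adj w a → Q.Adj w b) := by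
      intro w hw a b ha hab
      obtain ⟨p⟩ := hab
      induction p with
      | nil => exact ⟨id, id⟩
      | cons h p ih =>
        have h1 := key w hw _ _ ha h
        have h2 := ih ((SimpleGraph.ConnectedComponent.mem_supp_congr_adj C h).1 ha)
        exact ⟨h2.1 ∘ h1.1, h2.2 ∘ h1.2⟩
    intro a ha b hb w hw
    have hab : Q.nonAdj.Reachable a b := C.reachable_of_mem_supp ha hb
    have h1 := key2 w hw a b ha hab
    have h2 := key2 w hw b a hb hab.symm
    exact ⟨⟨h1.1, h2.1⟩, ⟨h1.2, h2.2⟩⟩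
  · rw [← isStrong_inducedOn]
    have : Nontrivial C.supp := ⟨⟨u, hu⟩, ⟨v, hv⟩, fun h' => h.1 (congrArg Subtype.val h')⟩
    refine hq.inducedOn.not_isStrong_of_connected_nonAdj hl.inducedOn ?_
    rw [nonAdj_inducedOn]
    exact C.connected_toSimpleGraph

end Digraph

/-! ### Blocks and canonical decompositions -/

namespace Digraph

variable {V : Type*} {Q : Digraph V}

theorem composition_adj_of_ne {ι : Type*} {W : ι → Type*} {D : Digraph ι} {H : ∀ i, Digraph (W i)}
    {x y : Σ i, W i} (h : x.1 ≠ y.1) : (composition D H).Adj x y ↔ D.Adj x.1 y.1 := by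
  constructor
  · rintro (⟨i, a, b, -, rfl, rfl⟩ | h')
    · exact absurd rfl h
    · exact h'
  · exact .inr

theorem composition_adj_mk {ι : Type*} {W : ι → Type*} {D : Digraph ι} {H : ∀ i, Digraph (W i)}
    (hD : D.IsLoopless) {i : ι} {a b : W i} :
    (composition D H).Adj ⟨i, a⟩ ⟨i, b⟩ ↔ (H i).Adj a b := by
  constructor
  · rintro (⟨j, a', b', h, h1, h2⟩ | h')
    · cases h1; cases h2; exact h
    · exact absurd h' (hD i)
  · exact fun h => .inl ⟨i, a, b, h, rfl, rfl⟩

/-- A part is a module of the composition, and by definition it is a single vertex or non-strong, so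
it witnesses the relation. This avoids any appeal to uniqueness of canonical decompositions. -/
theorem CanonicalDecomposition.sameBlock [Finite V] (C : CanonicalDecomposition Q) {u v : V}
    (h : (C.iso u).1 = (C.iso v).1) : Q.SameBlock u v := by
  set i := (C.iso u).1 with hi
  rcases C.vertex_or_not_strong i with h1 | h1
  · left
    apply C.iso.injective
    refine Sigma.ext h ?_
    have hs : Subsingleton (Fin (C.size i)) := by rw [h1]; infer_instance
    rw [← Sigma.eta (C.iso v)] at h ⊢
    generalize (C.iso v).2 = b at *
    generalize (C.iso v).1 = j at *
    dsimp only at h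
    subst h
    exact heq_of_eq (Subsingleton.elim _ _)
  · refine .inr ⟨{w | (C.iso w).1 = i}, ?_, ?_, rfl, h.symm⟩
    · intro a ha b hb w hw
      have key : ∀ c, (C.iso c).1 = i → (Q.Adj c w ↔ C.D.Adj i (C.iso w).1) ∧
          (Q.Adj w c ↔ C.D.Adj (C.iso w).1 i) := by
        intro c hc
        have hne : (C.iso c).1 ≠ (C.iso w).1 := fun h => hw (h.symm.trans hc)
        rw [← C.iso.map_rel_iff, ← C.iso.map_rel_iff, composition_adj_of_ne hne,
          composition_adj_of_ne hne.symm, hc]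
        exact ⟨Iff.rfl, Iff.rfl⟩
      exact ⟨(key a ha).1.trans (key b hb).1.symm, (key a ha).2.trans (key b hb).2.symm⟩
    · intro hs
      apply h1
      intro a b
      have hx : (C.iso (C.iso.symm ⟨i, a⟩)).1 = i := by rw [RelIso.apply_symm_apply]
      have hy : (C.iso (C.iso.symm ⟨i, b⟩)).1 = i := by rw [RelIso.apply_symm_apply]
      have key : ∀ z, Q.ReachIn {w | (C.iso w).1 = i} (C.iso.symm ⟨i, a⟩) z →
          ∃ c, C.iso z = ⟨i, c⟩ ∧ Relation.ReflTransGen (C.H i).Adj a c := by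
        intro z hz
        unfold ReachIn at hz
        induction hz with
        | refl => exact ⟨a, by rw [RelIso.apply_symm_apply], .refl⟩
        | @tail y z _ hyz ih =>
          obtain ⟨c, hc, hac⟩ := ih
          obtain ⟨d, hd⟩ : ∃ d, C.iso z = ⟨i, d⟩ := by
            have hz : (C.iso z).1 = i := hyz.2.1
            rcases hzz : C.iso z with ⟨j, d⟩
            rw [hzz] at hz
            dsimp only at hz
            subst hz
            exact ⟨d, rfl⟩
          refine ⟨d, hd, hac.tail ?_⟩
          have := C.iso.map_rel_iff.2 hyz.2.2
          rwa [hc, hd, composition_adj_mk C.loopless_D] at this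
      obtain ⟨c, hc, hac⟩ := key _ (hs _ hx _ hy)
      rw [RelIso.apply_symm_apply] at hc
      cases hc
      exact hac

/-- The part of `u` lies in the block of `u`. Hence a family as large as the smallest block is large
enough for every canonical decomposition at once. -/
theorem CanonicalDecomposition.minSize_le [Finite V] (C : CanonicalDecomposition Q) (u : V) :
    C.minSize ≤ {w | Q.SameBlock u w}.ncard := by
  set i := (C.iso u).1 with hi
  have h1 : C.minSize ≤ C.size i := Nat.sInf_le ⟨i, rfl⟩
  refine h1.trans ?_
  have h2 : ((fun a : Fin (C.size i) => C.iso.symm ⟨i, a⟩) '' Set.univ).ncard = C.size i := by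
    rw [Set.ncard_image_of_injective, Set.ncard_univ, Nat.card_fin]
    intro a b hab
    simpa using C.iso.symm.injective hab
  rw [← h2]
  refine Set.ncard_le_ncard ?_ (Set.toFinite _)
  rintro _ ⟨a, -, rfl⟩
  exact C.sameBlock (by rw [RelIso.apply_symm_apply])

theorem SameBlock.adj_iff {u u' v v' : V} (hu : Q.SameBlock u u') (hv : Q.SameBlock v v')
    (h : ¬ Q.SameBlock u v) : Q.Adj u v ↔ Q.Adj u' v' := by
  have E := Q.sameBlock_equivalence
  rw [(hu.adj_iff_left h).1, (hv.adj_iff_left fun h' => h (E.trans hu (E.symm h'))).2]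

/-- The blocks are taken as parts. The quotient is semicomplete because non-adjacent vertices share
a block, and strong because walks of `Q` project to it. -/
theorem nonempty_canonicalDecomposition [Finite V] (hl : Q.IsLoopless) (hs : Q.IsStrong)
    (hq : Q.IsQuasiTransitive) : Nonempty Q.CanonicalDecomposition := by
  have E := Q.sameBlock_equivalence
  let S : Setoid V := ⟨Q.SameBlock, E⟩
  let e : Quotient S ≃ Fin (Nat.card (Quotient S)) := Finite.equivFin _
  let cl : V → Fin (Nat.card (Quotient S)) := fun v => e ⟦v⟧
  have hcl : ∀ u v, cl u = cl v ↔ Q.SameBlock u v := fun u v =>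
    e.injective.eq_iff.trans Quotient.eq
  have hsurj : ∀ i, ∃ u, cl u = i := fun i => by
    obtain ⟨u, hu⟩ := Quotient.exists_rep (e.symm i)
    exact ⟨u, by simp [cl, hu]⟩
  let g : ∀ i, {v // cl v = i} ≃ Fin (Nat.card {v // cl v = i}) := fun i => Finite.equivFin _
  let D : Digraph (Fin (Nat.card (Quotient S))) :=
    ⟨fun i j => i ≠ j ∧ ∃ u v, cl u = i ∧ cl v = j ∧ Q.Adj u v⟩
  let H : ∀ i, Digraph (Fin (Nat.card {v // cl v = i})) :=
    fun i => ⟨fun a b => Q.Adj ((g i).symm a) ((g i).symm b)⟩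
  have hDl : D.IsLoopless := fun i h => h.1 rfl
  let f : V ≃ Σ i, Fin (Nat.card {v // cl v = i}) :=
    (Equiv.sigmaFiberEquiv cl).symm.trans (Equiv.sigmaCongrRight g)
  have hf : ∀ v, f v = ⟨cl v, g (cl v) ⟨v, rfl⟩⟩ := fun v => rfl
  have hDadj : ∀ u v, cl u ≠ cl v → (D.Adj (cl u) (cl v) ↔ Q.Adj u v) := by
    intro u v h
    constructor
    · rintro ⟨-, u', v', hu, hv, hadj⟩
      exact (SameBlock.adj_iff ((hcl _ _).1 hu) ((hcl _ _).1 hv)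
        fun h' => h (hu ▸ hv ▸ (hcl _ _).2 h')).1 hadj
    · exact fun hadj => ⟨h, u, v, rfl, rfl, hadj⟩
  have hiso : ∀ u v, (composition D H).Adj (f u) (f v) ↔ Q.Adj u v := by
    intro u v
    by_cases h : cl u = cl v
    · have hv : f v = ⟨cl u, g (cl u) ⟨v, h.symm⟩⟩ := by
        rw [hf]
        generalize_proofs p1 p2
        revert p2
        rw [h]
        intro p2; rfl
      rw [hv, hf, composition_adj_mk hDl]
      simp [H]
    · rw [composition_adj_of_ne (by simpa [hf] using h)]
      exact hDadj u v h
  refine ⟨⟨_, D, _, H, ⟨f, hiso _ _⟩, hDl, ?_, ?_, ?_, ?_, ?_, ?_⟩⟩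
  · intro i j
    obtain ⟨u, rfl⟩ := hsurj i
    obtain ⟨v, rfl⟩ := hsurj j
    have := hs u v
    induction this with
    | refl => exact .refl
    | @tail b c _ hbc ih =>
      by_cases h : cl b = cl c
      · rwa [← h]
      · exact ih.tail ((hDadj _ _ h).2 hbc)
  · intro i j hij
    obtain ⟨u, rfl⟩ := hsurj i
    obtain ⟨v, rfl⟩ := hsurj j
    rw [hDadj _ _ hij, hDadj _ _ hij.symm]
    by_contra! hn
    exact hij ((hcl _ _).2 (hq.sameBlock_of_nonAdj hl ⟨fun h => hij (h ▸ rfl), hn.1, hn.2⟩))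
  · intro i
    obtain ⟨u, hu⟩ := hsurj i
    have : Nonempty {v // cl v = i} := ⟨⟨u, hu⟩⟩
    exact Nat.card_pos
  · exact fun i a => hl _
  · intro i x y z hxy hyz hxz
    refine hq _ _ _ ?_ ?_ ?_ <;> simpa [Subtype.coe_inj]
  · intro i
    by_contra! h
    obtain ⟨h1, h2⟩ := h
    obtain ⟨u, rfl⟩ := hsurj i
    have hpos : 0 < Nat.card {v // cl v = cl u} := by
      have : Nonempty {v // cl v = cl u} := ⟨⟨u, rfl⟩⟩
      exact Nat.card_pos
    have hnt : Nontrivial {v // cl v = cl u} := by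
      rw [← Finite.one_lt_card_iff_nontrivial]; omega
    obtain ⟨⟨v, hv⟩, hne⟩ := exists_ne (⟨u, rfl⟩ : {v // cl v = cl u})
    have huv : u ≠ v := fun h => hne (Subtype.ext h.symm)
    refine (block_not_strongIn huv ((hcl _ _).1 hv.symm)).2 fun x hx y hy => ?_
    have hx' : cl x = cl u := (hcl _ _).2 (E.symm hx)
    have hy' : cl y = cl u := (hcl _ _).2 (E.symm hy)
    have := (h2 (g _ ⟨x, hx'⟩) (g _ ⟨y, hy'⟩)).lift (fun a => ((g (cl u)).symm a : V))
      (p := fun a b => a ∈ {w | Q.SameBlock u w} ∧ b ∈ {w | Q.SameBlock u w} ∧ Q.Adj a b)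
      fun a b hab => ⟨E.symm ((hcl _ _).1 ((g (cl u)).symm a).2),
        E.symm ((hcl _ _).1 ((g (cl u)).symm b).2), hab⟩
    simpa [ReachIn, Function.onFun] using this

end Digraph

/-! ### Blocks by iterated closures -/

theorem Function.iterate_card_fixed {V : Type*} [Finite V] {F : Set V → Set V}
    (hF : ∀ X, X ⊆ F X) (X : Set V) : F (F^[Nat.card V] X) = F^[Nat.card V] X := by
  by_contra hne
  have hfix : ∀ m ≤ Nat.card V, F (F^[m] X) ≠ F^[m] X := by
    intro m hm h
    apply hne
    obtain ⟨d, hd⟩ := Nat.exists_eq_add_of_le hm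
    rw [hd, Nat.add_comm, Function.iterate_add_apply]
    have : ∀ d, F^[d] (F^[m] X) = F^[m] X := fun d => Function.iterate_fixed h d
    rw [this, h]
  -- Without a fixed point every round adds an element, and after `Nat.card V + 1` rounds there
  -- would be too many.
  have hcard : ∀ m ≤ Nat.card V + 1, m ≤ (F^[m] X).ncard := by
    intro m
    induction m with
    | zero => intro _; exact Nat.zero_le _
    | succ m ih =>
      intro hm
      have h1 := ih (by omega)
      have h2 : (F^[m] X).ncard < (F^[m + 1] X).ncard := by
        rw [Function.iterate_succ_apply']
        exact Set.ncard_lt_ncard (LE.le.ssubset_of_ne (hF _)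
          (hfix m (by omega)).symm) (Set.toFinite _)
      omega
  have h1 := hcard _ le_rfl
  have h2 := Set.ncard_le_card (F^[Nat.card V + 1] X)
  omega

namespace Digraph

variable {V : Type*} {Q : Digraph V} {M N : Set V}

/-- Add to a set all vertices that distinguish two of its elements. -/
def modStep (Q : Digraph V) (M : Set V) : Set V :=
  {k | k ∈ M ∨ ∃ x y, (x ∈ M ∧ y ∈ M) ∧ ¬ ((Q.Adj k x ↔ Q.Adj k y) ∧ (Q.Adj x k ↔ Q.Adj y k))}

/-- Add to a set all vertices in `M` that are heads of arcs from it. -/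
def reachStep (Q : Digraph V) (M X : Set V) : Set V :=
  {k | k ∈ X ∨ k ∈ M ∧ ∃ x, x ∈ X ∧ Q.Adj x k}

/-- The smallest module that contains two given vertices. -/
def moduleClosure (Q : Digraph V) (u v : V) : Set V := (modStep Q)^[Nat.card V] {u, v}

/-- The vertices that can be reached from `u` in the smallest module that contains `u, v`. -/
def moduleReach (Q : Digraph V) (u v : V) : Set V :=
  (reachStep Q (Q.moduleClosure u v))^[Nat.card V] {u}

theorem subset_iterate {F : Set V → Set V} (hF : ∀ X, X ⊆ F X) (X : Set V) (m : ℕ) :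
    X ⊆ F^[m] X := by
  induction m with
  | zero => exact subset_rfl
  | succ m ih => rw [Function.iterate_succ_apply']; exact ih.trans (hF _)

theorem subset_modStep (X : Set V) : X ⊆ Q.modStep X := fun _ h => .inl h

theorem subset_reachStep (X : Set V) : X ⊆ Q.reachStep M X := fun _ h => .inl h

theorem left_mem_moduleClosure (u v : V) : u ∈ Q.moduleClosure u v :=
  subset_iterate subset_modStep _ _ (.inl rfl)

theorem right_mem_moduleClosure (u v : V) : v ∈ Q.moduleClosure u v :=
  subset_iterate subset_modStep _ _ (.inr rfl)

theorem isModule_moduleClosure [Finite V] (u v : V) : Q.IsModule (Q.moduleClosure u v) := by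
  intro x hx y hy w hw
  by_contra h
  apply hw
  unfold moduleClosure
  rw [← Function.iterate_card_fixed subset_modStep]
  exact .inr ⟨x, y, ⟨hx, hy⟩, fun h' => h h'.symm⟩

theorem moduleClosure_subset (hM : Q.IsModule M) {u v : V} (hu : u ∈ M) (hv : v ∈ M) :
    Q.moduleClosure u v ⊆ M := by
  unfold moduleClosure
  generalize Nat.card V = m
  induction m with
  | zero => rintro _ (rfl | rfl) <;> assumption
  | succ m ih =>
    rw [Function.iterate_succ_apply']
    rintro k (hk | ⟨x, y, ⟨hx, hy⟩, h⟩)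
    · exact ih hk
    · by_contra hk
      exact h (hM x (ih hx) y (ih hy) k hk).symm

theorem mem_moduleReach [Finite V] {u v k : V} :
    k ∈ Q.moduleReach u v ↔ Q.ReachIn (Q.moduleClosure u v) u k := by
  constructor
  · have key : ∀ m, ∀ k ∈ (reachStep Q (Q.moduleClosure u v))^[m] {u},
        k ∈ Q.moduleClosure u v ∧ Q.ReachIn (Q.moduleClosure u v) u k := by
      intro m
      induction m with
      | zero => rintro k rfl; exact ⟨left_mem_moduleClosure _ _, .refl⟩
      | succ m ih =>
        rw [Function.iterate_succ_apply']
        rintro k (hk | ⟨hk, x, hx, hxk⟩)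
        · exact ih k hk
        · exact ⟨hk, (ih x hx).2.tail ⟨(ih x hx).1, hk, hxk⟩⟩
    exact fun h => (key _ k h).2
  · intro h
    unfold ReachIn at h
    induction h with
    | refl => exact subset_iterate subset_reachStep _ _ rfl
    | @tail b c _ hbc ih =>
      unfold moduleReach at ih ⊢
      rw [← Function.iterate_card_fixed subset_reachStep]
      exact .inr ⟨hbc.2.1, b, ih, hbc.2.2⟩

theorem ReachIn.mono (h : M ⊆ N) {x y : V} (hxy : Q.ReachIn M x y) : Q.ReachIn N x y :=
  Relation.ReflTransGen.mono (fun _ _ hab => ⟨h hab.1, h hab.2.1, hab.2.2⟩) _ _ hxy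

theorem sameBlock_of_notMem_moduleReach [Finite V] {u v : V} (h : v ∉ Q.moduleReach u v) :
    Q.SameBlock u v := by
  rw [mem_moduleReach] at h
  exact .inr ⟨_, isModule_moduleClosure u v, fun hs => h (hs _ (left_mem_moduleClosure _ _) _
    (right_mem_moduleClosure _ _)), left_mem_moduleClosure _ _, right_mem_moduleClosure _ _⟩

/-- Replaces the quantifier over sets in the definition by one over vertices, so that blocks become
computable. Two vertices that cannot reach each other inside the least module containing them share
a block; one intermediate vertex `w` suffices to connect all pairs of a block in this way. -/
theorem sameBlock_iff [Finite V] {u v : V} : Q.SameBlock u v ↔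
    u = v ∨ ∃ w, (w ∉ Q.moduleReach u w ∨ u ∉ Q.moduleReach w u) ∧
      (v = w ∨ (v ∉ Q.moduleReach w v ∨ w ∉ Q.moduleReach v w)) := by
  have E := Q.sameBlock_equivalence
  constructor
  · rintro (h | ⟨M, h1, h2, hu, hv⟩)
    · exact .inl h
    · right
      have key : ∀ x ∈ M, ∀ y ∈ M, ¬ (Q.ReachIn M x y ∧ Q.ReachIn M y x) →
          (y ∉ Q.moduleReach x y ∨ x ∉ Q.moduleReach y x) := by
        intro x hx y hy h
        by_contra! hn
        rw [mem_moduleReach, mem_moduleReach] at hn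
        exact h ⟨hn.1.mono (moduleClosure_subset h1 hx hy),
          hn.2.mono (moduleClosure_subset h1 hy hx)⟩
      by_cases huv : Q.ReachIn M u v ∧ Q.ReachIn M v u
      · obtain ⟨w, hw, huw⟩ : ∃ w ∈ M, ¬ (Q.ReachIn M u w ∧ Q.ReachIn M w u) := by
          by_contra! hn
          exact h2 fun x hx y hy => (hn x hx).2.trans (hn y hy).1
        exact ⟨w, key u hu w hw huw, .inr (key w hw v hv fun h =>
          huw ⟨huv.1.trans h.2, h.1.trans huv.2⟩)⟩
      · exact ⟨v, key u hu v hv huv, .inl rfl⟩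
  · have key : ∀ x y, (y ∉ Q.moduleReach x y ∨ x ∉ Q.moduleReach y x) → Q.SameBlock x y := by
      rintro x y (h | h)
      · exact sameBlock_of_notMem_moduleReach h
      · exact E.symm (sameBlock_of_notMem_moduleReach h)
    rintro (rfl | ⟨w, h1, h2⟩)
    · exact E.refl _
    · refine E.trans (key _ _ h1) ?_
      rcases h2 with rfl | h2
      · exact E.refl _
      · exact key _ _ h2

end Digraph

/-! ### Ranks of vertices inside their blocks -/

section Rank

variable {V : Type*} [Fintype V]

open Classical in
/-- The number of vertices in the class of `u` that have a smaller key. -/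
noncomputable def rankBy (E : V → V → Prop) (key : V → ℕ) (u : V) : ℕ :=
  #{x | E u x ∧ key x < key u}

variable {E : V → V → Prop} {key : V → ℕ}

theorem rankBy_lt (hE : Equivalence E) {u v : V} (h : E u v) (hk : key u < key v) :
    rankBy E key u < rankBy E key v := by
  classical
  refine Finset.card_lt_card ⟨fun x hx => ?_, fun hsub => ?_⟩
  · simp only [mem_filter, mem_univ, true_and] at hx ⊢
    exact ⟨hE.trans (hE.symm h) hx.1, hx.2.trans hk⟩
  · have := hsub (x := u) (by simpa using ⟨hE.symm h, hk⟩)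
    simp at this

theorem rankBy_inj (hE : Equivalence E) (hkey : ∀ u v, E u v → key u = key v → u = v) {u v : V}
    (h : E u v) (hr : rankBy E key u = rankBy E key v) : u = v := by
  rcases lt_trichotomy (key u) (key v) with hk | hk | hk
  · exact absurd hr (rankBy_lt hE h hk).ne
  · exact hkey u v h hk
  · exact absurd hr (rankBy_lt hE (hE.symm h) hk).ne'

open Classical in
theorem rankBy_lt_card (hE : Equivalence E) (u : V) : rankBy E key u < #{x | E u x} := by
  refine Finset.card_lt_card ⟨fun x hx => ?_, fun hsub => ?_⟩
  · simp only [mem_filter, mem_univ, true_and] at hx ⊢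
    exact hx.1
  · have := hsub (x := u) (by simpa using hE.refl u)
    simp at this

open Classical in
-- Ranks are distinct within a class and smaller than its order, so by counting they take all values
-- below it.
theorem exists_rankBy_eq (hE : Equivalence E) (hkey : ∀ u v, E u v → key u = key v → u = v) (u : V)
    {m : ℕ} (hm : m < #{x | E u x}) : ∃ v, E u v ∧ rankBy E key v = m := by
  have hcard : ∀ v, E u v → #{x | E v x} = #{x | E u x} := by
    intro v h
    congr 1
    ext x
    simp only [mem_filter, mem_univ, true_and]
    exact ⟨hE.trans h, hE.trans (hE.symm h)⟩
  have himg : Finset.image (rankBy E key) ({x | E u x} : Finset V) = range (#{x | E u x}) := by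
    refine Finset.eq_of_subset_of_card_le (fun m hm => ?_) ?_
    · obtain ⟨v, hv, rfl⟩ := Finset.mem_image.1 hm
      have hv' : E u v := by simpa using hv
      rw [mem_range, ← hcard v hv']
      exact rankBy_lt_card hE v
    · rw [Finset.card_image_of_injOn, card_range]
      intro a ha b hb hab
      have ha' : E u a := by simpa using ha
      have hb' : E u b := by simpa using hb
      exact rankBy_inj hE hkey (hE.trans (hE.symm ha') hb') hab
  have : m ∈ Finset.image (rankBy E key) ({x | E u x} : Finset V) := by
    rw [himg, mem_range]; exact hm
  obtain ⟨v, hv, rfl⟩ := Finset.mem_image.1 this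
  exact ⟨v, by simpa using hv, rfl⟩

end Rank

namespace Digraph

variable {n : ℕ} (Q : Digraph (Fin n))

/-- The first vertex of a block that is the tail of an arc inside the block. -/
def IsTail (i : Fin n) : Prop :=
  (∃ x, Q.SameBlock i x ∧ Q.Adj i x) ∧
    ¬ ∃ y, (y < i ∧ Q.SameBlock i y) ∧ ∃ x, Q.SameBlock y x ∧ Q.Adj y x

/-- The first vertex of a block that is the head of an arc from the first tail. -/
def IsHead (i : Fin n) : Prop :=
  ∃ x, (Q.IsTail x ∧ Q.SameBlock x i ∧ Q.Adj x i) ∧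
    ¬ ∃ y, (y < i ∧ Q.SameBlock i y) ∧ Q.Adj x y

open Classical in
/-- The vertices of a block are ordered by this key. -/
noncomputable def key (i : Fin n) : ℕ := if Q.IsTail i then 0 else if Q.IsHead i then 1 else i + 2

/-- The position of a vertex in its block. -/
noncomputable def rank (i : Fin n) : ℕ := rankBy Q.SameBlock Q.key i

open Classical in
/-- The number of vertices in the block of `i`. -/
noncomputable def blockSize (i : Fin n) : ℕ := #{x | Q.SameBlock i x}

open Classical in
/-- The smallest number of vertices in a block. -/
noncomputable def minBlock : ℕ := #{k : Fin n | ∀ u, (k : ℕ) < Q.blockSize u}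

variable {Q}

theorem IsTail.unique {i j : Fin n} (hi : Q.IsTail i) (hj : Q.IsTail j) (h : Q.SameBlock i j) :
    i = j := by
  have E := Q.sameBlock_equivalence
  rcases lt_trichotomy i j with hij | hij | hij
  · exact absurd ⟨i, ⟨hij, E.symm h⟩, hi.1⟩ hj.2
  · exact hij
  · exact absurd ⟨j, ⟨hij, h⟩, hj.1⟩ hi.2

theorem IsHead.unique {i j : Fin n} (hi : Q.IsHead i) (hj : Q.IsHead j) (h : Q.SameBlock i j) :
    i = j := by
  have E := Q.sameBlock_equivalence
  obtain ⟨x, ⟨h1, h2, h3⟩, h4⟩ := hi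
  obtain ⟨y, ⟨k1, k2, k3⟩, k4⟩ := hj
  obtain rfl : x = y := h1.unique k1 (E.trans h2 (E.trans h (E.symm k2)))
  rcases lt_trichotomy i j with hij | hij | hij
  · exact absurd ⟨i, ⟨hij, E.symm h⟩, h3⟩ k4
  · exact hij
  · exact absurd ⟨j, ⟨hij, h⟩, k3⟩ h4

theorem key_inj {i j : Fin n} (h : Q.SameBlock i j) (hk : Q.key i = Q.key j) : i = j := by
  unfold key at hk
  split_ifs at hk with h1 h2 h3 h4 h5 h6 h7
  · exact h1.unique h2 h
  all_goals first
    | omega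
    | exact IsHead.unique ‹_› ‹_› h

theorem rank_inj {i j : Fin n} (h : Q.SameBlock i j) (hr : Q.rank i = Q.rank j) : i = j :=
  rankBy_inj Q.sameBlock_equivalence (fun _ _ => key_inj) h hr

theorem rank_lt_blockSize (i : Fin n) : Q.rank i < Q.blockSize i :=
  rankBy_lt_card Q.sameBlock_equivalence i

theorem exists_rank_eq (i : Fin n) {m : ℕ} (hm : m < Q.blockSize i) :
    ∃ j, Q.SameBlock i j ∧ Q.rank j = m :=
  exists_rankBy_eq Q.sameBlock_equivalence (fun _ _ => key_inj) i hm

theorem blockSize_congr {i j : Fin n} (h : Q.SameBlock i j) : Q.blockSize i = Q.blockSize j := by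
  classical
  have E := Q.sameBlock_equivalence
  unfold blockSize
  congr 1
  ext x
  simp only [mem_filter, mem_univ, true_and]
  exact ⟨E.trans (E.symm h), E.trans h⟩

/-- The reason for the choice of `key`: in a block that contains an arc, the first tail and its
first head get keys `0` and `1`, so an arc goes from rank `0` to rank `1`. The templates for
smallest order two rely on it. -/
theorem exists_rank_zero_one (hl : Q.IsLoopless) {u v : Fin n} (huv : Q.SameBlock u v)
    (hadj : Q.Adj u v) :
    ∃ p q, Q.SameBlock u p ∧ Q.SameBlock u q ∧ Q.rank p = 0 ∧ Q.rank q = 1 ∧ Q.Adj p q := by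
  classical
  have E := Q.sameBlock_equivalence
  have hmin : ∀ P : Fin n → Prop, (∃ x, P x) → ∃ x, P x ∧ ∀ y, y < x → ¬ P y := by
    rintro P ⟨x, hx⟩
    have hne : (univ.filter P).Nonempty := ⟨x, by simpa⟩
    refine ⟨(univ.filter P).min' hne, by simpa using (univ.filter P).min'_mem hne, ?_⟩
    intro y hy hPy
    exact absurd ((univ.filter P).min'_le y (by simpa)) (not_le.2 hy)
  obtain ⟨p, ⟨hp1, hp2⟩, hp3⟩ := hmin (fun p => Q.SameBlock u p ∧ ∃ x, Q.SameBlock p x ∧ Q.Adj p x)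
    ⟨u, E.refl u, v, huv, hadj⟩
  have hpt : Q.IsTail p := ⟨hp2, by
    rintro ⟨y, ⟨hy1, hy2⟩, hy3⟩
    exact hp3 y hy1 ⟨E.trans hp1 hy2, hy3⟩⟩
  obtain ⟨q, ⟨hq1, hq2⟩, hq3⟩ := hmin (fun q => Q.SameBlock p q ∧ Q.Adj p q) hp2
  have hqh : Q.IsHead q := ⟨p, ⟨hpt, hq1, hq2⟩, by
    rintro ⟨y, ⟨hy1, hy2⟩, hy3⟩
    exact hq3 y hy1 ⟨E.trans hq1 hy2, hy3⟩⟩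
  have hqt : ¬ Q.IsTail q := fun h => hl.ne hq2 (hpt.unique h hq1)
  have kp : Q.key p = 0 := by simp [key, hpt]
  have kq : Q.key q = 1 := by simp [key, hqt, hqh]
  refine ⟨p, q, hp1, E.trans hp1 hq1, ?_, ?_, hq2⟩
  · simp [rank, rankBy, kp]
  · have : ({x | Q.SameBlock q x ∧ Q.key x < Q.key q} : Finset (Fin n)) = {p} := by
      ext x
      simp only [mem_filter, mem_univ, true_and, mem_singleton, kq]
      constructor
      · rintro ⟨h1, h2⟩
        exact (key_inj (E.trans hq1 h1) (by omega)).symm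
      · rintro rfl
        exact ⟨E.symm hq1, by omega⟩
    rw [rank, rankBy, this, card_singleton]

theorem card_fin_lt {m : ℕ} (h : m ≤ n) : #{k : Fin n | (k : ℕ) < m} = m := by
  have := Finset.card_map (Fin.valEmbedding (n := n)) (s := {k : Fin n | (k : ℕ) < m})
  rw [← this]
  have : ({k : Fin n | (k : ℕ) < m} : Finset (Fin n)).map Fin.valEmbedding = range m := by
    ext x
    simp only [mem_map, mem_filter, mem_univ, true_and, Fin.valEmbedding_apply, mem_range]
    exact ⟨by rintro ⟨a, h, rfl⟩; exact h, fun hx => ⟨⟨x, by omega⟩, hx, rfl⟩⟩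
  rw [this, card_range]

theorem blockSize_le (i : Fin n) : Q.blockSize i ≤ n := by
  classical
  exact (card_le_univ _).trans (by simp)

/-- The smallest block size is attained and is a lower bound. -/
theorem minBlock_spec (hn : 0 < n) :
    (∀ u, Q.minBlock ≤ Q.blockSize u) ∧ (∃ u, Q.minBlock = Q.blockSize u) := by
  classical
  have hne : (univ : Finset (Fin n)).Nonempty := ⟨⟨0, hn⟩, mem_univ _⟩
  obtain ⟨u, -, hu⟩ := exists_min_image univ Q.blockSize hne
  have : Q.minBlock = Q.blockSize u := by
    unfold minBlock
    rw [← card_fin_lt (blockSize_le u)]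
    congr 1
    ext k
    simp only [mem_filter, mem_univ, true_and]
    exact ⟨fun h => h u, fun h v => h.trans_le (hu v (mem_univ v))⟩
  exact ⟨fun v => this ▸ hu v (mem_univ v), u, this⟩

end Digraph

/-! ### Latin squares for blow-ups of the directed triangle -/

/-- Congruence modulo `r`, for numbers whose difference lies in the interval from `-r` to `2r`. -/
def Cong (r a b : ℕ) : Prop := a = b ∨ a = b + r ∨ a = b + (r + r) ∨ b = a + r

/-- Residue modulo `s` of a number smaller than `2s`. -/
def lo (s x : ℕ) : ℕ := if x < s then x else x - s

/-- Quotient by `s` of a number smaller than `2s`. -/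
def hi (s x : ℕ) : ℕ := if x < s then 0 else 1

/-- In colour `k` the vertex `x` of part `t` of the `r`-fold blow-up of the directed triangle has
the successor `y`. -/
def latin (r k t x y : ℕ) : Prop :=
  if r % 2 = 1 then
    if t = 2 then Cong r (y + (k + k)) (x + 1) else Cong r y (x + k)
  else if r % 4 = 0 then
    if t = 0 then Cong r y (x + k)
    else if t = 1 then
      if k < r / 2 then Cong r y (x + k)
      else if k % 2 = 0 then Cong r y (x + k + 1) else Cong r (y + 1) (x + k)
    else
      if k < r / 2 then Cong r (y + (k + k)) (x + 1) else Cong r (y + (k + k)) x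
  else
    if t = 0 then
      if k < r / 2 ∧ x < 2 then
        Cong (r / 2) (lo (r / 2) y) (1 - x + lo (r / 2) k) ∧ hi (r / 2) y = 0
      else Cong (r / 2) (lo (r / 2) y) (lo (r / 2) x + lo (r / 2) k) ∧
        Cong 2 (hi (r / 2) y) (hi (r / 2) x + hi (r / 2) k)
    else if t = 1 then
      Cong (r / 2) (lo (r / 2) y) (lo (r / 2) x + lo (r / 2) k) ∧
        Cong 2 (hi (r / 2) y) (hi (r / 2) x + hi (r / 2) k)
    else
      Cong (r / 2) (lo (r / 2) y + (lo (r / 2) k + lo (r / 2) k)) (lo (r / 2) x + 1) ∧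
        Cong 2 (hi (r / 2) y)
          (hi (r / 2) x + hi (r / 2) k + if lo (r / 2) y < 2 then 1 else 0)

theorem exists_cong_lt {r a : ℕ} (ha : a < r + r) : ∃ y < r, Cong r y a := by
  unfold Cong
  by_cases h : a < r
  · exact ⟨a, h, by omega⟩
  · exact ⟨a - r, by omega, by omega⟩

theorem exists_cong_add_lt {r a b : ℕ} (ha : a ≤ r) (hb : b < r + r) (hr : 0 < r) :
    ∃ y < r, Cong r (y + b) a := by
  unfold Cong
  by_cases h : b ≤ a
  · by_cases h' : a - b < r
    · exact ⟨a - b, h', by omega⟩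
    · exact ⟨0, hr, by omega⟩
  · by_cases h' : b ≤ a + r
    · by_cases h'' : a + r - b < r
      · exact ⟨a + r - b, h'', by omega⟩
      · exact ⟨0, hr, by omega⟩
    · exact ⟨a + r + r - b, by omega, by omega⟩

theorem exists_lo_hi {s u i : ℕ} (hu : u < s) (hi' : i < 2) :
    ∃ x < s + s, lo s x = u ∧ hi s x = i := by
  unfold lo hi
  by_cases h : i = 0
  · exact ⟨u, by omega, by simp [hu], by simp [hu, h]⟩
  · exact ⟨u + s, by omega, by simp, by simp; omega⟩

theorem lo_lt {s x : ℕ} (hx : x < s + s) : lo s x < s := by unfold lo; split_ifs <;> omega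

theorem hi_lt (s x : ℕ) : hi s x < 2 := by unfold hi; split_ifs <;> omega

theorem eq_of_lo_hi {s x y : ℕ} (h1 : lo s x = lo s y) (h2 : hi s x = hi s y) : x = y := by
  unfold lo hi at *; split_ifs at * <;> omega

theorem latin_exists_right {r k t x : ℕ} (hk : k < r) (hx : x < r) :
    ∃ y < r, latin r k t x y := by
  have hr : 0 < r := by omega
  unfold latin
  by_cases h1 : r % 2 = 1
  · simp only [h1, if_true]
    split_ifs
    · exact exists_cong_add_lt (by omega) (by omega) hr
    · exact exists_cong_lt (by omega)
  by_cases h2 : r % 4 = 0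
  · simp only [h1, h2, if_true, if_false]
    split_ifs
    · exact exists_cong_lt (by omega)
    · exact exists_cong_lt (by omega)
    · exact exists_cong_lt (by omega)
    · by_cases h : x + k = 0
      · omega
      · obtain ⟨y, hy, h'⟩ := exists_cong_lt (r := r) (a := x + k - 1) (by omega)
        exact ⟨y, hy, by unfold Cong at *; omega⟩
    · exact exists_cong_add_lt (by omega) (by omega) hr
    · exact exists_cong_add_lt (by omega) (by omega) hr
  obtain ⟨s, rfl⟩ : ∃ s, r = s + s := ⟨r / 2, by omega⟩
  have hs : (s + s) / 2 = s := by omega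
  have hs0 : 0 < s := by omega
  simp only [h1, h2, if_false, hs]
  have lx := lo_lt hx
  have lk := lo_lt hk
  have hx2 := hi_lt s x
  have hk2 := hi_lt s k
  split_ifs with h3 h4 h5
  · obtain ⟨u, hu, hu'⟩ := exists_cong_lt (r := s) (a := 1 - x + lo s k) (by omega)
    obtain ⟨y, hy, e1, e2⟩ := exists_lo_hi hu (i := 0) (by omega)
    exact ⟨y, hy, by rw [e1]; exact hu', e2⟩
  · obtain ⟨u, hu, hu'⟩ := exists_cong_lt (r := s) (a := lo s x + lo s k) (by omega)
    obtain ⟨i, hi, hi'⟩ := exists_cong_lt (r := 2) (a := hi s x + hi s k) (by omega)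
    obtain ⟨y, hy, e1, e2⟩ := exists_lo_hi hu hi
    exact ⟨y, hy, by rw [e1]; exact hu', by rw [e2]; exact hi'⟩
  · obtain ⟨u, hu, hu'⟩ := exists_cong_lt (r := s) (a := lo s x + lo s k) (by omega)
    obtain ⟨i, hi, hi'⟩ := exists_cong_lt (r := 2) (a := hi s x + hi s k) (by omega)
    obtain ⟨y, hy, e1, e2⟩ := exists_lo_hi hu hi
    exact ⟨y, hy, by rw [e1]; exact hu', by rw [e2]; exact hi'⟩
  · obtain ⟨u, hu, hu'⟩ := exists_cong_add_lt (r := s) (a := lo s x + 1) (b := lo s k + lo s k)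
      (by omega) (by omega) hs0
    obtain ⟨i, hi, hi'⟩ := exists_cong_lt (r := 2)
      (a := (hi s x + hi s k + if u < 2 then 1 else 0)) (by split_ifs <;> omega)
    obtain ⟨y, hy, e1, e2⟩ := exists_lo_hi hu hi
    exact ⟨y, hy, by rw [e1]; exact hu', by rw [e1, e2]; exact hi'⟩

theorem exists_add_cong {r a b : ℕ} (ha : a < r) (hb : b ≤ r) :
    ∃ x < r, Cong r a (x + b) := by
  unfold Cong
  by_cases h : b ≤ a
  · exact ⟨a - b, by omega, by omega⟩
  · exact ⟨a + r - b, by omega, by omega⟩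

theorem exists_cong_add_one {r a : ℕ} (ha : a < r + r + r) (hr : 0 < r) :
    ∃ x < r, Cong r a (x + 1) := by
  unfold Cong
  by_cases h : a = 0
  · exact ⟨r - 1, by omega, by omega⟩
  by_cases h : a ≤ r
  · exact ⟨a - 1, by omega, by omega⟩
  by_cases h : a ≤ r + r
  · exact ⟨a - 1 - r, by omega, by omega⟩
  · exact ⟨a - 1 - r - r, by omega, by omega⟩

/-- Each congruence is solved for `x`. For `r = 2` the exchange of `0` and `1` would not stay in the
lower half, and the colour `0` would miss a vertex. -/
theorem latin_exists_left {r k t y : ℕ} (hr2 : r ≠ 2) (hk : k < r) (hy : y < r) :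
    ∃ x < r, latin r k t x y := by
  have hr : 0 < r := by omega
  unfold latin
  by_cases h1 : r % 2 = 1
  · simp only [h1, if_true]
    split_ifs
    · exact exists_cong_add_one (by omega) hr
    · exact exists_add_cong hy (by omega)
  by_cases h2 : r % 4 = 0
  · simp only [h1, h2, if_true, if_false]
    split_ifs
    · exact exists_add_cong hy (by omega)
    · exact exists_add_cong hy (by omega)
    · simp only [add_assoc]
      exact exists_add_cong hy (by omega)
    · by_cases h : k = 0
      · omega
      · obtain ⟨x, hx, h'⟩ := exists_add_cong (r := r) (a := y) (b := k - 1) hy (by omega)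
        exact ⟨x, hx, by unfold Cong at *; omega⟩
    · exact exists_cong_add_one (by omega) hr
    · by_cases h : y + (k + k) < r + r
      · obtain ⟨x, hx, h'⟩ := exists_cong_lt h
        exact ⟨x, hx, by unfold Cong at *; omega⟩
      · exact ⟨y + (k + k) - (r + r), by omega, by unfold Cong; omega⟩
  obtain ⟨s, rfl⟩ : ∃ s, r = s + s := ⟨r / 2, by omega⟩
  have hs : (s + s) / 2 = s := by omega
  have hs0 : 0 < s := by omega
  simp only [h1, h2, if_false, hs]
  have ly := lo_lt hy
  have lk := lo_lt hk
  have hy2 := hi_lt s y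
  have hk2 := hi_lt s k
  have par : ∀ b < 3, ∃ i < 2, Cong 2 (hi s y) (i + b) := fun b hb => by
    unfold Cong
    by_cases h : (hi s y + b) % 2 = 0
    · exact ⟨0, by omega, by omega⟩
    · exact ⟨1, by omega, by omega⟩
  have base : ∃ x < s + s, Cong s (lo s y) (lo s x + lo s k) ∧
      Cong 2 (hi s y) (hi s x + hi s k) := by
    obtain ⟨u, hu, hu'⟩ := exists_add_cong ly lk.le
    obtain ⟨i, hi, hi'⟩ := par (hi s k) (by omega)
    obtain ⟨x, hx, e1, e2⟩ := exists_lo_hi hu hi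
    exact ⟨x, hx, by rw [e1]; exact hu', by rw [e2]; exact hi'⟩
  by_cases h3 : t = 0
  · simp only [h3, if_true]
    obtain ⟨x, hx, e1, e2⟩ := base
    by_cases hks : k < s
    · have hk0 : hi s k = 0 := by simp [hi, hks]
      by_cases hx2 : x < 2
      · refine ⟨1 - x, by omega, ?_⟩
        -- Here `r` is `2` modulo `4` and different from `2`, so `s` is at least `3` and both
        -- exchanged vertices have second coordinate `0`.
        have h1s : x < s := by omega
        rw [if_pos ⟨hks, by omega⟩]
        have : lo s x = x := by simp [lo, h1s]
        have : hi s x = 0 := by simp [hi, h1s]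
        unfold Cong at *
        omega
      · refine ⟨x, hx, ?_⟩
        rw [if_neg (by omega)]
        exact ⟨e1, e2⟩
    · exact ⟨x, hx, by rw [if_neg (by omega)]; exact ⟨e1, e2⟩⟩
  · simp only [h3, if_false]
    split_ifs
    · exact base
    · obtain ⟨u, hu, hu'⟩ := exists_cong_add_one (r := s) (a := lo s y + (lo s k + lo s k))
        (by omega) hs0
      obtain ⟨i, hi, hi'⟩ := par (hi s k + 1) (by omega)
      obtain ⟨x, hx, e1, e2⟩ := exists_lo_hi hu hi
      exact ⟨x, hx, by rw [e1]; exact hu', by rw [e2]; exact hi'⟩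
    · obtain ⟨u, hu, hu'⟩ := exists_cong_add_one (r := s) (a := lo s y + (lo s k + lo s k))
        (by omega) hs0
      obtain ⟨i, hi, hi'⟩ := par (hi s k) (by omega)
      obtain ⟨x, hx, e1, e2⟩ := exists_lo_hi hu hi
      exact ⟨x, hx, by rw [e1]; exact hu', by rw [e2]; exact hi'⟩

/-- For odd `r` doubling is injective modulo `r`. If `4` divides `r`, the shifts `1 - 2k` for small
`k` are odd and the shifts `-2k` for large `k` are even, while the middle side exchanges
neighbouring large colours, which pair up because `r / 2` is even. For `r = 2s` with `s` odd, the
two coordinates of the colour are recovered modulo `s` and modulo `2`. -/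
theorem latin_unique {r k l t x y : ℕ} (hr2 : r ≠ 2) (hk : k < r) (hl : l < r) (hx : x < r)
    (hy : y < r)
    (h : latin r k t x y) (h' : latin r l t x y) : k = l := by
  unfold latin at h h'
  by_cases h1 : r % 2 = 1
  · simp only [h1, if_true] at h h'
    split_ifs at h h' <;> unfold Cong at h h' <;> omega
  by_cases h2 : r % 4 = 0
  · simp only [h1, h2, if_true, if_false] at h h'
    split_ifs at h h' <;> unfold Cong at h h' <;> omega
  obtain ⟨s, rfl⟩ : ∃ s, r = s + s := ⟨r / 2, by omega⟩
  have hs : (s + s) / 2 = s := by omega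
  simp only [h1, h2, if_false, hs] at h h'
  have lx := lo_lt hx
  have ly := lo_lt hy
  have lk := lo_lt hk
  have ll := lo_lt hl
  have hk2 := hi_lt s k
  have hl2 := hi_lt s l
  have hk' : k < s ↔ hi s k = 0 := by unfold hi; split_ifs <;> simp [*]
  have hl' : l < s ↔ hi s l = 0 := by unfold hi; split_ifs <;> simp [*]
  have hx01 : x < 2 → lo s x = x ∧ hi s x = 0 := by
    intro hx2
    have : x < s := by omega
    simp [lo, hi, this]
  have hx2 := hi_lt s x
  have hy2 := hi_lt s y
  refine eq_of_lo_hi (s := s) ?_ ?_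
  · split_ifs at h h' <;> unfold Cong at h h' <;> omega
  · split_ifs at h h' <;> unfold Cong at h h' <;> omega

theorem reflTransGen_of_enumeration {R : ℕ → ℕ → Prop} {r : ℕ} (e : ℕ → ℕ)
    (h1 : ∀ p, p + 1 < r → R (e p) (e (p + 1))) (h2 : R (e (r - 1)) (e 0))
    (h3 : ∀ x < r, ∃ p < r, e p = x) {x z : ℕ} (hx : x < r) (hz : z < r) :
    Relation.ReflTransGen R x z := by
  have up : ∀ d p, p + d < r → Relation.ReflTransGen R (e p) (e (p + d)) := by
    intro d
    induction d with
    | zero => exact fun p _ => .refl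
    | succ d ih => exact fun p hp => (ih p (by omega)).tail (h1 (p + d) (by omega))
  obtain ⟨p, hp, rfl⟩ := h3 x hx
  obtain ⟨q, hq, rfl⟩ := h3 z hz
  have a1 := up (r - 1 - p) p (by omega)
  have a2 := up q 0 (by omega)
  rw [show p + (r - 1 - p) = r - 1 by omega] at a1
  rw [Nat.zero_add] at a2
  exact (a1.tail h2).trans a2

/-- A walk of three arcs in colour `k` through the directed triangle. -/
def LatinRound (r k x z : ℕ) : Prop := ∃ y < r, ∃ w < r, z < r ∧
  latin r k 0 x y ∧ latin r k 1 y w ∧ latin r k 2 w z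

/-- A round from `x` always exists, so it is enough to compute where it can end. -/
theorem latinRound_of {r k x z : ℕ} (hk : k < r) (hx : x < r)
    (h : ∀ z', LatinRound r k x z' → z' = z) : LatinRound r k x z := by
  obtain ⟨y, hy, h1⟩ := latin_exists_right (t := 0) hk hx
  obtain ⟨w, hw, h2⟩ := latin_exists_right (t := 1) hk hy
  obtain ⟨z', hz, h3⟩ := latin_exists_right (t := 2) hk hw
  have hr : LatinRound r k x z' := ⟨y, hy, w, hw, hz, h1, h2, h3⟩
  rwa [h z' hr] at hr

/-- The shifts `κ`, `κ` and `1 - 2κ` add up to `1`. -/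
theorem cong_chain {s x y w z κ : ℕ} (hx : x < s) (hy : y < s) (hw : w < s) (hz : z < s)
    (hκ : κ < s) (h1 : Cong s y (x + κ)) (h2 : Cong s w (y + κ))
    (h3 : Cong s (z + (κ + κ)) (w + 1)) : Cong s z (x + 1) := by
  have h1' : y = x + κ ∨ y + s = x + κ := by unfold Cong at h1; omega
  have h2' : w = y + κ ∨ w + s = y + κ := by unfold Cong at h2; omega
  clear h1 h2
  unfold Cong at *
  rcases h1' with h1 | h1 <;> rcases h2' with h2 | h2 <;> rcases h3 with h3 | h3 | h3 | h3 <;> omega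

theorem Cong.mod_two {a b : ℕ} (h : Cong 2 a b) : a % 2 = b % 2 := by
  unfold Cong at h; omega

theorem latinRound_odd {r k x z : ℕ} (h1 : r % 2 = 1) (hk : k < r) (hx : x < r)
    (h : LatinRound r k x z) : Cong r z (x + 1) := by
  obtain ⟨y, hy, w, hw, hz, a, b, c⟩ := h
  simp only [latin, h1, if_true] at a b c
  norm_num at a b c
  exact cong_chain hx hy hw hz hk a b c

/-- For a large colour the shifts are `k`, then `k + 1` or `k - 1` according to parity, then `-2k`,
with sum `1` or `-1`. -/
theorem latinRound_four {r k x z : ℕ} (h1 : r % 4 = 0) (hk : k < r) (hx : x < r)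
    (h : LatinRound r k x z) :
    if k < r / 2 ∨ k % 2 = 0 then Cong r z (x + 1) else Cong r (z + 1) x := by
  obtain ⟨y, hy, w, hw, hz, a, b, c⟩ := h
  have h2 : ¬ r % 2 = 1 := by omega
  simp only [latin, h1, h2, if_true, if_false] at a b c
  norm_num at a b c
  have a' : y = x + k ∨ y + r = x + k := by unfold Cong at a; omega
  clear a
  by_cases hk2 : k < r / 2
  · rw [if_pos hk2] at b c
    rw [if_pos (.inl hk2)]
    exact cong_chain hx hy hw hz hk (by unfold Cong; omega) b c
  · rw [if_neg hk2] at b c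
    by_cases hk3 : k % 2 = 0
    · rw [if_pos hk3] at b
      rw [if_pos (.inr hk3)]
      unfold Cong at *
      rcases a' with h1 | h1 <;> rcases b with h2 | h2 | h2 | h2 <;>
        rcases c with h3 | h3 | h3 | h3 <;> omega
    · rw [if_neg hk3] at b
      rw [if_neg (by tauto)]
      unfold Cong at *
      rcases a' with h1 | h1 <;> rcases b with h2 | h2 | h2 | h2 <;>
        rcases c with h3 | h3 | h3 | h3 <;> omega

/-- Vertices are pairs modulo `s` and modulo `2`. The first coordinate grows by `1`, after the
exchange of `0` and `1` for small colours. The second gains `hi s k` three times, hence once modulo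
`2`, and a further `1` on entering first coordinate `0` or `1`. -/
theorem latinRound_two {s k x z : ℕ} (h1 : s % 2 = 1) (hs : 3 ≤ s) (hk : k < s + s)
    (hx : x < s + s) (h : LatinRound (s + s) k x z) :
    z < s + s ∧ Cong s (lo s z) ((if k < s ∧ x < 2 then 1 - x else lo s x) + 1) ∧
    hi s z % 2 = (hi s x + (if k < s then 0 else 1) + if lo s z < 2 then 1 else 0) % 2 := by
  obtain ⟨y, hy, w, hw, hz, a, b, c⟩ := h
  have h2 : ¬ (s + s) % 2 = 1 := by omega
  have h3 : ¬ (s + s) % 4 = 0 := by omega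
  have h4 : (s + s) / 2 = s := by omega
  simp only [latin, h2, h3, h4, if_false, if_true, OfNat.ofNat_ne_zero, OfNat.ofNat_ne_one,
    one_ne_zero] at a b c
  have lk := lo_lt hk
  have lx := lo_lt hx
  have ly := lo_lt hy
  have lw := lo_lt hw
  have lz := lo_lt hz
  have hk' : hi s k = if k < s then 0 else 1 := rfl
  have hx01 : x < 2 → hi s x = 0 := by
    intro hx2
    have : x < s := by omega
    simp [hi, this]
  obtain ⟨b1, b2⟩ := b
  obtain ⟨c1, c2⟩ := c
  rw [← hk']
  refine ⟨hz, ?_, ?_⟩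
  · by_cases hc : k < s ∧ x < 2
    · rw [if_pos hc] at a ⊢
      exact cong_chain (by omega) ly lw lz lk a.1 b1 c1
    · rw [if_neg hc] at a ⊢
      exact cong_chain lx ly lw lz lk a.1 b1 c1
  · have b3 := b2.mod_two
    have c3 := c2.mod_two
    clear b1 c1 b2 c2
    generalize (if lo s z < 2 then 1 else 0) = δ at *
    by_cases hc : k < s ∧ x < 2
    · rw [if_pos hc] at a
      have h0 : hi s k = 0 := by rw [hk', if_pos hc.1]
      have := hx01 hc.2
      omega
    · rw [if_neg hc] at a
      have a3 := a.2.mod_two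
      omega

theorem lo_hi_cases (s x : ℕ) :
    (x < s ∧ lo s x = x ∧ hi s x = 0) ∨ (s ≤ x ∧ lo s x + s = x ∧ hi s x = 1) := by
  by_cases h : x < s
  · exact .inl ⟨h, by simp [lo, h], by simp [hi, h]⟩
  · exact .inr ⟨by omega, by simp only [lo, h, if_false]; omega, by simp [hi, h]⟩

/-- During one turn of the first coordinate the second one flips twice. Without the exchange of `0`
and `1` there would thus be two cycles of length `s`; these two vertices lie in different ones, and
exchanging them merges the cycles. -/
theorem latinRound_two_low {s k x z : ℕ} (h1 : s % 2 = 1) (hs : 3 ≤ s) (hk : k < s)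
    (hx : x < s + s) (h : LatinRound (s + s) k x z) :
    z = if x = 0 then 2 else if x = 1 then s + 1 else
        if x = s then 1 else if x + 1 = s + s then 0 else x + 1 := by
  obtain ⟨hz, h3, h4⟩ := latinRound_two h1 hs (by omega) hx h
  clear h
  have lz := lo_lt hz
  have lx := lo_lt hx
  have cx := lo_hi_cases s x
  have cz := lo_hi_cases s z
  generalize lo s z = u at *
  generalize lo s x = v at *
  generalize hi s z = i at *
  generalize hi s x = j at *
  simp only [hk, true_and, if_true] at h3 h4
  generalize hw : (if x < 2 then 1 - x else v) = w at *
  have hw' : (x < 2 ∧ w = 1 - x) ∨ (2 ≤ x ∧ w = v) := by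
    split_ifs at hw <;> omega
  have h3' : (w + 1 < s ∧ u = w + 1) ∨ (w + 1 = s ∧ u = 0) := by
    unfold Cong at h3; omega
  clear h3 hw
  generalize hd : (if u < 2 then 1 else 0) = d at *
  have hd' : (u < 2 ∧ d = 1) ∨ (2 ≤ u ∧ d = 0) := by
    split_ifs at hd <;> omega
  clear hd
  split_ifs <;> omega

/-- Here the second coordinate changes `s + 2` times modulo `2` in one turn of the first. This is
odd, so the cycle has length `2s` without any exchange. -/
theorem latinRound_two_high {s k x z : ℕ} (h1 : s % 2 = 1) (hs : 3 ≤ s) (hk : s ≤ k)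
    (hk2 : k < s + s) (hx : x < s + s) (h : LatinRound (s + s) k x z) :
    z = if x = 0 ∨ x = s then x + 1 else
        if x + 1 = s then 0 else if x + 1 = s + s then s else
        if x < s then x + 1 + s else x + 1 - s := by
  obtain ⟨hz, h3, h4⟩ := latinRound_two h1 hs (by omega) hx h
  clear h
  have lz := lo_lt hz
  have lx := lo_lt hx
  have cx := lo_hi_cases s x
  have cz := lo_hi_cases s z
  generalize lo s z = u at *
  generalize lo s x = v at *
  generalize hi s z = i at *
  generalize hi s x = j at *
  rw [if_neg (by omega)] at h3
  rw [if_neg (by omega)] at h4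
  have h3' : (v + 1 < s ∧ u = v + 1) ∨ (v + 1 = s ∧ u = 0) := by
    unfold Cong at h3; omega
  clear h3
  generalize hd : (if u < 2 then 1 else 0) = d at *
  have hd' : (u < 2 ∧ d = 1) ∨ (2 ≤ u ∧ d = 0) := by
    split_ifs at hd <;> omega
  clear hd
  split_ifs <;> omega

theorem latinRound_reflTransGen {r k x z : ℕ} (hr2 : r ≠ 2) (hk : k < r) (hx : x < r) (hz : z < r) :
    Relation.ReflTransGen (LatinRound r k) x z := by
  by_cases h1 : r % 2 = 1
  · refine reflTransGen_of_enumeration id (fun p hp => ?_) ?_ (fun x hx => ⟨x, hx, rfl⟩) hx hz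
    · refine latinRound_of hk (by simpa using by omega) fun z' h => ?_
      have := latinRound_odd h1 hk (by simpa using by omega) h
      obtain ⟨_, _, _, _, hz', _⟩ := h
      unfold Cong at this
      simp only [id] at *
      omega
    · refine latinRound_of hk (by simpa using by omega) fun z' h => ?_
      have := latinRound_odd h1 hk (by simpa using by omega) h
      obtain ⟨_, _, _, _, hz', _⟩ := h
      unfold Cong at this
      simp only [id] at *
      omega
  by_cases h2 : r % 4 = 0
  · by_cases hk2 : k < r / 2 ∨ k % 2 = 0
    · refine reflTransGen_of_enumeration id (fun p hp => ?_) ?_ (fun x hx => ⟨x, hx, rfl⟩) hx hz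
      all_goals
        refine latinRound_of hk (by simpa using by omega) fun z' h => ?_
        have := latinRound_four h2 hk (by simpa using by omega) h
        obtain ⟨_, _, _, _, hz', _⟩ := h
        rw [if_pos hk2] at this
        unfold Cong at this
        simp only [id] at *
        omega
    · refine reflTransGen_of_enumeration (fun p => r - 1 - p) (fun p hp => ?_) ?_
        (fun x hx => ⟨r - 1 - x, by omega, by omega⟩) hx hz
      all_goals
        refine latinRound_of hk (by omega) fun z' h => ?_
        have := latinRound_four h2 hk (by omega) h
        obtain ⟨_, _, _, _, hz', _⟩ := h
        rw [if_neg hk2] at this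
        unfold Cong at this
        omega
  obtain ⟨s, rfl⟩ : ∃ s, r = s + s := ⟨r / 2, by omega⟩
  have hs : 3 ≤ s := by omega
  have hs1 : s % 2 = 1 := by omega
  by_cases hks : k < s
  · have key : ∀ x z, x < s + s → z = (if x = 0 then 2 else if x = 1 then s + 1 else
        if x = s then 1 else if x + 1 = s + s then 0 else x + 1) → LatinRound (s + s) k x z :=
      fun x z hx hz => latinRound_of hk hx fun z' h =>
        (latinRound_two_low hs1 hs hks hx h).trans hz.symm
    have e1 : ∀ x z, x < s + s → x ≠ 0 → x ≠ 1 → x ≠ s → x + 1 ≠ s + s → z = x + 1 →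
        LatinRound (s + s) k x z := fun x z hx h0 h1 h2 h3 hz =>
      key x z hx (by rw [if_neg h0, if_neg h1, if_neg h2, if_neg h3, hz])
    -- The merged cycle is `0, 2, 3, …, s, 1, s + 1, …, 2s - 1`.
    let e : ℕ → ℕ := fun p => if p = 0 then 0 else if p < s then p + 1 else if p = s then 1 else p
    have f0 : e 0 = 0 := rfl
    have f1 : ∀ p, 0 < p → p < s → e p = p + 1 := fun p h h' => by simp [e, h.ne', h']
    have f2 : e s = 1 := by simp [e]; omega
    have f3 : ∀ p, s < p → e p = p := fun p h => by
      simp only [e]; rw [if_neg (by omega), if_neg (by omega), if_neg (by omega)]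
    refine reflTransGen_of_enumeration e (fun p hp => ?_) ?_ (fun x hx => ?_) hx hz
    · rcases Nat.eq_zero_or_pos p with rfl | h0
      · rw [f0, f1 _ (by omega) (by omega)]
        exact key _ _ (by omega) (by rw [if_pos rfl])
      rcases Nat.lt_or_ge (p + 1) s with h | h
      · rw [f1 p h0 (by omega), f1 _ (by omega) h]
        exact e1 _ _ (by omega) (by omega) (by omega) (by omega) (by omega) rfl
      rcases h.eq_or_lt with h | h
      · rw [f1 p h0 (by omega), ← h, f2]
        exact key _ _ (by omega) (by rw [if_neg (by omega), if_neg (by omega), if_pos rfl])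
      rcases Nat.eq_or_lt_of_le (Nat.le_of_lt_succ h) with h | h
      · rw [← h, f2, f3 _ (by omega)]
        exact key _ _ (by omega) (by rw [if_neg (by omega), if_pos rfl])
      · rw [f3 _ h, f3 _ (by omega)]
        exact e1 _ _ (by omega) (by omega) (by omega) (by omega) (by omega) rfl
    · rw [f3 _ (by omega), f0]
      exact key _ _ (by omega) (by
        rw [if_neg (by omega), if_neg (by omega), if_neg (by omega), if_pos (by omega)])
    · rcases Nat.eq_zero_or_pos x with rfl | h0
      · exact ⟨0, hx, f0⟩
      by_cases h1 : x = 1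
      · exact ⟨s, by omega, by rw [f2, h1]⟩
      by_cases h2 : x ≤ s
      · exact ⟨x - 1, by omega, by rw [f1 _ (by omega) (by omega)]; omega⟩
      · exact ⟨x, hx, f3 x (by omega)⟩
  · have key : ∀ x z, x < s + s → z = (if x = 0 ∨ x = s then x + 1 else
        if x + 1 = s then 0 else if x + 1 = s + s then s else
        if x < s then x + 1 + s else x + 1 - s) → LatinRound (s + s) k x z :=
      fun x z hx hz => latinRound_of hk hx fun z' h =>
        (latinRound_two_high hs1 hs (by omega) hk hx h).trans hz.symm
    -- The cycle starts at `1` and changes halves at every step, except on entering and on leaving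
    -- first coordinate `0`.
    let e : ℕ → ℕ := fun p => if p + 1 = s then s else if p + 1 = s + s then 0 else if p < s then
        (if p % 2 = 0 then p + 1 else p + 1 + s) else (if p % 2 = 0 then p + 1 - s else p + 1)
    have f1 : ∀ p, p + 1 < s → e p = if p % 2 = 0 then p + 1 else p + 1 + s := fun p h => by
      simp only [e]; rw [if_neg (by omega), if_neg (by omega), if_pos (by omega)]
    have f2 : e (s - 1) = s := by simp only [e]; rw [if_pos (by omega)]
    have f3 : ∀ p, s ≤ p → p + 1 < s + s → e p = if p % 2 = 0 then p + 1 - s else p + 1 :=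
      fun p h h' => by
      simp only [e]; rw [if_neg (by omega), if_neg (by omega), if_neg (by omega)]
    have f4 : e (s + s - 1) = 0 := by simp only [e]; rw [if_neg (by omega), if_pos (by omega)]
    have g1 : ∀ x z, 0 < x → x + 1 < s → z = x + 1 + s → LatinRound (s + s) k x z :=
      fun x z h1 h2 hz => key x z (by omega) (by
        rw [if_neg (by omega), if_neg (by omega), if_neg (by omega), if_pos (by omega), hz])
    have g2 : ∀ x z, s < x → x + 1 < s + s → z = x + 1 - s → LatinRound (s + s) k x z :=
      fun x z h1 h2 hz => key x z (by omega) (by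
        rw [if_neg (by omega), if_neg (by omega), if_neg (by omega), if_neg (by omega), hz])
    refine reflTransGen_of_enumeration e (fun p hp => ?_) ?_ (fun x hx => ?_) hx hz
    · rcases Nat.lt_or_ge (p + 2) s with h | h
      · rw [f1 p (by omega), f1 _ (by omega)]
        rcases Nat.mod_two_eq_zero_or_one p with hp2 | hp2
        · rw [if_pos hp2, if_neg (by omega)]
          exact g1 _ _ (by omega) (by omega) rfl
        · rw [if_neg (by omega), if_pos (by omega)]
          exact g2 _ _ (by omega) (by omega) (by omega)
      rcases h.eq_or_lt with h | h
      · rw [f1 p (by omega), if_neg (by omega), show p + 1 = s - 1 by omega, f2]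
        exact key _ _ (by omega) (by
          rw [if_neg (by omega), if_neg (by omega), if_pos (by omega)])
      rcases Nat.eq_or_lt_of_le (Nat.le_of_lt_succ h) with h | h
      · rw [show p = s - 1 by omega, f2, show s - 1 + 1 = s by omega, f3 _ le_rfl (by omega),
          if_neg (by omega)]
        exact key _ _ (by omega) (by rw [if_pos (.inr rfl)])
      rcases Nat.lt_or_ge (p + 2) (s + s) with h' | h'
      · rw [f3 p (by omega) (by omega), f3 _ (by omega) (by omega)]
        rcases Nat.mod_two_eq_zero_or_one p with hp2 | hp2
        · rw [if_pos hp2, if_neg (by omega)]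
          exact g1 _ _ (by omega) (by omega) (by omega)
        · rw [if_neg (by omega), if_pos (by omega)]
          exact g2 _ _ (by omega) (by omega) rfl
      · rw [f3 p (by omega) (by omega), if_pos (by omega), show p + 1 = s + s - 1 by omega, f4]
        exact key _ _ (by omega) (by rw [if_neg (by omega), if_pos (by omega)])
    · rw [f4, f1 0 (by omega), if_pos (by omega)]
      exact key _ _ (by omega) (by rw [if_pos (.inl rfl)])
    · rcases Nat.eq_zero_or_pos x with rfl | h0
      · exact ⟨s + s - 1, by omega, f4⟩
      by_cases h1 : x = s
      · exact ⟨s - 1, by omega, by rw [f2, h1]⟩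
      rcases Nat.lt_or_ge x s with h2 | h2
      · rcases Nat.mod_two_eq_zero_or_one x with hp2 | hp2
        · exact ⟨s + x - 1, by omega, by
            rw [f3 _ (by omega) (by omega), if_pos (by omega)]; omega⟩
        · exact ⟨x - 1, by omega, by rw [f1 _ (by omega), if_pos (by omega)]; omega⟩
      · rcases Nat.mod_two_eq_zero_or_one x with hp2 | hp2
        · exact ⟨x - 1, by omega, by
            rw [f3 _ (by omega) (by omega), if_neg (by omega)]; omega⟩
        · exact ⟨x - 1 - s, by omega, by rw [f1 _ (by omega), if_neg (by omega)]; omega⟩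

/-! ### Strong colour classes of arcs between blocks -/

namespace Digraph

open Relation (ReflTransGen)

variable {n : ℕ} {Q : Digraph (Fin n)}

/-- An arc between different blocks. -/
def BlockArc (Q : Digraph (Fin n)) (u v : Fin n) : Prop := Q.Adj u v ∧ ¬ Q.SameBlock u v

theorem BlockArc.congr {u u' v v' : Fin n} (h : Q.BlockArc u v) (hu : Q.SameBlock u u')
    (hv : Q.SameBlock v v') : Q.BlockArc u' v' := by
  have E := Q.sameBlock_equivalence
  exact ⟨(SameBlock.adj_iff hu hv h.2).1 h.1, fun h' => h.2 (E.trans hu (E.trans h' (E.symm hv)))⟩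

/-- Some arc leaves every set of blocks. -/
theorem IsStrong.exists_blockArc (hs : Q.IsStrong) {P : Fin n → Prop}
    (hP : ∀ u v, Q.SameBlock u v → P u → P v) {u v : Fin n} (hu : P u) (hv : ¬ P v) :
    ∃ x y, Q.BlockArc x y ∧ P x ∧ ¬ P y := by
  by_contra! h
  have : ∀ w, ReflTransGen Q.Adj u w → P w := by
    intro w hw
    induction hw with
    | refl => exact hu
    | @tail b c _ hbc ih =>
      by_cases hb : Q.SameBlock b c
      · exact hP _ _ hb ih
      · exact h b c ⟨hbc, hb⟩ ih
  exact hv (this v (hs u v))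

theorem IsStrong.exists_blockArc_from (hs : Q.IsStrong) (hn : 2 ≤ n) (u : Fin n) :
    ∃ v, Q.BlockArc u v := by
  have E := Q.sameBlock_equivalence
  have : Nontrivial (Fin n) := Fin.nontrivial_iff_two_le.2 hn
  obtain ⟨v, hv⟩ := hs.exists_not_sameBlock u
  obtain ⟨x, y, h1, h2, -⟩ := hs.exists_blockArc (P := Q.SameBlock u)
    (fun a b hab ha => E.trans ha hab) (E.refl u) hv
  exact ⟨y, h1.congr (E.symm h2) (E.refl y)⟩

theorem IsStrong.exists_blockArc_to (hs : Q.IsStrong) (hn : 2 ≤ n) (u : Fin n) :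
    ∃ v, Q.BlockArc v u := by
  have E := Q.sameBlock_equivalence
  have : Nontrivial (Fin n) := Fin.nontrivial_iff_two_le.2 hn
  obtain ⟨v, hv⟩ := hs.exists_not_sameBlock u
  obtain ⟨x, y, h1, -, h2⟩ := hs.exists_blockArc (P := fun v => ¬ Q.SameBlock u v)
    (fun a b hab ha hb => ha (E.trans hb (E.symm hab))) hv (fun h => h (E.refl u))
  rw [not_not] at h2
  exact ⟨x, h1.congr (E.refl x) (E.symm h2)⟩

/-- A spanning subgraph is strong if arcs between blocks can be followed forwards and backwards
along it and the vertices of small rank in one block can be reached from each other. -/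
theorem reflTransGen_of_lifts (hs : Q.IsStrong) (hn : 2 ≤ n) {H : Fin n → Fin n → Prop} {r : ℕ}
    (a : Fin n)
    (hout : ∀ u v, Q.BlockArc u v → ∃ v', Q.SameBlock v v' ∧ Q.rank v' < r ∧ H u v')
    (hin : ∀ u v, Q.BlockArc u v → ∃ u', Q.SameBlock u u' ∧ Q.rank u' < r ∧ H u' v)
    (hcore : ∀ u v, Q.SameBlock a u → Q.SameBlock a v → Q.rank u < r → Q.rank v < r →
      ReflTransGen H u v) (u v : Fin n) : ReflTransGen H u v := by
  have E := Q.sameBlock_equivalence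
  -- Follow a walk of `Q` to `a`: arcs between blocks are lifted, and arcs inside a block are
  -- skipped, since only the block of the current vertex matters.
  have to_core : ∀ u, ∃ u', Q.SameBlock a u' ∧ Q.rank u' < r ∧ ReflTransGen H u u' := by
    have key : ∀ p, ReflTransGen Q.Adj p a → ∀ u, Q.SameBlock p u → Q.rank u < r →
        ∃ u', Q.SameBlock a u' ∧ Q.rank u' < r ∧ ReflTransGen H u u' := by
      intro p hp
      induction hp using Relation.ReflTransGen.head_induction_on with
      | refl => exact fun u hu hr => ⟨u, hu, hr, .refl⟩
      | @head p q hpq _ ih =>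
        intro u hu hr
        by_cases hb : Q.SameBlock p q
        · exact ih u (E.trans (E.symm hb) hu) hr
        · obtain ⟨q', h1, h2, h3⟩ := hout u q (BlockArc.congr ⟨hpq, hb⟩ hu (E.refl q))
          obtain ⟨u', k1, k2, k3⟩ := ih q' h1 h2
          exact ⟨u', k1, k2, .head h3 k3⟩
    intro u
    obtain ⟨v, hv⟩ := hs.exists_blockArc_from hn u
    obtain ⟨v', h1, h2, h3⟩ := hout u v hv
    obtain ⟨u', k1, k2, k3⟩ := key v' (hs v' a) v' (E.refl _) h2
    exact ⟨u', k1, k2, .head h3 k3⟩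
  have from_core : ∀ u, ∃ u', Q.SameBlock a u' ∧ Q.rank u' < r ∧ ReflTransGen H u' u := by
    have key : ∀ p, ReflTransGen Q.Adj a p → ∀ u, Q.SameBlock p u → Q.rank u < r →
        ∃ u', Q.SameBlock a u' ∧ Q.rank u' < r ∧ ReflTransGen H u' u := by
      intro p hp
      induction hp with
      | refl => exact fun u hu hr => ⟨u, hu, hr, .refl⟩
      | @tail q p _ hqp ih =>
        intro u hu hr
        by_cases hb : Q.SameBlock q p
        · exact ih u (E.trans hb hu) hr
        · obtain ⟨q', h1, h2, h3⟩ := hin q u (BlockArc.congr ⟨hqp, hb⟩ (E.refl q) hu)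
          obtain ⟨u', k1, k2, k3⟩ := ih q' h1 h2
          exact ⟨u', k1, k2, k3.tail h3⟩
    intro u
    obtain ⟨v, hv⟩ := hs.exists_blockArc_to hn u
    obtain ⟨v', h1, h2, h3⟩ := hin v u hv
    obtain ⟨u', k1, k2, k3⟩ := key v' (hs a v') v' (E.refl _) h2
    exact ⟨u', k1, k2, k3.tail h3⟩
  obtain ⟨u', h1, h2, h3⟩ := to_core u
  obtain ⟨v', k1, k2, k3⟩ := from_core v
  exact (h3.trans (hcore u' v' h1 k1 h2 k2)).trans k3

/-- The arcs of colour `k`: between vertices of rank smaller than `r` they are given by `L`, the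
other vertices are joined to those of rank `k`. -/
def ColourArc (Q : Digraph (Fin n)) (r : ℕ) (L : ℕ → Fin n → Fin n → Prop) (k : ℕ)
    (u v : Fin n) : Prop :=
  Q.BlockArc u v ∧ ((Q.rank u < r ∧ Q.rank v < r ∧ L k u v) ∨ (r ≤ Q.rank u ∧ Q.rank v = k) ∨
    (r ≤ Q.rank v ∧ Q.rank u = k))

/-- An arc with an end of rank at least `r` has its colour as the rank of the other end, which is
below `r`; only arcs between low vertices depend on the rule. -/
theorem ColourArc.unique {r k l : ℕ} (hk : k < r) {L : ℕ → Fin n → Fin n → Prop}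
    (hL : ∀ u v, Q.rank u < r → Q.rank v < r → L k u v → L l u v → k = l)
    {u v : Fin n} (h : Q.ColourArc r L k u v) (h' : Q.ColourArc r L l u v) : k = l := by
  obtain ⟨-, ⟨h1, h2, h3⟩ | ⟨h1, h2⟩ | ⟨h1, h2⟩⟩ := h <;>
    obtain ⟨-, ⟨k1, k2, k3⟩ | ⟨k1, k2⟩ | ⟨k1, k2⟩⟩ := h' <;>
    first | omega | exact hL u v h1 h2 h3 k3

theorem exists_rank_eq_of_lt_minBlock (u : Fin n) {k : ℕ} (hk : k < Q.minBlock) :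
    ∃ v, Q.SameBlock u v ∧ Q.rank v = k :=
  exists_rank_eq u (hk.trans_le ((minBlock_spec (Nat.zero_lt_of_lt u.2)).1 u))

/-- The common frame of both colourings: local solvability of the rule in both directions, and
reachability among the low vertices of one block. Every block has a vertex of rank `k`, to which
high vertices are attached. -/
theorem colourArc_reflTransGen (hs : Q.IsStrong) (hn : 2 ≤ n) {k : ℕ} (hk : k < Q.minBlock)
    {L : ℕ → Fin n → Fin n → Prop} (a : Fin n)
    (hout : ∀ u v, Q.BlockArc u v → Q.rank u < Q.minBlock → ∃ y < Q.minBlock,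
      ∀ v', Q.SameBlock v v' → Q.rank v' = y → L k u v')
    (hin : ∀ u v, Q.BlockArc u v → Q.rank v < Q.minBlock → ∃ x < Q.minBlock,
      ∀ u', Q.SameBlock u u' → Q.rank u' = x → L k u' v)
    (hcore : ∀ u v, Q.SameBlock a u → Q.SameBlock a v → Q.rank u < Q.minBlock →
      Q.rank v < Q.minBlock → ReflTransGen (Q.ColourArc Q.minBlock L k) u v) (u v : Fin n) :
    ReflTransGen (Q.ColourArc Q.minBlock L k) u v := by
  have E := Q.sameBlock_equivalence
  refine reflTransGen_of_lifts hs hn a ?_ ?_ hcore u v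
  · intro u v h
    by_cases hr : Q.rank u < Q.minBlock
    · obtain ⟨y, hy, hL⟩ := hout u v h hr
      obtain ⟨v', h1, rfl⟩ := exists_rank_eq_of_lt_minBlock v hy
      exact ⟨v', h1, hy, h.congr (E.refl u) h1, .inl ⟨hr, hy, hL v' h1 rfl⟩⟩
    · obtain ⟨v', h1, h2⟩ := exists_rank_eq_of_lt_minBlock v hk
      exact ⟨v', h1, by omega, h.congr (E.refl u) h1, .inr (.inl ⟨by omega, h2⟩)⟩
  · intro u v h
    by_cases hr : Q.rank v < Q.minBlock
    · obtain ⟨x, hx, hL⟩ := hin u v h hr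
      obtain ⟨u', h1, rfl⟩ := exists_rank_eq_of_lt_minBlock u hx
      exact ⟨u', h1, hx, h.congr h1 (E.refl v), .inl ⟨hx, hr, hL u' h1 rfl⟩⟩
    · obtain ⟨u', h1, h2⟩ := exists_rank_eq_of_lt_minBlock u hk
      exact ⟨u', h1, by omega, h.congr h1 (E.refl v), .inr (.inr ⟨by omega, h2⟩)⟩

/-- If the ranks in one block can be reached from each other along the relation `R`, and `R` can
be followed in `H`, then the vertices can be reached from each other. -/
theorem reflTransGen_of_rank {H : Fin n → Fin n → Prop} {R : ℕ → ℕ → Prop} {a : Fin n}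
    (hR : ∀ x z, R x z → ∀ u, Q.SameBlock a u → Q.rank u = x →
      ∃ u', Q.SameBlock a u' ∧ Q.rank u' = z ∧ ReflTransGen H u u')
    {u v : Fin n} (hu : Q.SameBlock a u) (hv : Q.SameBlock a v)
    (h : ReflTransGen R (Q.rank u) (Q.rank v)) : ReflTransGen H u v := by
  have E := Q.sameBlock_equivalence
  have key : ∀ z, ReflTransGen R (Q.rank u) z →
      ∃ u', Q.SameBlock a u' ∧ Q.rank u' = z ∧ ReflTransGen H u u' := by
    intro z hz
    induction hz with
    | refl => exact ⟨u, hu, rfl, .refl⟩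
    | @tail y z _ hyz ih =>
      obtain ⟨w, h1, h2, h3⟩ := ih
      obtain ⟨w', k1, k2, k3⟩ := hR y z hyz w h1 h2
      exact ⟨w', k1, k2, h3.trans k3⟩
  obtain ⟨u', h1, h2, h3⟩ := key _ h
  rwa [rank_inj (E.trans (E.symm h1) hv) h2] at h3

/-! ### Quotients with a closed walk of even length -/

/-- The arc `za` between blocks lies on a directed cycle of length two or four of blocks. -/
def GoodArc (Q : Digraph (Fin n)) (z a : Fin n) : Prop :=
  Q.BlockArc z a ∧ (Q.BlockArc a z ∨ ∃ b c, Q.BlockArc a b ∧ Q.BlockArc b c ∧ Q.BlockArc c z)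

/-- The first such arc. -/
def FirstGoodArc (Q : Digraph (Fin n)) (z a : Fin n) : Prop :=
  Q.GoodArc z a ∧ ¬ ∃ z' a', (z' < z ∨ z' = z ∧ a' < a) ∧ Q.GoodArc z' a'

/-- The arc `uv` joins the same blocks as the chosen arc. -/
def Twisted (Q : Digraph (Fin n)) (u v : Fin n) : Prop :=
  ∃ z a, Q.FirstGoodArc z a ∧ Q.SameBlock z u ∧ Q.SameBlock a v

theorem FirstGoodArc.unique {z a z' a' : Fin n} (h : Q.FirstGoodArc z a)
    (h' : Q.FirstGoodArc z' a') : z = z' ∧ a = a' := by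
  have h1 : ¬ (z' < z ∨ z' = z ∧ a' < a) := fun hh => h.2 ⟨z', a', hh, h'.1⟩
  have h2 : ¬ (z < z' ∨ z = z' ∧ a < a') := fun hh => h'.2 ⟨z, a, hh, h.1⟩
  simp only [not_or, not_lt, not_and] at h1 h2
  have : z = z' := le_antisymm h1.1 h2.1
  exact ⟨this, le_antisymm (h1.2 this.symm) (h2.2 this)⟩

theorem exists_firstGoodArc (h : ∃ z a, Q.GoodArc z a) : ∃ z a, Q.FirstGoodArc z a := by
  classical
  have hmin : ∀ P : Fin n → Prop, (∃ x, P x) → ∃ x, P x ∧ ∀ y, y < x → ¬ P y := by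
    rintro P hP
    obtain ⟨x, hx, hx'⟩ := WellFounded.has_min (wellFounded_lt (α := Fin n)) {x | P x} hP
    exact ⟨x, hx, fun y hy hPy => hx' y hPy hy⟩
  obtain ⟨z, hz, hz'⟩ := hmin _ h
  obtain ⟨a, ha, ha'⟩ := hmin _ hz
  refine ⟨z, a, ha, ?_⟩
  rintro ⟨z', a', h | ⟨rfl, h⟩, hg⟩
  · exact hz' z' h ⟨a', hg⟩
  · exact ha' a' h hg

open Classical in
/-- The colouring that is used if there is a good arc. -/
noncomputable def goodRule (Q : Digraph (Fin n)) (k : ℕ) (u v : Fin n) : Prop :=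
  Cong Q.minBlock (Q.rank u + Q.rank v) (k + if Q.Twisted u v then 1 else 0)

theorem Twisted.congr {u u' v v' : Fin n} (hu : Q.SameBlock u u') (hv : Q.SameBlock v v')
    (h : Q.Twisted u v) : Q.Twisted u' v' := by
  have E := Q.sameBlock_equivalence
  obtain ⟨z, a, h1, h2, h3⟩ := h
  exact ⟨z, a, h1, E.trans h2 hu, E.trans h3 hv⟩

/-- One walk around the cycle of blocks through the chosen arc `za` raises the rank in the block of
`a` by one modulo the smallest block order, so all low vertices of that block lie on one closed
walk. -/
theorem goodRule_reflTransGen (hs : Q.IsStrong) (hn : 2 ≤ n) (hg : ∃ z a, Q.GoodArc z a) {k : ℕ}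
    (hk : k < Q.minBlock) (u v : Fin n) :
    ReflTransGen (Q.ColourArc Q.minBlock Q.goodRule k) u v := by
  classical
  have E := Q.sameBlock_equivalence
  have hr : 0 < Q.minBlock := by omega
  obtain ⟨z, a, hza⟩ := exists_firstGoodArc hg
  have htw : ∀ u v, Q.Twisted u v ↔ Q.SameBlock z u ∧ Q.SameBlock a v := by
    intro u v
    constructor
    · rintro ⟨z', a', h1, h2, h3⟩
      obtain ⟨rfl, rfl⟩ := hza.unique h1
      exact ⟨h2, h3⟩
    · exact fun h => ⟨z, a, hza, h.1, h.2⟩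
  have step : ∀ u v, Q.BlockArc u v → Q.rank u < Q.minBlock → ∃ v', Q.SameBlock v v' ∧
      Q.rank v' < Q.minBlock ∧ Q.goodRule k u v' ∧ Q.ColourArc Q.minBlock Q.goodRule k u v' := by
    intro u v h hu
    obtain ⟨y, hy, hc⟩ := exists_cong_add_lt (r := Q.minBlock) (b := Q.rank u)
      (a := k + if Q.Twisted u v then 1 else 0) (by split_ifs <;> omega) (by omega) hr
    obtain ⟨v', h1, rfl⟩ := exists_rank_eq_of_lt_minBlock v hy
    have hL : Q.goodRule k u v' := by
      unfold goodRule
      rw [show Q.Twisted u v' ↔ Q.Twisted u v from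
        ⟨Twisted.congr (E.refl u) (E.symm h1), Twisted.congr (E.refl u) h1⟩, Nat.add_comm]
      exact hc
    exact ⟨v', h1, hy, hL, h.congr (E.refl u) h1, .inl ⟨hu, hy, hL⟩⟩
  refine colourArc_reflTransGen hs hn hk a ?_ ?_ ?_ u v
  · intro u v h hu
    obtain ⟨v', h1, h2, h3, -⟩ := step u v h hu
    refine ⟨_, h2, fun w hw hwr => ?_⟩
    rwa [rank_inj (E.trans (E.symm hw) h1) hwr]
  · intro u v h hv
    obtain ⟨y, hy, hc⟩ := exists_cong_add_lt (r := Q.minBlock) (b := Q.rank v)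
      (a := k + if Q.Twisted u v then 1 else 0) (by split_ifs <;> omega) (by omega) hr
    refine ⟨y, hy, ?_⟩
    rintro u' h1 rfl
    unfold goodRule
    rw [show Q.Twisted u' v ↔ Q.Twisted u v from
      ⟨Twisted.congr (E.symm h1) (E.refl v), Twisted.congr h1 (E.refl v)⟩]
    exact hc
  · intro u v hu hv hur hvr
    refine reflTransGen_of_rank (R := fun x w => x < Q.minBlock ∧ w < Q.minBlock ∧
      Cong Q.minBlock w (x + 1)) ?_ hu hv ?_
    · rintro x w ⟨hx, hw, hc⟩ u hu rfl
      have hz0 : ¬ Q.SameBlock z u := fun h => hza.1.1.2 (E.trans h (E.symm hu))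
      obtain ⟨u', hu', hur', hru⟩ : ∃ u', Q.SameBlock a u' ∧ (Q.rank u' < Q.minBlock ∧
          Cong Q.minBlock (Q.rank u') (Q.rank u + 1)) ∧
          ReflTransGen (Q.ColourArc Q.minBlock Q.goodRule k) u u' := by
        by_cases h2 : Q.BlockArc a z
        · obtain ⟨z₁, e1, r1, l1, c1⟩ := step u z (h2.congr hu (E.refl z)) hx
          obtain ⟨u', e2, r2, l2, c2⟩ := step z₁ a (hza.1.1.congr e1 (E.refl a)) r1
          refine ⟨u', e2, ⟨r2, ?_⟩, .head c1 (.single c2)⟩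
          unfold goodRule at l1 l2
          rw [if_neg (by rw [htw]; exact fun h => hz0 h.1)] at l1
          rw [if_pos (by rw [htw]; exact ⟨e1, e2⟩)] at l2
          -- From rank `x` the untwisted arc leads to `k - x`, and the twisted one back to `k + 1 -
          -- (k - x) = x + 1`.
          unfold Cong at *
          omega
        · obtain ⟨b, c, hab, hbc, hcz⟩ := hza.1.2.resolve_left h2
          obtain ⟨b₁, e1, r1, l1, c1⟩ := step u b (hab.congr hu (E.refl b)) hx
          obtain ⟨c₁, e2, r2, l2, c2⟩ := step b₁ c (hbc.congr e1 (E.refl c)) r1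
          obtain ⟨z₁, e3, r3, l3, c3⟩ := step c₁ z (hcz.congr e2 (E.refl z)) r2
          obtain ⟨u', e4, r4, l4, c4⟩ := step z₁ a (hza.1.1.congr e3 (E.refl a)) r3
          refine ⟨u', e4, ⟨r4, ?_⟩, .head c1 (.head c2 (.head c3 (.single c4)))⟩
          unfold goodRule at l1 l2 l3 l4
          rw [if_neg (by rw [htw]; exact fun h => hz0 h.1)] at l1
          -- The arc from `b` to `c` could be twisted only if `b` lay in the block of `z`; then
          -- there would be an arc from `a` to `z`, which the first case has dealt with.
          rw [if_neg (by
            rw [htw]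
            exact fun h => h2 (hab.congr (E.refl a) (E.trans e1 (E.symm h.1))))] at l2
          rw [if_neg (by
            rw [htw]
            exact fun h => hza.1.1.2 (E.trans e3 (E.symm h.2)))] at l3
          rw [if_pos (by rw [htw]; exact ⟨e3, e4⟩)] at l4
          have q1 : Cong Q.minBlock (Q.rank c₁) (Q.rank u) := by
            clear l3 l4; unfold Cong at *; omega
          have q2 : Cong Q.minBlock (Q.rank u') (Q.rank c₁ + 1) := by
            clear l1 l2 q1; unfold Cong at *; omega
          clear l1 l2 l3 l4
          unfold Cong at *
          omega
      refine ⟨u', hu', ?_, hru⟩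
      unfold Cong at *
      omega
    · refine reflTransGen_of_enumeration id (fun p hp => ?_) ?_ (fun x hx => ⟨x, hx, rfl⟩) hur hvr
      · simp only [id]; unfold Cong; omega
      · simp only [id]; unfold Cong; omega

theorem goodRule_unique {k l : ℕ} (hk : k < Q.minBlock) (hl : l < Q.minBlock) {u v : Fin n}
    (h : Q.ColourArc Q.minBlock Q.goodRule k u v) (h' : Q.ColourArc Q.minBlock Q.goodRule l u v) :
    k = l := by
  refine h.unique hk (fun u v hu hv h1 h2 => ?_) h'
  unfold goodRule Cong at h1 h2
  omega

/-! ### Quotients that are directed triangles -/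

/-- The blocks are those of a blow-up of the directed triangle, numbered by `ty`. -/
structure IsTriangle (Q : Digraph (Fin n)) (ty : Fin n → ℕ) : Prop where
  lt : ∀ u, ty u < 3
  sameBlock_iff : ∀ u v, Q.SameBlock u v ↔ ty u = ty v
  blockArc_iff : ∀ u v, Q.BlockArc u v ↔ ty v = (ty u + 1) % 3
  surj : ∀ t < 3, ∃ u, ty u = t

/-- The colouring that is used if the quotient is a directed triangle. -/
def latinRule (Q : Digraph (Fin n)) (ty : Fin n → ℕ) (k : ℕ) (u v : Fin n) : Prop :=
  latin Q.minBlock k (ty u) (Q.rank u) (Q.rank v)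

/-- A `LatinRound` on ranks lifts to three arcs around the triangle, starting and ending in part
`0`. -/
theorem latinRule_reflTransGen (hs : Q.IsStrong) (hn : 2 ≤ n) {ty : Fin n → ℕ}
    (ht : Q.IsTriangle ty) (hr2 : Q.minBlock ≠ 2) {k : ℕ} (hk : k < Q.minBlock) (u v : Fin n) :
    ReflTransGen (Q.ColourArc Q.minBlock (Q.latinRule ty) k) u v := by
  have E := Q.sameBlock_equivalence
  obtain ⟨a, ha⟩ := ht.surj 0 (by omega)
  refine colourArc_reflTransGen hs hn hk a ?_ ?_ ?_ u v
  · intro u v h hu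
    obtain ⟨y, hy, h'⟩ := latin_exists_right (t := ty u) hk hu
    exact ⟨y, hy, fun v' _ h2 => by rw [latinRule, h2]; exact h'⟩
  · intro u v h hv
    obtain ⟨x, hx, h'⟩ := latin_exists_left (t := ty u) hr2 hk hv
    exact ⟨x, hx, fun u' h1 h2 => by
      rw [latinRule, h2, ← (ht.sameBlock_iff _ _).1 h1]; exact h'⟩
  · intro u v hu hv hur hvr
    refine reflTransGen_of_rank (R := fun x z => x < Q.minBlock ∧ LatinRound Q.minBlock k x z)
      ?_ hu hv ?_
    · rintro x z ⟨hx, y, hy, w, hw, hz, h1, h2, h3⟩ u hu rfl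
      have hu0 : ty u = 0 := by rw [← (ht.sameBlock_iff _ _).1 hu, ha]
      obtain ⟨b, hb⟩ := ht.surj 1 (by omega)
      obtain ⟨c, hc⟩ := ht.surj 2 (by omega)
      obtain ⟨b', eb, rfl⟩ := exists_rank_eq_of_lt_minBlock b hy
      obtain ⟨c', ec, rfl⟩ := exists_rank_eq_of_lt_minBlock c hw
      obtain ⟨a', ea, rfl⟩ := exists_rank_eq_of_lt_minBlock a hz
      have hb' : ty b' = 1 := by rw [← (ht.sameBlock_iff _ _).1 eb, hb]
      have hc' : ty c' = 2 := by rw [← (ht.sameBlock_iff _ _).1 ec, hc]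
      have ha' : ty a' = 0 := by rw [← (ht.sameBlock_iff _ _).1 ea, ha]
      refine ⟨a', ea, rfl, .head (b := b') ⟨?_, .inl ⟨hx, hy, ?_⟩⟩
        (.head (b := c') ⟨?_, .inl ⟨hy, hw, ?_⟩⟩ (.single ⟨?_, .inl ⟨hw, hz, ?_⟩⟩))⟩
      · rw [ht.blockArc_iff, hu0, hb']
      · rw [latinRule, hu0]; exact h1
      · rw [ht.blockArc_iff, hb', hc']
      · rw [latinRule, hb']; exact h2
      · rw [ht.blockArc_iff, hc', ha']
      · rw [latinRule, hc']; exact h3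
    · have := latinRound_reflTransGen hr2 hk hur hvr
      have key : ∀ z, ReflTransGen (LatinRound Q.minBlock k) (Q.rank u) z →
          z < Q.minBlock ∧ ReflTransGen (fun x z => x < Q.minBlock ∧
            LatinRound Q.minBlock k x z) (Q.rank u) z := by
        intro z hz
        induction hz with
        | refl => exact ⟨hur, .refl⟩
        | tail _ hbc ih =>
          obtain ⟨y, hy, w, hw, hz, _⟩ := id hbc
          exact ⟨hz, ih.2.tail ⟨ih.1, hbc⟩⟩
      exact (key _ this).2

theorem latinRule_unique {ty : Fin n → ℕ} (hr2 : Q.minBlock ≠ 2) {k l : ℕ} (hk : k < Q.minBlock)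
    (hl : l < Q.minBlock) {u v : Fin n} (h : Q.ColourArc Q.minBlock (Q.latinRule ty) k u v)
    (h' : Q.ColourArc Q.minBlock (Q.latinRule ty) l u v) : k = l :=
  h.unique hk (fun _ _ hu hv h1 h2 => latin_unique hr2 hk hl hu hv h1 h2) h'

open Classical in
/-- The number of the block of `u` in the directed triangle, if that of `b` has number `0`. -/
noncomputable def blockType (Q : Digraph (Fin n)) (b u : Fin n) : ℕ :=
  if Q.SameBlock b u then 0 else if Q.BlockArc b u then 1 else 2

/-- A strong tournament on at least four vertices has a directed 4-cycle, so only three blocks are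
possible. The argument fixes the block of `b` and shows that it has a single out-neighbouring and a
single in-neighbouring block. -/
theorem isTriangle_blockType (hl : Q.IsLoopless) (hs : Q.IsStrong) (hq : Q.IsQuasiTransitive)
    (hn : 2 ≤ n) (hg : ¬ ∃ z a, Q.GoodArc z a) (b : Fin n) : Q.IsTriangle (Q.blockType b) := by
  have E := Q.sameBlock_equivalence
  have no2 : ∀ {a b}, Q.BlockArc a b → ¬ Q.BlockArc b a := fun h h' => hg ⟨_, _, h, .inl h'⟩
  have no4 : ∀ {a b c z}, Q.BlockArc a b → Q.BlockArc b c → Q.BlockArc c z → ¬ Q.BlockArc z a :=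
    fun h1 h2 h3 h4 => hg ⟨_, _, h4, .inr ⟨_, _, h1, h2, h3⟩⟩
  have tot : ∀ a b, Q.SameBlock a b ∨ Q.BlockArc a b ∨ Q.BlockArc b a := by
    intro a b
    by_cases h : Q.SameBlock a b
    · exact .inl h
    right
    by_contra! hn
    have h1 : ¬ Q.Adj a b := fun h' => hn.1 ⟨h', h⟩
    have h2 : ¬ Q.Adj b a := fun h' => hn.2 ⟨h', fun h'' => h (E.symm h'')⟩
    exact h (hq.sameBlock_of_nonAdj hl ⟨fun h' => h (h' ▸ E.refl a), h1, h2⟩)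
  obtain ⟨i₀, hi₀⟩ := hs.exists_blockArc_to hn b
  -- An arc leaves the union of `b` and its out-neighbours. Its head `i` is an in-neighbour of `b`,
  -- and its tail `o` must be an out-neighbour.
  obtain ⟨o, i, hoi, ho, hi⟩ := hs.exists_blockArc
    (P := fun v => Q.SameBlock b v ∨ Q.BlockArc b v) (u := b) (v := i₀)
    (by
      rintro u v huv (h | h)
      · exact .inl (E.trans h huv)
      · exact .inr (h.congr (E.refl b) huv)) (.inl (E.refl b)) (by
      rintro (h | h)
      · exact hi₀.2 (E.symm h)
      · exact no2 h hi₀)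
  have hbi : ¬ Q.BlockArc b i := fun h => hi (.inr h)
  have hib : Q.BlockArc i b := by
    rcases tot b i with h | h | h
    · exact absurd (.inl h) hi
    · exact absurd h hbi
    · exact h
  have hbo : Q.BlockArc b o := ho.resolve_left fun h => hbi (hoi.congr (E.symm h) (E.refl i))
  -- For a further out-neighbour `v`, the arc `vo` would close the cycle `b, v, o, i`, and the arc
  -- `vi` the cycle `b, o, v, i`.
  have hO : ∀ v, Q.BlockArc b v → ¬ Q.SameBlock o v → Q.BlockArc o v ∧ Q.BlockArc i v := by
    intro v hv hov
    have hov' : Q.BlockArc o v := ((tot o v).resolve_left hov).resolve_right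
      fun h => no4 hv h hoi hib
    refine ⟨hov', ?_⟩
    rcases tot i v with h | h | h
    · exact absurd (hv.congr (E.refl b) (E.symm h)) hbi
    · exact h
    · exact absurd hbo (no4 hov' h hib)
  have hI : ∀ v, Q.BlockArc v b → ¬ Q.SameBlock i v → Q.BlockArc v o ∧ Q.BlockArc v i := by
    intro v hv hiv
    have hvi : Q.BlockArc v i := ((tot i v).resolve_left hiv).resolve_left
      fun h => no4 hbo hoi h hv
    refine ⟨?_, hvi⟩
    rcases tot o v with h | h | h
    · exact absurd (hv.congr (E.symm h) (E.refl b)) (no2 hbo)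
    · exact absurd hib (no4 hbo h hvi)
    · exact h
  -- No arc could leave the set of further out-neighbours without creating a cycle of length two or
  -- four, contrary to strongness. For in-neighbours, dually, no arc could enter.
  have hO' : ∀ v, Q.BlockArc b v → Q.SameBlock o v := by
    by_contra! ⟨v, hv, hov⟩
    obtain ⟨x, y, hxy, ⟨hx1, hx2⟩, hy⟩ := hs.exists_blockArc
      (P := fun v => Q.BlockArc b v ∧ ¬ Q.SameBlock o v) (u := v) (v := b)
      (fun u v huv h => ⟨h.1.congr (E.refl b) huv, fun h' => h.2 (E.trans h' (E.symm huv))⟩)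
      ⟨hv, hov⟩ (fun h => h.1.2 (E.refl b))
    obtain ⟨hox, hix⟩ := hO x hx1 hx2
    rcases tot b y with h | h | h
    · exact no2 hx1 (hxy.congr (E.refl x) (E.symm h))
    · have hoy : Q.SameBlock o y := by_contra fun h' => hy ⟨h, h'⟩
      exact no2 hox (hxy.congr (E.refl x) (E.symm hoy))
    · by_cases hiy : Q.SameBlock i y
      · exact no2 hix (hxy.congr (E.refl x) (E.symm hiy))
      · exact no4 hx1 hxy (hI y h hiy).2 hib
  have hI' : ∀ v, Q.BlockArc v b → Q.SameBlock i v := by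
    by_contra! ⟨v, hv, hiv⟩
    obtain ⟨x, y, hxy, hx, hy⟩ := hs.exists_blockArc
      (P := fun v => ¬ (Q.BlockArc v b ∧ ¬ Q.SameBlock i v)) (u := b) (v := v)
      (fun u v huv h h' => h ⟨h'.1.congr (E.symm huv) (E.refl b),
        fun h'' => h'.2 (E.trans h'' huv)⟩)
      (fun h => h.1.2 (E.refl b)) (fun h => h ⟨hv, hiv⟩)
    rw [not_not] at hy
    obtain ⟨hyo, hyi⟩ := hI y hy.1 hy.2
    rcases tot b x with h | h | h
    · exact no2 hy.1 (hxy.congr (E.symm h) (E.refl y))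
    · exact no2 hyo (hxy.congr (E.symm (hO' x h)) (E.refl y))
    · have hix : Q.SameBlock i x := by_contra fun h' => hx ⟨h, h'⟩
      exact no2 hyi (hxy.congr (E.symm hix) (E.refl y))
  have cases : ∀ u, (Q.SameBlock b u ∧ Q.blockType b u = 0) ∨
      (Q.SameBlock o u ∧ Q.blockType b u = 1) ∨ (Q.SameBlock i u ∧ Q.blockType b u = 2) := by
    intro u
    unfold blockType
    rcases tot b u with h | h | h
    · exact .inl ⟨h, if_pos h⟩
    · exact .inr (.inl ⟨hO' u h, by rw [if_neg h.2, if_pos h]⟩)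
    · exact .inr (.inr ⟨hI' u h, by rw [if_neg fun h' => h.2 (E.symm h'), if_neg (no2 h)]⟩)
  have nbo := hbo.2
  have noi := hoi.2
  have nib := hib.2
  refine ⟨fun u => ?_, fun u v => ?_, fun u v => ?_, fun t ht => ?_⟩
  · rcases cases u with h | h | h <;> omega
  · rcases cases u with ⟨hu, tu⟩ | ⟨hu, tu⟩ | ⟨hu, tu⟩ <;>
      rcases cases v with ⟨hv, tv⟩ | ⟨hv, tv⟩ | ⟨hv, tv⟩ <;> rw [tu, tv]
    · exact iff_of_true (E.trans (E.symm hu) hv) rfl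
    · exact iff_of_false (fun h => nbo (E.trans hu (E.trans h (E.symm hv)))) (by decide)
    · exact iff_of_false (fun h => nib (E.symm (E.trans hu (E.trans h (E.symm hv))))) (by decide)
    · exact iff_of_false (fun h => nbo (E.symm (E.trans hu (E.trans h (E.symm hv))))) (by decide)
    · exact iff_of_true (E.trans (E.symm hu) hv) rfl
    · exact iff_of_false (fun h => noi (E.trans hu (E.trans h (E.symm hv)))) (by decide)
    · exact iff_of_false (fun h => nib (E.trans hu (E.trans h (E.symm hv)))) (by decide)
    · exact iff_of_false (fun h => noi (E.symm (E.trans hu (E.trans h (E.symm hv))))) (by decide)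
    · exact iff_of_true (E.trans (E.symm hu) hv) rfl
  · rcases cases u with ⟨hu, tu⟩ | ⟨hu, tu⟩ | ⟨hu, tu⟩ <;>
      rcases cases v with ⟨hv, tv⟩ | ⟨hv, tv⟩ | ⟨hv, tv⟩ <;> rw [tu, tv]
    · exact iff_of_false (fun h => h.2 (E.trans (E.symm hu) hv)) (by decide)
    · exact iff_of_true (hbo.congr hu hv) (by decide)
    · exact iff_of_false (no2 (hib.congr hv hu)) (by decide)
    · exact iff_of_false (no2 (hbo.congr hv hu)) (by decide)
    · exact iff_of_false (fun h => h.2 (E.trans (E.symm hu) hv)) (by decide)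
    · exact iff_of_true (hoi.congr hu hv) (by decide)
    · exact iff_of_true (hib.congr hu hv) (by decide)
    · exact iff_of_false (no2 (hoi.congr hv hu)) (by decide)
    · exact iff_of_false (fun h => h.2 (E.trans (E.symm hu) hv)) (by decide)
  · have h1 : Q.blockType b b = 0 := by
      rcases cases b with h | h | h
      exacts [h.2, absurd (E.symm h.1) nbo, absurd h.1 nib]
    have h2 : Q.blockType b o = 1 := by
      rcases cases o with h | h | h
      exacts [absurd h.1 nbo, h.2, absurd (E.symm h.1) noi]
    have h3 : Q.blockType b i = 2 := by
      rcases cases i with h | h | h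
      exacts [absurd (E.symm h.1) nib, absurd h.1 noi, h.2]
    interval_cases t
    exacts [⟨b, h1⟩, ⟨o, h2⟩, ⟨i, h3⟩]

end Digraph

/-! ### Closed walks for smallest block order two -/

theorem List.reflTransGen_zip_tail {α : Type*} {l : List α} : ∀ {a : α}, ∀ x ∈ a :: l,
    Relation.ReflTransGen (fun x y => (x, y) ∈ (a :: l).zip l) a x ∧
      Relation.ReflTransGen (fun x y => (x, y) ∈ (a :: l).zip l) x
        ((a :: l).getLast (List.cons_ne_nil _ _)) := by
  induction l with
  | nil =>
    intro a x hx
    obtain rfl : x = a := by simpa using hx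
    exact ⟨.refl, .refl⟩
  | cons b l ih =>
    intro a x hx
    have mono : ∀ {x y}, Relation.ReflTransGen (fun x y => (x, y) ∈ (b :: l).zip l) x y →
        Relation.ReflTransGen (fun x y => (x, y) ∈ (a :: b :: l).zip (b :: l)) x y :=
      fun h => Relation.ReflTransGen.mono (fun _ _ h => List.mem_cons_of_mem _ h) _ _ h
    have hab : Relation.ReflTransGen (fun x y => (x, y) ∈ (a :: b :: l).zip (b :: l)) a b :=
      .single (List.mem_cons_self ..)
    rw [List.getLast_cons (List.cons_ne_nil _ _)]
    rcases List.mem_cons.1 hx with rfl | hx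
    · exact ⟨.refl, hab.trans (mono (ih b (List.mem_cons_self ..)).2)⟩
    · exact ⟨hab.trans (mono (ih x hx).1), mono (ih x hx).2⟩

/-- Two closed walks through the same vertices of a blow-up of the directed triangle, the vertex of
rank `x` in part `t` being denoted by `4t + x`, and what they require: arcs in some of the parts and
lower bounds for the orders of the parts. -/
structure Template where
  /-- the parts in which there is an arc from rank `0` to rank `1` -/
  inner : List ℕ
  /-- pairs of a part and a lower bound for its order -/
  sizes : List (ℕ × ℕ)
  /-- the first walk -/
  first : List ℕ
  /-- the second walk -/
  second : List ℕ

namespace Template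

/-- The walk in colour `k`. -/
def walk (T : Template) (k : ℕ) : List ℕ := if k = 0 then T.first else T.second

/-- The walks are closed and arc-disjoint and meet the requirements. -/
structure Valid (T : Template) : Prop where
  arc : ∀ k < 2, ∀ p ∈ (T.walk k).zip (T.walk k).tail, p.1 / 4 < 3 ∧
    (p.2 / 4 = (p.1 / 4 + 1) % 3 ∨ (p.2 / 4 = p.1 / 4 ∧ p.1 / 4 ∈ T.inner ∧ p.1 % 4 = 0 ∧
      p.2 % 4 = 1))
  size : ∀ c ∈ T.first, ∃ p ∈ T.sizes, p.1 = c / 4 ∧ c % 4 < p.2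
  mem_iff : ∀ k < 2, T.walk k ⊆ T.first ∧ T.first ⊆ T.walk k
  disjoint : ∀ p ∈ (T.walk 0).zip (T.walk 0).tail, p ∉ (T.walk 1).zip (T.walk 1).tail
  closed : ∀ k < 2, ∃ l, T.walk k = 0 :: l ∧ (0 :: l).getLast (List.cons_ne_nil _ _) = 0
  small : ∀ t < 3, ∀ x < 2, 4 * t + x ∈ T.first

end Template

/-- The templates for the blow-ups of the directed triangle with smallest part of order two. -/
def templates : List Template :=
  [⟨[0, 1], [(0, 2), (1, 2), (2, 2)], [0, 1, 4, 8, 1, 4, 5, 9, 0], [0, 4, 9, 1, 5, 8, 0]⟩,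
    ⟨[0], [(0, 2), (1, 2), (2, 3)], [0, 5, 8, 1, 4, 10, 1, 4, 9, 0],
      [0, 1, 5, 9, 1, 5, 10, 0, 4, 8, 0]⟩,
    ⟨[1], [(0, 2), (1, 2), (2, 3)], [0, 5, 9, 1, 4, 10, 1, 4, 8, 0],
      [0, 4, 9, 0, 4, 5, 8, 1, 5, 10, 0]⟩,
    ⟨[2], [(0, 2), (1, 2), (2, 3)], [0, 4, 10, 1, 5, 8, 9, 0], [0, 5, 9, 1, 4, 8, 0, 5, 10, 0]⟩,
    ⟨[], [(0, 2), (1, 2), (2, 4)], [0, 5, 11, 1, 4, 8, 1, 4, 9, 0, 5, 10, 0],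
      [0, 4, 10, 1, 5, 9, 1, 5, 8, 0, 4, 11, 0]⟩,
    ⟨[], [(0, 2), (1, 3), (2, 3)], [0, 4, 8, 0, 6, 9, 1, 5, 8, 0, 6, 10, 0],
      [0, 5, 10, 1, 6, 8, 1, 4, 9, 0]⟩]

theorem templates_valid : ∀ T ∈ templates, T.Valid := by
  -- The conditions are restated with bounded quantifiers only, so that `decide` checks each
  -- template.
  have key : ∀ T ∈ templates, (∀ k < 2, ∀ p ∈ (T.walk k).zip (T.walk k).tail, p.1 / 4 < 3 ∧
      (p.2 / 4 = (p.1 / 4 + 1) % 3 ∨ (p.2 / 4 = p.1 / 4 ∧ p.1 / 4 ∈ T.inner ∧ p.1 % 4 = 0 ∧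
        p.2 % 4 = 1))) ∧ (∀ c ∈ T.first, ∃ p ∈ T.sizes, p.1 = c / 4 ∧ c % 4 < p.2) ∧
      (∀ k < 2, (∀ c ∈ T.walk k, c ∈ T.first) ∧ ∀ c ∈ T.first, c ∈ T.walk k) ∧
      (∀ p ∈ (T.walk 0).zip (T.walk 0).tail, p ∉ (T.walk 1).zip (T.walk 1).tail) ∧
      (∀ k < 2, T.walk k = 0 :: (T.walk k).tail ∧
        (0 :: (T.walk k).tail).getLast (List.cons_ne_nil _ _) = 0) ∧
      (∀ t < 3, ∀ x < 2, 4 * t + x ∈ T.first) := by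
    unfold templates
    iterate 6
      refine List.forall_mem_cons.2 ⟨?_, ?_⟩
      · refine ⟨?_, ?_, ?_, ?_, ?_, ?_⟩ <;> decide
    exact fun _ h => absurd h List.not_mem_nil
  intro T hT
  obtain ⟨h1, h2, h3, h4, h5, h6⟩ := key T hT
  exact ⟨h1, h2, h3, h4, fun k hk => ⟨_, h5 k hk⟩, h6⟩

/-! ### Templates inside a digraph -/

namespace Digraph

open Relation (ReflTransGen)

variable {n : ℕ} {Q : Digraph (Fin n)}

/-- The number of a vertex in a template. -/
noncomputable def code (Q : Digraph (Fin n)) (b u : Fin n) : ℕ := 4 * Q.blockType b u + Q.rank u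

/-- The requirements of the template are met. -/
def Fits (Q : Digraph (Fin n)) (b : Fin n) (T : Template) : Prop :=
  (∀ t ∈ T.inner, ∃ u, Q.blockType b u = t ∧ ∃ v, Q.SameBlock u v ∧ Q.Adj u v) ∧
    ∀ p ∈ T.sizes, ∃ u, Q.blockType b u = p.1 ∧ p.2 ≤ Q.blockSize u

/-- The vertex is one of the vertices of the template. -/
def InCore (Q : Digraph (Fin n)) (b : Fin n) (T : Template) (u : Fin n) : Prop :=
  Q.rank u < 4 ∧ Q.code b u ∈ T.first

/-- The arcs of colour `k`: those of the walks, and arcs that join the remaining vertices to those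
of rank `k`. -/
def CoreArc (Q : Digraph (Fin n)) (b : Fin n) (T : Template) (k : ℕ) (u v : Fin n) : Prop :=
  Q.Adj u v ∧ (((Q.InCore b T u ∧ Q.InCore b T v) ∧
    (Q.code b u, Q.code b v) ∈ (T.walk k).zip (T.walk k).tail) ∨
    (¬ Q.SameBlock u v ∧ ((¬ Q.InCore b T u ∧ Q.rank v = k) ∨ (¬ Q.InCore b T v ∧ Q.rank u = k))))

theorem inCore_of_rank_lt {T : Template} (hT : T.Valid) {b u : Fin n}
    (ht : Q.IsTriangle (Q.blockType b)) (hu : Q.rank u < 2) : Q.InCore b T u :=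
  ⟨by omega, hT.small _ (ht.lt u) _ hu⟩

/-- Vertices of rank `0` and `1` always belong to the template. An additional arc therefore has
exactly one end in it, and the rank of that end is the colour. -/
theorem coreArc_unique {T : Template} (hT : T.Valid) {b : Fin n}
    (ht : Q.IsTriangle (Q.blockType b)) {k l : ℕ} (hk : k < 2) (hl : l < 2) {u v : Fin n}
    (h : Q.CoreArc b T k u v) (h' : Q.CoreArc b T l u v) : k = l := by
  obtain ⟨-, ⟨⟨h1, h2⟩, h3⟩ | ⟨h0, ⟨h1, h2⟩ | ⟨h1, h2⟩⟩⟩ := h <;>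
    obtain ⟨-, ⟨⟨k1, k2⟩, k3⟩ | ⟨k0, ⟨k1, k2⟩ | ⟨k1, k2⟩⟩⟩ := h'
  · have e0 : k = 0 ∨ k = 1 := by omega
    have e1 : l = 0 ∨ l = 1 := by omega
    rcases e0 with rfl | rfl <;> rcases e1 with rfl | rfl
    · rfl
    · exact absurd k3 (hT.disjoint _ h3)
    · exact absurd h3 (hT.disjoint _ k3)
    · rfl
  · exact absurd h1 k1
  · exact absurd h2 k1
  · exact absurd k1 h1
  · omega
  · exact absurd (inCore_of_rank_lt hT ht (by omega)) h1
  · exact absurd k2 h1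
  · exact absurd (inCore_of_rank_lt hT ht (by omega)) h1
  · omega

/-- Each closed walk visits all vertices of the template, so these reach each other. Any other
vertex has an arc to the vertex of rank `k` in the next part and one from that in the previous part,
and both of these lie in the template. -/
theorem coreArc_reflTransGen (hl : Q.IsLoopless) {T : Template} (hT : T.Valid) {b : Fin n}
    (ht : Q.IsTriangle (Q.blockType b)) (hfit : Q.Fits b T) (hr : Q.minBlock = 2) {k : ℕ}
    (hk : k < 2) (u v : Fin n) : ReflTransGen (Q.CoreArc b T k) u v := by
  have E := Q.sameBlock_equivalence
  have exists_vertex : ∀ c ∈ T.first, ∃ u, Q.blockType b u = c / 4 ∧ Q.rank u = c % 4 := by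
    intro c hc
    obtain ⟨p, hp, h1, h2⟩ := hT.size c hc
    obtain ⟨u, h3, h4⟩ := hfit.2 p hp
    obtain ⟨v, h5, h6⟩ := exists_rank_eq u (h2.trans_le h4)
    exact ⟨v, by rw [← h1, ← h3, (ht.sameBlock_iff _ _).1 h5], h6⟩
  have type_of_code : ∀ {u}, Q.rank u < 4 → Q.blockType b u = Q.code b u / 4 ∧
      Q.rank u = Q.code b u % 4 := by
    intro u hu
    unfold code
    omega
  have eq_of_code : ∀ {u v}, Q.rank u < 4 → Q.rank v < 4 → Q.code b u = Q.code b v → u = v := by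
    intro u v hu hv h
    have h1 := type_of_code hu
    have h2 := type_of_code hv
    rw [h] at h1
    exact rank_inj ((ht.sameBlock_iff _ _).2 (h1.1.trans h2.1.symm)) (h1.2.trans h2.2.symm)
  have step : ∀ u v, Q.InCore b T u → Q.InCore b T v →
      (Q.code b u, Q.code b v) ∈ (T.walk k).zip (T.walk k).tail → Q.CoreArc b T k u v := by
    intro u v hu hv h
    refine ⟨?_, .inl ⟨⟨hu, hv⟩, h⟩⟩
    obtain ⟨hu1, hu2⟩ := type_of_code hu.1
    obtain ⟨hv1, hv2⟩ := type_of_code hv.1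
    obtain ⟨-, h1 | ⟨h1, h2, h3, h4⟩⟩ := hT.arc k hk _ h
    · refine ((ht.blockArc_iff u v).2 ?_).1
      rw [hu1, hv1]; exact h1
    -- An arc inside a part: the ranks were chosen so that it leads from rank `0` to rank `1`.
    · obtain ⟨x, hx, y, hxy, hadj⟩ := hfit.1 _ h2
      obtain ⟨p, q, hp, hq, rp, rq, hpq⟩ := exists_rank_zero_one hl hxy hadj
      have hxu : Q.SameBlock x u := (ht.sameBlock_iff _ _).2 (by rw [hx, hu1])
      have hxv : Q.SameBlock x v := (ht.sameBlock_iff _ _).2 (by rw [hx, hv1]; exact h1.symm)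
      rw [rank_inj (E.trans (E.symm hxu) hp) (by rw [hu2, rp]; exact h3),
        rank_inj (E.trans (E.symm hxv) hq) (by rw [hv2, rq]; exact h4)]
      exact hpq
  have core : ∀ u v, Q.InCore b T u → Q.InCore b T v → ReflTransGen (Q.CoreArc b T k) u v := by
    intro u v hu hv
    obtain ⟨l, hl1, hl2⟩ := hT.closed k hk
    have hsub : ∀ c ∈ T.first, c ∈ 0 :: l := by
      intro c hc
      rw [← hl1]
      exact (hT.mem_iff k hk).2 hc
    have h1 := (List.reflTransGen_zip_tail _ (hsub _ hu.2)).2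
    have h2 := (List.reflTransGen_zip_tail _ (hsub _ hv.2)).1
    rw [hl2] at h1
    have key : ∀ c, ReflTransGen (fun x y => (x, y) ∈ (0 :: l).zip l) (Q.code b u) c →
        ∃ w, Q.InCore b T w ∧ Q.code b w = c ∧ ReflTransGen (Q.CoreArc b T k) u w := by
      intro c hc
      induction hc with
      | refl => exact ⟨u, hu, rfl, .refl⟩
      | @tail c d _ hcd ih =>
        obtain ⟨w, h1, rfl, h3⟩ := ih
        have hd : d ∈ T.first := by
          apply (hT.mem_iff k hk).1
          rw [hl1]
          exact List.mem_cons_of_mem _ (List.of_mem_zip hcd).2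
        obtain ⟨x, hx1, hx2⟩ := exists_vertex d hd
        have hxc : Q.code b x = d := by unfold code; omega
        have hxi : Q.InCore b T x := ⟨by omega, by rw [hxc]; exact hd⟩
        refine ⟨x, hxi, hxc, h3.tail (step w x h1 hxi ?_)⟩
        rw [hxc, hl1]
        exact hcd
    obtain ⟨w, h3, h4, h5⟩ := key _ (h1.trans h2)
    rwa [eq_of_code h3.1 hv.1 h4] at h5
  have to_core : ∀ u, ∃ v, Q.InCore b T v ∧ ReflTransGen (Q.CoreArc b T k) u v := by
    intro u
    by_cases hu : Q.InCore b T u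
    · exact ⟨u, hu, .refl⟩
    · obtain ⟨v, hv⟩ := ht.surj ((Q.blockType b u + 1) % 3) (by omega)
      obtain ⟨v', h1, h2⟩ := exists_rank_eq_of_lt_minBlock v (hr ▸ hk : k < Q.minBlock)
      have hb : Q.BlockArc u v' :=
        (ht.blockArc_iff _ _).2 (by rw [← (ht.sameBlock_iff _ _).1 h1, hv])
      exact ⟨v', inCore_of_rank_lt hT ht (by omega), .single ⟨hb.1, .inr ⟨hb.2, .inl ⟨hu, h2⟩⟩⟩⟩
  have from_core : ∀ u, ∃ v, Q.InCore b T v ∧ ReflTransGen (Q.CoreArc b T k) v u := by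
    intro u
    by_cases hu : Q.InCore b T u
    · exact ⟨u, hu, .refl⟩
    · obtain ⟨v, hv⟩ := ht.surj ((Q.blockType b u + 2) % 3) (by omega)
      obtain ⟨v', h1, h2⟩ := exists_rank_eq_of_lt_minBlock v (hr ▸ hk : k < Q.minBlock)
      have := ht.lt u
      have hb : Q.BlockArc v' u :=
        (ht.blockArc_iff _ _).2 (by rw [← (ht.sameBlock_iff _ _).1 h1, hv]; omega)
      exact ⟨v', inCore_of_rank_lt hT ht (by omega), .single ⟨hb.1, .inr ⟨hb.2, .inr ⟨hu, h2⟩⟩⟩⟩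
  obtain ⟨u', h1, h2⟩ := to_core u
  obtain ⟨v', h3, h4⟩ := from_core v
  exact (h2.trans (core u' v' h1 h3)).trans h4

open Classical in
/-- The arcs of colour `k` for the first template of the list that fits. -/
noncomputable def TemplateArc (Q : Digraph (Fin n)) (b : Fin n) (k : ℕ) (u v : Fin n) :
    List Template → Prop
  | [] => False
  | T :: l => if Q.Fits b T then Q.CoreArc b T k u v else TemplateArc Q b k u v l

theorem templateArc_eq {b : Fin n} {l : List Template} (h : ∃ T ∈ l, Q.Fits b T) :
    ∃ T ∈ l, Q.Fits b T ∧ ∀ k u v, Q.TemplateArc b k u v l ↔ Q.CoreArc b T k u v := by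
  classical
  induction l with
  | nil => obtain ⟨T, hT, -⟩ := h; exact absurd hT List.not_mem_nil
  | cons T l ih =>
    by_cases hT : Q.Fits b T
    · exact ⟨T, List.mem_cons_self .., hT, fun k u v => by rw [TemplateArc, if_pos hT]⟩
    · obtain ⟨T', hT', hf⟩ := h
      rcases List.mem_cons.1 hT' with rfl | hT'
      · exact absurd hf hT
      · obtain ⟨T', h1, h2, h3⟩ := ih ⟨T', hT', hf⟩
        exact ⟨T', List.mem_cons_of_mem _ h1, h2, fun k u v => by
          rw [TemplateArc, if_neg hT, h3]⟩

/-- The first vertex for which a template fits, or `0` if there is none. -/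
def IsBase (Q : Digraph (Fin n)) (b : Fin n) : Prop :=
  ((∃ T ∈ templates, Q.Fits b T) ∧ ¬ ∃ y, y < b ∧ ∃ T ∈ templates, Q.Fits y T) ∨
    ((b : ℕ) = 0 ∧ ¬ ∃ y, ∃ T ∈ templates, Q.Fits y T)

theorem IsBase.unique {b b' : Fin n} (h : Q.IsBase b) (h' : Q.IsBase b') : b = b' := by
  rcases h with ⟨h1, h2⟩ | ⟨h1, h2⟩ <;> rcases h' with ⟨k1, k2⟩ | ⟨k1, k2⟩
  · refine le_antisymm ?_ ?_
    · exact not_lt.1 fun h => h2 ⟨b', h, k1⟩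
    · exact not_lt.1 fun h => k2 ⟨b, h, h1⟩
  · exact absurd ⟨b, h1⟩ k2
  · exact absurd ⟨b', k1⟩ h2
  · exact Fin.ext (by omega)

theorem exists_isBase (hn : 0 < n) :
    ∃ b, Q.IsBase b ∧ ((∃ y, ∃ T ∈ templates, Q.Fits y T) → ∃ T ∈ templates, Q.Fits b T) := by
  by_cases h : ∃ y, ∃ T ∈ templates, Q.Fits y T
  · obtain ⟨b, hb, hb'⟩ := WellFounded.has_min (wellFounded_lt (α := Fin n))
      {y | ∃ T ∈ templates, Q.Fits y T} h
    exact ⟨b, .inl ⟨hb, fun ⟨y, hy, hy'⟩ => hb' y hy' hy⟩, fun _ => hb⟩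
  · exact ⟨⟨0, hn⟩, .inr ⟨rfl, h⟩, fun h' => absurd h' h⟩

/-- The arcs of the `k`-th subgraph. -/
def FamilyArc (Q : Digraph (Fin n)) (k : ℕ) (u v : Fin n) : Prop :=
  k < Q.minBlock ∧ (((∃ z a, Q.GoodArc z a) ∧ Q.ColourArc Q.minBlock Q.goodRule k u v) ∨
    (¬ (∃ z a, Q.GoodArc z a) ∧ ∃ b, Q.IsBase b ∧
      ((Q.minBlock = 2 ∧ Q.TemplateArc b k u v templates) ∨
        (Q.minBlock ≠ 2 ∧ Q.ColourArc Q.minBlock (Q.latinRule (Q.blockType b)) k u v))))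

theorem FamilyArc.adj {k : ℕ} {u v : Fin n} (h : Q.FamilyArc k u v) : Q.Adj u v := by
  obtain ⟨-, ⟨-, h⟩ | ⟨-, b, -, ⟨-, h⟩ | ⟨-, h⟩⟩⟩ := h
  · exact h.1.1
  · by_cases hf : ∃ T ∈ templates, Q.Fits b T
    · obtain ⟨T, -, -, hT⟩ := templateArc_eq hf
      exact ((hT k u v).1 h).1
    · exfalso
      revert h hf
      -- If no template fits, `TemplateArc` reaches the end of the list and is false.
      generalize templates = l
      induction l with
      | nil => exact fun h _ => h
      | cons T l ih =>
        intro h hf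
        rw [TemplateArc, if_neg fun h' => hf ⟨T, List.mem_cons_self .., h'⟩] at h
        exact ih h fun ⟨T', h1, h2⟩ => hf ⟨T', List.mem_cons_of_mem _ h1, h2⟩
  · exact h.1.1

end Digraph

/-! ### The exceptional digraphs -/

namespace Digraph

open Relation (ReflTransGen)

variable {n : ℕ} {Q : Digraph (Fin n)}

theorem dicycle3_isLoopless : dicycle3.IsLoopless := by
  intro i h
  simp [dicycle3] at h

/-- The isomorphism sends a vertex to its part and its rank. -/
theorem IsTriangle.nonempty_relIso {ty : Fin n → ℕ} (ht : Q.IsTriangle ty) (m : Fin 3 → ℕ)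
    (hm : ∀ u (i : Fin 3), ty u = i → Q.blockSize u = m i) (H : ∀ i, Digraph (Fin (m i)))
    (hH : ∀ u v (i : Fin 3) (x y : Fin (m i)), ty u = i → ty v = i → Q.rank u = x →
      Q.rank v = y → (Q.Adj u v ↔ (H i).Adj x y)) :
    Nonempty (Q.Adj ≃r (composition dicycle3 H).Adj) := by
  let t : Fin n → Fin 3 := fun u => ⟨ty u, ht.lt u⟩
  let f : Fin n → Σ i, Fin (m i) := fun u =>
    ⟨t u, ⟨Q.rank u, (rank_lt_blockSize u).trans_eq (hm u (t u) rfl)⟩⟩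
  have hf : ∀ (i : Fin 3) (x : Fin (m i)) u, ty u = i → Q.rank u = x → f u = ⟨i, x⟩ := by
    intro i x u h1 h2
    obtain rfl : t u = i := Fin.ext h1
    exact congrArg (Sigma.mk _) (Fin.ext h2)
  have hbij : Function.Bijective f := by
    constructor
    · intro u v h
      have h1 : t u = t v := congrArg Sigma.fst h
      have h2 : Q.rank u = Q.rank v := congrArg (fun x : Σ i, Fin (m i) => (x.2 : ℕ)) h
      exact rank_inj ((ht.sameBlock_iff _ _).2 (congrArg Fin.val h1)) h2
    · rintro ⟨i, x⟩
      obtain ⟨u, hu⟩ := ht.surj i i.2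
      obtain ⟨v, h1, h2⟩ := exists_rank_eq u (x.2.trans_eq (hm u i hu).symm)
      exact ⟨v, hf i x v (((ht.sameBlock_iff _ _).1 h1).symm.trans hu) h2⟩
  refine ⟨⟨Equiv.ofBijective f hbij, fun {u v} => ?_⟩⟩
  simp only [Equiv.ofBijective_apply]
  by_cases h : t u = t v
  · have hv : ty v = t u := congrArg Fin.val h.symm
    have hr := (rank_lt_blockSize v).trans_eq (hm v (t u) hv)
    rw [hf (t u) ⟨Q.rank v, hr⟩ v hv rfl, composition_adj_mk dicycle3_isLoopless]
    exact (hH u v (t u) _ _ rfl hv rfl rfl).symm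
  · have hne : ¬ Q.SameBlock u v := fun h' => h (Fin.ext ((ht.sameBlock_iff _ _).1 h'))
    rw [composition_adj_of_ne h]
    have h1 : Q.Adj u v ↔ Q.BlockArc u v := ⟨fun h' => ⟨h', hne⟩, fun h' => h'.1⟩
    rw [h1, ht.blockArc_iff]
    simp only [dicycle3, f, Fin.ext_iff, Fin.val_add, t]
    rfl

theorem IsTriangle.blockType_eq {ty : Fin n → ℕ} (ht : Q.IsTriangle ty) (b u : Fin n) :
    Q.blockType b u = (ty u + 3 - ty b) % 3 := by
  have := ht.lt u
  have := ht.lt b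
  unfold blockType
  rw [ht.sameBlock_iff, ht.blockArc_iff]
  split_ifs <;> omega

/-- Two opposite arcs would make the block strong. -/
theorem not_adj_both_of_card_two {u v : Fin n} (huv : u ≠ v) (h : Q.SameBlock u v)
    (h2 : Q.blockSize u = 2) : ¬ (Q.Adj u v ∧ Q.Adj v u) := by
  classical
  rintro ⟨h3, h4⟩
  have hset : ({u, v} : Finset (Fin n)) = ({x | Q.SameBlock u x} : Finset (Fin n)) := by
    refine Finset.eq_of_subset_of_card_le (fun x hx => ?_) ?_
    · rcases (by simpa using hx : x = u ∨ x = v) with rfl | rfl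
      · simpa using Q.sameBlock_equivalence.refl x
      · simpa using h
    · rw [card_pair huv]
      exact h2.le
  refine (block_not_strongIn huv h).2 fun x hx y hy => ?_
  have hmem : ∀ x, Q.SameBlock u x → x = u ∨ x = v := by
    intro x hx
    have : x ∈ ({u, v} : Finset (Fin n)) := by rw [hset]; simpa using hx
    simpa using this
  have hu : Q.SameBlock u u := Q.sameBlock_equivalence.refl u
  rcases hmem x hx with rfl | rfl <;> rcases hmem y hy with rfl | rfl
  · exact .refl
  · exact .single ⟨hx, hy, h3⟩
  · exact .single ⟨hx, hy, h4⟩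
  · exact .refl

/-- Failure of each template in all rotations leaves little room. If a block has three vertices,
then no block contains an arc, this block has exactly three vertices and the others two. If all
blocks have two vertices, then at most one contains an arc, and only one arc. -/
theorem isExceptional_of_not_fits (hl : Q.IsLoopless) (hs : Q.IsStrong) (hq : Q.IsQuasiTransitive)
    (hn : 2 ≤ n) (hg : ¬ ∃ z a, Q.GoodArc z a) (hr : Q.minBlock = 2)
    (hfit : ¬ ∃ b, ∃ T ∈ templates, Q.Fits b T) : Q.IsExceptional := by
  have ht := isTriangle_blockType hl hs hq hn hg
  have hsize : ∀ u, 2 ≤ Q.blockSize u := fun u => hr ▸ (minBlock_spec (by omega)).1 u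
  let I : Fin n → ℕ → Prop := fun b t => ∃ u, Q.blockType b u = t ∧ ∃ v, Q.SameBlock u v ∧ Q.Adj u v
  let S : Fin n → ℕ → ℕ → Prop := fun b t m => ∃ u, Q.blockType b u = t ∧ m ≤ Q.blockSize u
  have hS : ∀ b, ∀ t < 3, S b t 2 := by
    intro b t h
    obtain ⟨u, hu⟩ := (ht b).surj t h
    exact ⟨u, hu, hsize u⟩
  have hno : ∀ (i : ℕ) (T : Template), templates[i]? = some T → ∀ b, (∀ t ∈ T.inner, I b t) →
      (∀ p ∈ T.sizes, S b p.1 p.2) → False :=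
    fun i T hT b h1 h2 => hfit ⟨b, T, List.mem_of_getElem? hT, h1, h2⟩
  have no1 : ∀ b, ¬ (I b 0 ∧ I b 1) := fun b h => hno 0 _ rfl b
    (by simpa using h) (by simpa using ⟨hS b 0 (by omega), hS b 1 (by omega), hS b 2 (by omega)⟩)
  have no2 : ∀ b, ¬ (I b 0 ∧ S b 2 3) := fun b h => hno 1 _ rfl b
    (by simpa using h.1) (by simpa using ⟨hS b 0 (by omega), hS b 1 (by omega), h.2⟩)
  have no3 : ∀ b, ¬ (I b 1 ∧ S b 2 3) := fun b h => hno 2 _ rfl b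
    (by simpa using h.1) (by simpa using ⟨hS b 0 (by omega), hS b 1 (by omega), h.2⟩)
  have no4 : ∀ b, ¬ (I b 2 ∧ S b 2 3) := fun b h => hno 3 _ rfl b
    (by simpa using h.1) (by simpa using ⟨hS b 0 (by omega), hS b 1 (by omega), h.2⟩)
  have no5 : ∀ b, ¬ S b 2 4 := fun b h => hno 4 _ rfl b
    (by simp) (by simpa using ⟨hS b 0 (by omega), hS b 1 (by omega), h⟩)
  have no6 : ∀ b, ¬ (S b 1 3 ∧ S b 2 3) := fun b h => hno 5 _ rfl b
    (by simp) (by simpa using ⟨hS b 0 (by omega), h⟩)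
  -- A suitable base vertex rotates any given block into any position, so the templates need to list
  -- only one rotation.
  have hbase : ∀ u, ∀ t < 3, ∃ b, Q.blockType b u = t := by
    intro u t h
    obtain ⟨b, hb⟩ := (ht u).surj ((3 - t) % 3) (by omega)
    exact ⟨b, by rw [(ht u).blockType_eq, hb, (ht u).blockType_eq]; omega⟩
  -- Two different blocks of a triangle are consecutive in one of the two orders and can be rotated
  -- to positions `1` and `2` of the last template.
  have hthree : ∀ b u v, Q.blockType b u ≠ Q.blockType b v → 3 ≤ Q.blockSize u →
      ¬ 3 ≤ Q.blockSize v := by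
    intro b u v hne hu hv
    have := (ht b).lt u
    have := (ht b).lt v
    have h12 : Q.blockType b v = (Q.blockType b u + 1) % 3 ∨
      Q.blockType b u = (Q.blockType b v + 1) % 3 := by omega
    rcases h12 with h | h
    · obtain ⟨b', hb'⟩ := hbase u 1 (by omega)
      refine no6 b' ⟨⟨u, hb', hu⟩, v, ?_, hv⟩
      rw [(ht b).blockType_eq] at hb' ⊢
      have := (ht b).lt b'
      omega
    · obtain ⟨b', hb'⟩ := hbase v 1 (by omega)
      refine no6 b' ⟨⟨v, hb', hv⟩, u, ?_, hu⟩
      rw [(ht b).blockType_eq] at hb' ⊢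
      have := (ht b).lt b'
      omega
  have hlt3 : ∀ {t : ℕ}, t < 3 → t = 0 ∨ t = 1 ∨ t = 2 := by intro t h; omega
  by_cases h3 : ∃ u, 3 ≤ Q.blockSize u
  · obtain ⟨u, hu⟩ := h3
    obtain ⟨b, hb⟩ := hbase u 2 (by omega)
    have hinner : ∀ x y, Q.SameBlock x y → ¬ Q.Adj x y := by
      intro x y h h'
      rcases hlt3 ((ht b).lt x) with hx | hx | hx
      · exact no2 b ⟨⟨x, hx, y, h, h'⟩, u, hb, hu⟩
      · exact no3 b ⟨⟨x, hx, y, h, h'⟩, u, hb, hu⟩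
      · exact no4 b ⟨⟨x, hx, y, h, h'⟩, u, hb, hu⟩
    refine .inr (.inr ((ht b).nonempty_relIso ![2, 2, 3] ?_ _ ?_))
    · intro v i hi
      have h2 := hsize v
      by_cases hv : Q.blockType b v = 2
      · obtain rfl : i = 2 := Fin.ext (by rw [← hi]; exact hv)
        have h4 : ¬ 4 ≤ Q.blockSize v := fun h => no5 b ⟨v, hv, h⟩
        have h5 : Q.blockSize v = Q.blockSize u :=
          blockSize_congr (((ht b).sameBlock_iff _ _).2 (by rw [hv, hb]))
        show Q.blockSize v = 3
        omega
      · have h4 := hthree b u v (by rw [hb]; exact Ne.symm hv) hu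
        have : (![2, 2, 3] : Fin 3 → ℕ) i = 2 := by
          fin_cases i
          · rfl
          · rfl
          · exact absurd hi hv
        omega
    · intro x y i p q hx hy _ _
      refine iff_of_false (hinner x y (((ht b).sameBlock_iff _ _).2 (hx.trans hy.symm))) ?_
      simp
  · have h2 : ∀ u, Q.blockSize u = 2 := by
      intro u
      have := hsize u
      by_contra h
      exact h3 ⟨u, by omega⟩
    by_cases hin : ∃ x y, Q.SameBlock x y ∧ Q.Adj x y
    · obtain ⟨u, v, huv, hadj⟩ := hin
      obtain ⟨p, q, hp, hq', rp, rq, hpq⟩ := exists_rank_zero_one hl huv hadj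
      have E := Q.sameBlock_equivalence
      have hpq' : Q.SameBlock p q := E.trans (E.symm hp) hq'
      have h0 : Q.blockType p p = 0 := by rw [(ht p).blockType_eq]; omega
      have hI : I p 0 := ⟨p, h0, q, hpq', hpq⟩
      -- A second block with an arc would, with the base at `p` or at `x`, occupy positions `0` and
      -- `1` together with the first one.
      have hinner : ∀ x y, Q.SameBlock x y → Q.Adj x y → Q.blockType p x = 0 := by
        intro x y h h'
        rcases hlt3 ((ht p).lt x) with hx | hx | hx
        · exact hx
        · exact absurd ⟨hI, x, hx, y, h, h'⟩ (no1 p)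
        · have := (ht p).blockType_eq x x
          have := (ht p).blockType_eq x p
          exact absurd ⟨⟨x, by omega, y, h, h'⟩, p, by omega, q, hpq', hpq⟩ (no1 x)
      have hfin : ∀ x, Q.blockType p x = 0 → (Q.rank x = 0 → x = p) ∧ (Q.rank x = 1 → x = q) := by
        intro x hx
        have hpx : Q.SameBlock p x := ((ht p).sameBlock_iff _ _).2 (h0.trans hx.symm)
        exact ⟨fun h => (rank_inj hpx (rp.trans h.symm)).symm,
          fun h => (rank_inj (E.trans (E.symm hpq') hpx) (rq.trans h.symm)).symm⟩
      refine .inr (.inl ((ht p).nonempty_relIso (fun _ => 2) (fun u i _ => h2 u) _ ?_))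
      intro x y i a c hx hy hra hrc
      by_cases hi : i = 0
      · subst hi
        rw [if_pos rfl]
        have hx' := hfin x hx
        have hy' := hfin y hy
        have hqp : ¬ Q.Adj q p := fun h => not_adj_both_of_card_two (hl.ne hpq) hpq' (h2 p) ⟨hpq, h⟩
        have d0 : dipath2.Adj 0 1 := ⟨rfl, rfl⟩
        have d1 : ¬ dipath2.Adj 0 0 := fun h => absurd h.2 (by decide)
        have d2 : ¬ dipath2.Adj 1 0 := fun h => absurd h.2 (by decide)
        have d3 : ¬ dipath2.Adj 1 1 := fun h => absurd h.1 (by decide)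
        fin_cases a <;> fin_cases c
        · obtain rfl := hx'.1 hra
          obtain rfl := hy'.1 hrc
          exact iff_of_false (hl _) d1
        · obtain rfl := hx'.1 hra
          obtain rfl := hy'.2 hrc
          exact iff_of_true hpq d0
        · obtain rfl := hx'.2 hra
          obtain rfl := hy'.1 hrc
          exact iff_of_false hqp d2
        · obtain rfl := hx'.2 hra
          obtain rfl := hy'.2 hrc
          exact iff_of_false (hl _) d3
      · rw [if_neg hi]
        refine iff_of_false (fun h => hi (Fin.ext ?_)) (by simp)
        rw [← hx]
        exact hinner x y (((ht p).sameBlock_iff _ _).2 (hx.trans hy.symm)) h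
    · obtain ⟨b⟩ : Nonempty (Fin n) := ⟨⟨0, by omega⟩⟩
      refine .inl ((ht b).nonempty_relIso (fun _ => 2) (fun u i _ => h2 u) _ ?_)
      intro x y i p q hx hy _ _
      refine iff_of_false (fun h => hin ⟨x, y,
        ((ht b).sameBlock_iff _ _).2 (hx.trans hy.symm), h⟩) ?_
      simp

/-! ### The family of subgraphs -/

theorem familyArc_reflTransGen (hl : Q.IsLoopless) (hs : Q.IsStrong) (hq : Q.IsQuasiTransitive)
    (hn : 2 ≤ n) (he : ¬ Q.IsExceptional) {k : ℕ} (hk : k < Q.minBlock) (u v : Fin n) :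
    ReflTransGen (Q.FamilyArc k) u v := by
  by_cases hg : ∃ z a, Q.GoodArc z a
  · exact ReflTransGen.mono (fun _ _ h => ⟨hk, .inl ⟨hg, h⟩⟩) _ _
      (goodRule_reflTransGen hs hn hg hk u v)
  · have ht := isTriangle_blockType hl hs hq hn hg
    obtain ⟨b, hb, hb'⟩ := exists_isBase (Q := Q) (by omega)
    by_cases hr : Q.minBlock = 2
    · obtain ⟨T, h1, h2, h3⟩ := templateArc_eq
        (hb' (by_contra fun h => he (isExceptional_of_not_fits hl hs hq hn hg hr h)))
      exact ReflTransGen.mono (fun x y h =>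
          ⟨hk, .inr ⟨hg, b, hb, .inl ⟨hr, (h3 k x y).2 h⟩⟩⟩) _ _
        (coreArc_reflTransGen hl (templates_valid T h1) (ht b) h2 hr (by omega) u v)
    · exact ReflTransGen.mono (fun _ _ h => ⟨hk, .inr ⟨hg, b, hb, .inr ⟨hr, h⟩⟩⟩) _ _
        (latinRule_reflTransGen hs hn (ht b) hr hk u v)

theorem FamilyArc.unique (hl : Q.IsLoopless) (hs : Q.IsStrong) (hq : Q.IsQuasiTransitive)
    (hn : 2 ≤ n) (he : ¬ Q.IsExceptional) {k l : ℕ} {u v : Fin n} (h : Q.FamilyArc k u v)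
    (h' : Q.FamilyArc l u v) : k = l := by
  obtain ⟨hk, h⟩ := h
  obtain ⟨hl', h'⟩ := h'
  by_cases hg : ∃ z a, Q.GoodArc z a
  · exact goodRule_unique hk hl' (h.resolve_right fun h => h.1 hg).2
      (h'.resolve_right fun h => h.1 hg).2
  · have ht := isTriangle_blockType hl hs hq hn hg
    obtain ⟨-, b, hb, h⟩ := h.resolve_left fun h => hg h.1
    obtain ⟨-, b', hb', h'⟩ := h'.resolve_left fun h => hg h.1
    obtain rfl := hb.unique hb'
    by_cases hr : Q.minBlock = 2
    · obtain ⟨b', hb', hfit⟩ := exists_isBase (Q := Q) (by omega)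
      obtain rfl := hb.unique hb'
      obtain ⟨T, h1, h2, h3⟩ := templateArc_eq
        (hfit (by_contra fun h => he (isExceptional_of_not_fits hl hs hq hn hg hr h)))
      exact coreArc_unique (templates_valid T h1) (ht b) (by omega) (by omega)
        ((h3 _ _ _).1 (h.resolve_right fun h => h.1 hr).2)
        ((h3 _ _ _).1 (h'.resolve_right fun h => h.1 hr).2)
    · exact latinRule_unique hr hk hl' (h.resolve_left fun h => hr h.1).2
        (h'.resolve_left fun h => hr h.1).2

end Digraph

/-! ### Formulas for the machine -/

namespace RAM

namespace Ex

/-- Equivalence. -/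
def iff (e f : Ex) : Ex := (e.and f).or (e.not.and f.not)
/-- The conjunction of a list. -/
def all : List Ex → Ex
  | [] => .const 1
  | e :: l => e.and (all l)
/-- The disjunction of a list. -/
def any : List Ex → Ex
  | [] => .const 0
  | e :: l => e.or (any l)
/-- The entry of an array at the values of three variables. -/
def entry (a x y z : ℕ) : Ex := .cell a (.var x) (.var y) (.var z)

variable {A : ℕ → ℕ → ℕ → ℕ → ℕ} {n : ℕ} {ρ : ℕ → ℕ} {e f g : Ex}

theorem sat_iff : (e.iff f).Sat A n ρ ↔ (e.Sat A n ρ ↔ f.Sat A n ρ) := by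
  rw [iff, sat_or, sat_and, sat_and, sat_not, sat_not]
  exact iff_iff_and_or_not_and_not.symm

theorem sat_cond : (Ex.cond e f g).Sat A n ρ ↔
    e.Sat A n ρ ∧ f.Sat A n ρ ∨ ¬ e.Sat A n ρ ∧ g.Sat A n ρ := by
  simp only [Sat, eval]
  split_ifs with h <;> simp [h]

theorem eval_cond_lt {a b : Ex} : (Ex.cond (a.lt b) f g).eval A n ρ =
    if a.eval A n ρ < b.eval A n ρ then f.eval A n ρ else g.eval A n ρ := by
  simp only [eval, lt]
  split_ifs <;> omega

theorem sat_entry {a x y z : ℕ} : (Ex.entry a x y z).Sat A n ρ ↔ A a (ρ x) (ρ y)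
    (ρ z) ≠ 0 := Iff.rfl

theorem eval_entry {a x y z : ℕ} : (Ex.entry a x y z).eval A n ρ = A a (ρ x) (ρ y) (ρ z) := rfl

theorem sat_all {l : List Ex} : (all l).Sat A n ρ ↔ ∀ e ∈ l, e.Sat A n ρ := by
  induction l with
  | nil => simp [all, Sat, eval]
  | cons e l ih => rw [all, sat_and, ih, List.forall_mem_cons]

theorem sat_any {l : List Ex} : (any l).Sat A n ρ ↔ ∃ e ∈ l, e.Sat A n ρ := by
  induction l with
  | nil => simp [any, Sat, eval]
  | cons e l ih => rw [any, sat_or, ih, List.exists_mem_cons_iff]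

theorem sat_any_map {α : Type*} {l : List α} {F : α → Ex} :
    (any (l.map F)).Sat A n ρ ↔ ∃ x ∈ l, (F x).Sat A n ρ := by
  simp only [sat_any, List.mem_map]
  exact ⟨fun ⟨_, ⟨x, hx, h⟩, h'⟩ => ⟨x, hx, h ▸ h'⟩, fun ⟨x, hx, h⟩ => ⟨_, ⟨x, hx, rfl⟩, h⟩⟩

/-- The relation `Cong`. -/
def cong (r a b : Ex) : Ex :=
  (a.eq b).or ((a.eq (b.add r)).or ((a.eq (b.add (r.add r))).or (b.eq (a.add r))))
/-- The function `lo`. -/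
def lo (s x : Ex) : Ex := .cond (x.lt s) x (x.sub s)
/-- The function `hi`. -/
def hi (s x : Ex) : Ex := .cond (x.lt s) (.const 0) (.const 1)

theorem sat_cong {r a b : Ex} :
    (cong r a b).Sat A n ρ ↔ Cong (r.eval A n ρ) (a.eval A n ρ) (b.eval A n ρ) := by
  simp only [cong, sat_or, sat_eq, eval, Cong]

theorem eval_lo {s x : Ex} : (lo s x).eval A n ρ = _root_.lo (s.eval A n ρ) (x.eval A n ρ) := by
  simp only [lo, eval_cond_lt, _root_.lo, eval]

theorem eval_hi {s x : Ex} : (hi s x).eval A n ρ = _root_.hi (s.eval A n ρ) (x.eval A n ρ) := by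
  simp only [hi, eval_cond_lt, _root_.hi, eval]

/-- The relation `latin`; `h` is half of `r`, and the formulas `o, q, p` say that `r` is odd, that
it is divisible by four and that `k` is even. -/
def latin (o q p h r k t x y : Ex) : Ex :=
  .cond o
    (.cond (t.eq (.const 2)) (cong r (y.add (k.add k)) (x.add (.const 1))) (cong r y (x.add k)))
    (.cond q
      (.cond (t.eq (.const 0)) (cong r y (x.add k))
        (.cond (t.eq (.const 1))
          (.cond (k.lt h) (cong r y (x.add k))
            (.cond p (cong r y ((x.add k).add (.const 1))) (cong r (y.add (.const 1)) (x.add k))))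
          (.cond (k.lt h) (cong r (y.add (k.add k)) (x.add (.const 1)))
            (cong r (y.add (k.add k)) x))))
      (.cond (t.eq (.const 0))
        (.cond ((k.lt h).and (x.lt (.const 2)))
          ((cong h (lo h y) (((Ex.const 1).sub x).add (lo h k))).and ((hi h y).eq (.const 0)))
          ((cong h (lo h y) ((lo h x).add (lo h k))).and
            (cong (.const 2) (hi h y) ((hi h x).add (hi h k)))))
        (.cond (t.eq (.const 1))
          ((cong h (lo h y) ((lo h x).add (lo h k))).and
            (cong (.const 2) (hi h y) ((hi h x).add (hi h k))))
          ((cong h ((lo h y).add ((lo h k).add (lo h k))) ((lo h x).add (.const 1))).and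
            (cong (.const 2) (hi h y) (((hi h x).add (hi h k)).add
              (.cond ((lo h y).lt (.const 2)) (.const 1) (.const 0))))))))

/-- There is no division, so parities and the half of `r` enter as separately computed data. -/
theorem sat_latin {o q p h r k t x y : Ex} (ho : o.Sat A n ρ ↔ r.eval A n ρ % 2 = 1)
    (hq : q.Sat A n ρ ↔ r.eval A n ρ % 4 = 0) (hp : p.Sat A n ρ ↔ k.eval A n ρ % 2 = 0)
    (hh : h.eval A n ρ = r.eval A n ρ / 2) :
    (latin o q p h r k t x y).Sat A n ρ ↔ _root_.latin (r.eval A n ρ) (k.eval A n ρ)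
      (t.eval A n ρ) (x.eval A n ρ) (y.eval A n ρ) := by
  simp only [latin, sat_cond, ho, hq, hp, sat_eq, sat_cong, sat_lt, sat_and, eval_lo, eval_hi,
    eval_cond_lt, hh, eval.eq_2, eval.eq_5, eval.eq_6, _root_.latin, ite_prop_iff_or]

end Ex

open Classical in
/-- The characteristic function of a relation. -/
noncomputable def ind (P : ∀ n, Digraph (Fin n) → Fin n → Fin n → Fin n → Prop) : Spec :=
  fun n Q i j k => if P n Q i j k then 1 else 0

open Classical in
theorem Knows.ind_iff {L : List (ℕ × Spec)} {n : ℕ} {Q : Digraph (Fin n)}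
    {A : ℕ → ℕ → ℕ → ℕ → ℕ} (h : Knows L n Q A) {a : ℕ}
    {P : ∀ n, Digraph (Fin n) → Fin n → Fin n → Fin n → Prop} (hm : (a, ind P) ∈ L)
    (i j k : Fin n) : A a i j k ≠ 0 ↔ P n Q i j k := by
  have h1 : A a i j k = if P n Q i j k then 1 else 0 := h _ hm i j k
  rw [h1]
  split_ifs with h' <;> simp [h']

/-- `e` is satisfied if and only if `P` holds, when the arrays are as in `L`. -/
def Ex.Says (L : List (ℕ × Spec)) (e : Ex)
    (P : ∀ n, Digraph (Fin n) → Fin n → Fin n → Fin n → Prop) : Prop :=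
  ∀ n Q A, Knows L n Q A → ∀ (ρ : ℕ → ℕ) (i j k : Fin n), ρ 0 = i → ρ 1 = j → ρ 2 = k →
    (e.Sat A n ρ ↔ P n Q i j k)

theorem Ex.Says.is {L : List (ℕ × Spec)} {e : Ex}
    {P : ∀ n, Digraph (Fin n) → Fin n → Fin n → Fin n → Prop} (h : e.Says L P) :
    e.bool.Is L (ind P) := by
  classical
  intro n Q A hA ρ i j k h0 h1 h2
  rw [Ex.eval_bool, ind]
  simp only [h n Q A hA ρ i j k h0 h1 h2]

theorem Solves.fill_ind {L : List (ℕ × Spec)} (a : ℕ) (e : Ex)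
    (P : ∀ n, Digraph (Fin n) → Fin n → Fin n → Fin n → Prop) (ha : ∀ p ∈ L, p.1 ≠ a)
    (he : e.Says L P) : Solves L ((a, ind P) :: L) :=
  .fill a e.bool _ ha he.is

end RAM

/-! ### Computing blocks, ranks and the triangle, one array at a time -/

namespace RAM

open Digraph

theorem Knows.eq {L : List (ℕ × Spec)} {n : ℕ} {Q : Digraph (Fin n)}
    {A : ℕ → ℕ → ℕ → ℕ → ℕ} (h : Knows L n Q A) {a : ℕ} {f : Spec} (hm : (a, f) ∈ L)
    (i j k : Fin n) : A a i j k = f n Q i j k := h _ hm i j k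

theorem Ex.eval_cond_of_iff {A : ℕ → ℕ → ℕ → ℕ → ℕ} {n : ℕ} {ρ : ℕ → ℕ} {e f g : Ex} {p : Prop}
    [Decidable p] (h : e.Sat A n ρ ↔ p) :
    (Ex.cond e f g).eval A n ρ = if p then f.eval A n ρ else g.eval A n ρ := by
  simp only [Ex.eval]
  exact if_congr h rfl rfl

theorem ind_congr {P P' : ∀ n, Digraph (Fin n) → Fin n → Fin n → Fin n → Prop}
    (h : ∀ n Q i j k, P n Q i j k ↔ P' n Q i j k) : ind P = ind P' := by
  have : P = P' := by
    funext n Q i j k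
    exact propext (h n Q i j k)
  rw [this]

section Stages

variable {L : List (ℕ × Spec)}

theorem solves_closure (h4 : (4, ind fun _ Q i j _ => Q.Adj i j) ∈ L) (h5 : ∀ p ∈ L, p.1 ≠ 5)
    (h6 : ∀ p ∈ L, p.1 ≠ 6) :
    Solves L ((5, ind fun _ Q i j k => k ∈ Q.moduleClosure i j) :: L) := by
  have h1 : Solves L ((5, ind fun _ Q i j k => k ∈ (modStep Q)^[0] {i, j}) :: L) := by
    refine .fill_ind 5 (((Ex.var 2).eq (.var 0)).or ((Ex.var 2).eq (.var 1))) _ h5 ?_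
    intro n Q A hA ρ i j k r0 r1 r2
    simp only [Ex.sat_or, Ex.sat_eq, Ex.eval.eq_3, r0, r1, r2, Function.iterate_zero, id,
      Set.mem_insert_iff, Set.mem_singleton_iff, Fin.ext_iff]
  have h2 := Solves.iterate 5 6 (Ex.bool ((Ex.entry 5 0 1 2).or (.ex 3 (.ex 4
    (((Ex.entry 5 0 1 3).and (.entry 5 0 1 4)).and
      (.not (((Ex.entry 4 2 3 3).iff (.entry 4 2 4 4)).and
        ((Ex.entry 4 3 2 2).iff (.entry 4 4 2 2))))))))) (fun m => ind fun _ Q i j k =>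
      k ∈ (modStep Q)^[m] {i, j}) (by decide) h5 h6 (fun m => Ex.Says.is (by
    intro n Q A hA ρ i j k r0 r1 r2
    have k5 := hA.ind_iff (List.mem_cons_self ..)
    have k4 := hA.ind_iff (List.mem_cons_of_mem _ h4)
    simp only [Ex.sat_or, Ex.sat_and, Ex.sat_not, Ex.sat_iff, Ex.sat_ex, Ex.sat_entry,
      Function.update_apply, OfNat.zero_ne_ofNat, OfNat.one_ne_ofNat, Nat.reduceEqDiff, if_true,
      if_false, r0, r1, r2, k4, k5, Function.iterate_succ_apply']
    rfl))
  have h3 : (fun n => ind (fun _ Q i j k => k ∈ (modStep Q)^[n] {i, j}) n : Spec) =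
      ind fun _ Q i j k => k ∈ Q.moduleClosure i j := by
    refine ind_congr (P := fun n Q i j k => k ∈ (modStep Q)^[n] {i, j}) fun n Q i j k => ?_
    rw [moduleClosure, Nat.card_fin]
  rw [← h3]
  exact h1.trans h2

theorem solves_reach (h4 : (4, ind fun _ Q i j _ => Q.Adj i j) ∈ L)
    (h5 : (5, ind fun _ Q i j k => k ∈ Q.moduleClosure i j) ∈ L) (h7 : ∀ p ∈ L, p.1 ≠ 7)
    (h6 : ∀ p ∈ L, p.1 ≠ 6) :
    Solves L ((7, ind fun _ Q i j k => k ∈ Q.moduleReach i j) :: L) := by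
  have h1 : Solves L ((7, ind fun _ Q i j k =>
      k ∈ (reachStep Q (Q.moduleClosure i j))^[0] {i}) :: L) := by
    refine .fill_ind 7 ((Ex.var 2).eq (.var 0)) _ h7 ?_
    intro n Q A hA ρ i j k r0 r1 r2
    simp only [Ex.sat_eq, Ex.eval.eq_3, r0, r2, Function.iterate_zero, id, Set.mem_singleton_iff,
      Fin.ext_iff]
  have h2 := Solves.iterate 7 6 (Ex.bool ((Ex.entry 7 0 1 2).or ((Ex.entry 5 0 1 2).and (.ex 3
    ((Ex.entry 7 0 1 3).and (.entry 4 3 2 2)))))) (fun m => ind fun _ Q i j k =>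
      k ∈ (reachStep Q (Q.moduleClosure i j))^[m] {i}) (by decide) h7 h6 (fun m => Ex.Says.is (by
    intro n Q A hA ρ i j k r0 r1 r2
    have k7 := hA.ind_iff (List.mem_cons_self ..)
    have k4 := hA.ind_iff (List.mem_cons_of_mem _ h4)
    have k5 := hA.ind_iff (List.mem_cons_of_mem _ h5)
    simp only [Ex.sat_or, Ex.sat_and, Ex.sat_ex, Ex.sat_entry, Function.update_apply,
      OfNat.zero_ne_ofNat, OfNat.one_ne_ofNat, Nat.reduceEqDiff, if_true, if_false, r0, r1, r2, k4,
      k5, k7, Function.iterate_succ_apply']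
    rfl))
  have h3 : (fun n => ind (fun _ Q i j k => k ∈ (reachStep Q (Q.moduleClosure i j))^[n] {i}) n :
      Spec) = ind fun _ Q i j k => k ∈ Q.moduleReach i j := by
    refine ind_congr (P := fun n Q i j k => k ∈ (reachStep Q (Q.moduleClosure i j))^[n] {i})
      fun n Q i j k => ?_
    rw [moduleReach, Nat.card_fin]
  rw [← h3]
  exact h1.trans h2

theorem solves_sameBlock (h7 : (7, ind fun _ Q i j k => k ∈ Q.moduleReach i j) ∈ L)
    (ha : ∀ p ∈ L, p.1 ≠ 8) : Solves L ((8, ind fun _ Q i j _ => Q.SameBlock i j) :: L) := by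
  refine .fill_ind 8 (((Ex.var 0).eq (.var 1)).or (.ex 3 ((((Ex.entry 7 0 3 3).not.or
    (Ex.entry 7 3 0 0).not)).and
    (((Ex.var 1).eq (.var 3)).or ((Ex.entry 7 3 1 1).not.or (Ex.entry 7 1 3 3).not))))) _ ha ?_
  intro n Q A hA ρ i j k r0 r1 r2
  have k7 := hA.ind_iff h7
  simp only [Ex.sat_or, Ex.sat_and, Ex.sat_not, Ex.sat_ex, Ex.sat_entry, Ex.sat_eq, Ex.eval.eq_3,
    Function.update_apply, OfNat.zero_ne_ofNat, OfNat.one_ne_ofNat, if_true, if_false, r0, r1, k7,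
    sameBlock_iff, Fin.ext_iff]

theorem solves_isTail (h4 : (4, ind fun _ Q i j _ => Q.Adj i j) ∈ L)
    (h8 : (8, ind fun _ Q i j _ => Q.SameBlock i j) ∈ L)
    (ha : ∀ p ∈ L, p.1 ≠ 9) : Solves L ((9, ind fun _ Q i _ _ => Q.IsTail i) :: L) := by
  refine .fill_ind 9 ((Ex.ex 3 ((Ex.entry 8 0 3 3).and (.entry 4 0 3 3))).and (.not (.ex 3
    ((((Ex.var 3).lt (.var 0)).and (.entry 8 0 3 3)).and
      (.ex 4 ((Ex.entry 8 3 4 4).and (.entry 4 3 4 4))))))) _ ha ?_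
  intro n Q A hA ρ i j k r0 r1 r2
  have k4 := hA.ind_iff h4
  have k8 := hA.ind_iff h8
  simp only [Ex.sat_and, Ex.sat_not, Ex.sat_ex, Ex.sat_entry, Ex.sat_lt, Ex.eval.eq_3,
    Function.update_apply, OfNat.zero_ne_ofNat, Nat.reduceEqDiff, if_true, if_false, r0, k4, k8,
    IsTail, Fin.lt_def]

theorem solves_isHead (h4 : (4, ind fun _ Q i j _ => Q.Adj i j) ∈ L)
    (h8 : (8, ind fun _ Q i j _ => Q.SameBlock i j) ∈ L)
    (h9 : (9, ind fun _ Q i _ _ => Q.IsTail i) ∈ L)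
    (ha : ∀ p ∈ L, p.1 ≠ 10) : Solves L ((10, ind fun _ Q i _ _ => Q.IsHead i) :: L) := by
  refine .fill_ind 10 (Ex.ex 3 (((Ex.entry 9 3 3 3).and ((Ex.entry 8 3 0 0).and
    (.entry 4 3 0 0))).and (.not (.ex 4
    ((((Ex.var 4).lt (.var 0)).and (.entry 8 0 4 4)).and (.entry 4 3 4 4)))))) _ ha ?_
  intro n Q A hA ρ i j k r0 r1 r2
  have k4 := hA.ind_iff h4
  have k8 := hA.ind_iff h8
  have k9 := hA.ind_iff h9
  simp only [Ex.sat_and, Ex.sat_not, Ex.sat_ex, Ex.sat_entry, Ex.sat_lt, Ex.eval.eq_3,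
    Function.update_apply, OfNat.zero_ne_ofNat, Nat.reduceEqDiff, if_true, if_false, r0, k4, k8, k9,
    IsHead, Fin.lt_def]

theorem solves_key (h9 : (9, ind fun _ Q i _ _ => Q.IsTail i) ∈ L)
    (h10 : (10, ind fun _ Q i _ _ => Q.IsHead i) ∈ L)
    (ha : ∀ p ∈ L, p.1 ≠ 11) : Solves L ((11, fun _ Q i _ _ => Q.key i) :: L) := by
  refine .fill 11 (.cond (.entry 9 0 0 0) (.const 0) (.cond (.entry 10 0 0 0) (.const 1)
    ((Ex.var 0).add (.const 2)))) _ ha ?_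
  intro n Q A hA ρ i j k r0 r1 r2
  have k9 := hA.ind_iff h9
  have k10 := hA.ind_iff h10
  classical
  have e9 : (Ex.entry 9 0 0 0).Sat A n ρ ↔ Q.IsTail i := by rw [Ex.sat_entry, r0, k9]
  have e10 : (Ex.entry 10 0 0 0).Sat A n ρ ↔ Q.IsHead i := by rw [Ex.sat_entry, r0, k10]
  rw [Ex.eval_cond_of_iff e9, Ex.eval_cond_of_iff e10]
  simp only [Ex.eval, r0]
  rfl

theorem solves_rank (h8 : (8, ind fun _ Q i j _ => Q.SameBlock i j) ∈ L)
    (h11 : ((11, fun _ Q i _ _ => Q.key i) : ℕ × Spec) ∈ L)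
    (ha : ∀ p ∈ L, p.1 ≠ 12) : Solves L ((12, fun _ Q i _ _ => Q.rank i) :: L) := by
  refine .fill 12 (.sum 3 (.bool ((Ex.entry 8 0 3 3).and ((Ex.entry 11 3 3 3).lt
    (.entry 11 0 0 0))))) _ ha ?_
  intro n Q A hA ρ i j k r0 r1 r2
  have k8 := hA.ind_iff h8
  have k11 := hA.eq h11
  rw [Ex.eval_sum_bool]
  simp only [rank, rankBy]
  congr 1
  ext x
  simp only [mem_filter, mem_univ, true_and]
  simp only [Ex.sat_and, Ex.sat_entry, Ex.sat_lt, Ex.eval_entry, Function.update_apply,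
    OfNat.zero_ne_ofNat, if_true, if_false, r0, k8, k11]

theorem solves_blockSize (h8 : (8, ind fun _ Q i j _ => Q.SameBlock i j) ∈ L)
    (ha : ∀ p ∈ L, p.1 ≠ 13) : Solves L ((13, fun _ Q i _ _ => Q.blockSize i) :: L) := by
  refine .fill 13 (.sum 3 (.bool (.entry 8 0 3 3))) _ ha ?_
  intro n Q A hA ρ i j k r0 r1 r2
  have k8 := hA.ind_iff h8
  rw [Ex.eval_sum_bool]
  simp only [blockSize]
  congr 1
  ext x
  simp only [mem_filter, mem_univ, true_and]
  simp only [Ex.sat_entry, Function.update_apply, OfNat.zero_ne_ofNat, if_true, if_false, r0, k8]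

theorem solves_minBlock (h13 : ((13, fun _ Q i _ _ => Q.blockSize i) : ℕ × Spec) ∈ L)
    (ha : ∀ p ∈ L, p.1 ≠ 14) : Solves L ((14, fun _ Q _ _ _ => Q.minBlock) :: L) := by
  refine .fill 14 (.sum 3 (.bool (.not (.ex 4 (.not ((Ex.var 3).lt (.entry 13 4 4 4))))))) _ ha ?_
  intro n Q A hA ρ i j k r0 r1 r2
  have k13 := hA.eq h13
  rw [Ex.eval_sum_bool]
  simp only [minBlock]
  congr 1
  ext x
  simp only [mem_filter, mem_univ, true_and]
  simp only [Ex.sat_not, Ex.sat_ex, Ex.sat_lt, Ex.eval_entry, Ex.eval.eq_3, Function.update_apply,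
    Nat.reduceEqDiff, if_true, if_false, k13, not_exists, not_not]

theorem solves_blockArc (h4 : (4, ind fun _ Q i j _ => Q.Adj i j) ∈ L)
    (h8 : (8, ind fun _ Q i j _ => Q.SameBlock i j) ∈ L)
    (ha : ∀ p ∈ L, p.1 ≠ 15) : Solves L ((15, ind fun _ Q i j _ => Q.BlockArc i j) :: L) := by
  refine .fill_ind 15 ((Ex.entry 4 0 1 1).and (.not (.entry 8 0 1 1))) _ ha ?_
  intro n Q A hA ρ i j k r0 r1 r2
  have k4 := hA.ind_iff h4
  have k8 := hA.ind_iff h8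
  simp only [Ex.sat_and, Ex.sat_not, Ex.sat_entry, r0, r1, k4, k8, BlockArc]

theorem solves_goodArc (h15 : (15, ind fun _ Q i j _ => Q.BlockArc i j) ∈ L)
    (ha : ∀ p ∈ L, p.1 ≠ 16) : Solves L ((16, ind fun _ Q i j _ => Q.GoodArc i j) :: L) := by
  refine .fill_ind 16 ((Ex.entry 15 0 1 1).and ((Ex.entry 15 1 0 0).or (.ex 3 (.ex 4
    ((Ex.entry 15 1 3 3).and
    ((Ex.entry 15 3 4 4).and (.entry 15 4 0 0))))))) _ ha ?_
  intro n Q A hA ρ i j k r0 r1 r2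
  have k15 := hA.ind_iff h15
  simp only [Ex.sat_or, Ex.sat_and, Ex.sat_ex, Ex.sat_entry, Function.update_apply,
    OfNat.zero_ne_ofNat, OfNat.one_ne_ofNat, Nat.reduceEqDiff, if_true, if_false, r0, r1, k15,
    GoodArc]

theorem solves_firstGoodArc (h16 : (16, ind fun _ Q i j _ => Q.GoodArc i j) ∈ L)
    (ha : ∀ p ∈ L, p.1 ≠ 17) : Solves L ((17, ind fun _ Q i j _ => Q.FirstGoodArc i j) :: L) := by
  refine .fill_ind 17 ((Ex.entry 16 0 1 1).and (.not (.ex 3 (.ex 4 ((((Ex.var 3).lt (.var 0)).or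
    (((Ex.var 3).eq (.var 0)).and ((Ex.var 4).lt (.var 1)))).and (.entry 16 3 4 4)))))) _ ha ?_
  intro n Q A hA ρ i j k r0 r1 r2
  have k16 := hA.ind_iff h16
  simp only [Ex.sat_or, Ex.sat_and, Ex.sat_not, Ex.sat_ex, Ex.sat_entry, Ex.sat_eq, Ex.sat_lt,
    Ex.eval.eq_3, Function.update_apply, OfNat.zero_ne_ofNat, OfNat.one_ne_ofNat, Nat.reduceEqDiff,
    if_true, if_false, r0, r1, k16, FirstGoodArc, Fin.lt_def, Fin.ext_iff]

theorem solves_twisted (h8 : (8, ind fun _ Q i j _ => Q.SameBlock i j) ∈ L)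
    (h17 : (17, ind fun _ Q i j _ => Q.FirstGoodArc i j) ∈ L)
    (ha : ∀ p ∈ L, p.1 ≠ 18) : Solves L ((18, ind fun _ Q i j _ => Q.Twisted i j) :: L) := by
  refine .fill_ind 18 (.ex 3 (.ex 4 ((Ex.entry 17 3 4 4).and ((Ex.entry 8 3 0 0).and
    (.entry 8 4 1 1))))) _ ha ?_
  intro n Q A hA ρ i j k r0 r1 r2
  have k8 := hA.ind_iff h8
  have k17 := hA.ind_iff h17
  simp only [Ex.sat_and, Ex.sat_ex, Ex.sat_entry, Function.update_apply, OfNat.zero_ne_ofNat,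
    OfNat.one_ne_ofNat, Nat.reduceEqDiff, if_true, if_false, r0, r1, k8, k17, Twisted]

theorem solves_blockType (h8 : (8, ind fun _ Q i j _ => Q.SameBlock i j) ∈ L)
    (h15 : (15, ind fun _ Q i j _ => Q.BlockArc i j) ∈ L)
    (ha : ∀ p ∈ L, p.1 ≠ 19) : Solves L ((19, fun _ Q i j _ => Q.blockType i j) :: L) := by
  refine .fill 19 (.cond (.entry 8 0 1 1) (.const 0) (.cond (.entry 15 0 1 1) (.const 1)
    (.const 2))) _ ha ?_
  intro n Q A hA ρ i j k r0 r1 r2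
  have k8 := hA.ind_iff h8
  have k15 := hA.ind_iff h15
  classical
  have e8 : (Ex.entry 8 0 1 1).Sat A n ρ ↔ Q.SameBlock i j := by rw [Ex.sat_entry, r0, r1, k8]
  have e15 : (Ex.entry 15 0 1 1).Sat A n ρ ↔ Q.BlockArc i j := by rw [Ex.sat_entry, r0, r1, k15]
  rw [Ex.eval_cond_of_iff e8, Ex.eval_cond_of_iff e15]
  rfl

theorem minBlock_le {n : ℕ} (Q : Digraph (Fin n)) : Q.minBlock ≤ n := by
  classical
  exact (card_le_univ _).trans (by simp)

theorem solves_half (h14 : ((14, fun _ Q _ _ _ => Q.minBlock) : ℕ × Spec) ∈ L)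
    (ha : ∀ p ∈ L, p.1 ≠ 20) : Solves L ((20, fun _ Q _ _ _ => Q.minBlock / 2) :: L) := by
  -- Division by two is done by counting: `x < r / 2` holds exactly if `2x + 1 < r`, and `r` is at
  -- most `n`.
  refine .fill 20 (.sum 3 (.bool ((((Ex.var 3).add (.var 3)).add (.const 1)).lt
    (.entry 14 0 0 0)))) _ ha ?_
  intro n Q A hA ρ i j k r0 r1 r2
  have k14 := hA.eq h14
  have hle := minBlock_le Q
  rw [Ex.eval_sum_bool]
  simp only
  rw [← card_fin_lt (n := n) (m := Q.minBlock / 2) (by omega)]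
  congr 1
  ext x
  simp only [mem_filter, mem_univ, true_and]
  simp only [Ex.sat_lt, Ex.eval_entry, Ex.eval.eq_2, Ex.eval.eq_3, Ex.eval.eq_5,
    Function.update_apply, OfNat.zero_ne_ofNat, if_true, if_false, r0, k14]
  omega

theorem solves_even (ha : ∀ p ∈ L, p.1 ≠ 21) : Solves L ((21, ind fun _ _ i _ _ =>
    (i : ℕ) % 2 = 0) :: L) := by
  refine .fill_ind 21 (.ex 3 ((Ex.var 0).eq ((Ex.var 3).add (.var 3)))) _ ha ?_
  intro n Q A hA ρ i j k r0 r1 r2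
  simp only [Ex.sat_ex, Ex.sat_eq, Ex.eval.eq_3, Ex.eval.eq_5, Function.update_apply,
    OfNat.zero_ne_ofNat, if_true, if_false, r0]
  exact ⟨fun ⟨x, hx⟩ => by omega, fun h => ⟨⟨i / 2, by omega⟩, by simp only; omega⟩⟩

theorem solves_odd (h14 : ((14, fun _ Q _ _ _ => Q.minBlock) : ℕ × Spec) ∈ L)
    (ha : ∀ p ∈ L, p.1 ≠ 22) : Solves L ((22, ind fun _ Q _ _ _ => Q.minBlock % 2 = 1) :: L) := by
  refine .fill_ind 22 (.ex 3 ((Ex.entry 14 0 0 0).eq (((Ex.var 3).add (.var 3)).add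
    (.const 1)))) _ ha ?_
  intro n Q A hA ρ i j k r0 r1 r2
  have k14 := hA.eq h14
  simp only [Ex.sat_ex, Ex.sat_eq, Ex.eval_entry, Ex.eval.eq_2, Ex.eval.eq_3, Ex.eval.eq_5,
    Function.update_apply, OfNat.zero_ne_ofNat, if_true, if_false, r0, k14]
  have hle := minBlock_le Q
  exact ⟨fun ⟨x, hx⟩ => by omega, fun h => ⟨⟨Q.minBlock / 2, by omega⟩, by simp only; omega⟩⟩

theorem solves_four (h14 : ((14, fun _ Q _ _ _ => Q.minBlock) : ℕ × Spec) ∈ L)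
    (ha : ∀ p ∈ L, p.1 ≠ 23) : Solves L ((23, ind fun _ Q _ _ _ => Q.minBlock % 4 = 0) :: L) := by
  refine .fill_ind 23 (.ex 3 ((Ex.entry 14 0 0 0).eq (((Ex.var 3).add (.var 3)).add
    ((Ex.var 3).add (.var 3))))) _ ha ?_
  intro n Q A hA ρ i j k r0 r1 r2
  have k14 := hA.eq h14
  simp only [Ex.sat_ex, Ex.sat_eq, Ex.eval_entry, Ex.eval.eq_3, Ex.eval.eq_5, Function.update_apply,
    OfNat.zero_ne_ofNat, if_true, if_false, r0, k14]
  have hle := minBlock_le Q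
  exact ⟨fun ⟨x, hx⟩ => by omega, fun h => ⟨⟨Q.minBlock / 4, by omega⟩, by simp only; omega⟩⟩

theorem solves_exists_goodArc (h16 : (16, ind fun _ Q i j _ => Q.GoodArc i j) ∈ L)
    (ha : ∀ p ∈ L, p.1 ≠ 27) : Solves L ((27, ind fun _ Q _ _ _ => ∃ z a, Q.GoodArc z a) :: L) := by
  refine .fill_ind 27 (.ex 3 (.ex 4 (.entry 16 3 4 4))) _ ha ?_
  intro n Q A hA ρ i j k r0 r1 r2
  have k16 := hA.ind_iff h16
  simp only [Ex.sat_ex, Ex.sat_entry, Function.update_apply, Nat.reduceEqDiff, if_true, if_false,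
    k16]

end Stages

end RAM

/-! ### Computing the template arcs and the family -/

namespace RAM

open Digraph

section Templates

/-- The number of the value of a variable in a template. -/
def Ex.code (x : ℕ) : Ex :=
  (((Ex.entry 19 0 x x).add (.entry 19 0 x x)).add ((Ex.entry 19 0 x x).add
    (.entry 19 0 x x))).add (.entry 12 x x x)

/-- The formula for `Fits`. -/
def Ex.fits (T : Template) : Ex :=
  (Ex.all (T.inner.map fun t => .ex 3 (((Ex.entry 19 0 3 3).eq (.const t)).and
    (.ex 4 ((Ex.entry 8 3 4 4).and (.entry 4 3 4 4)))))).and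
  (Ex.all (T.sizes.map fun p => .ex 3 (((Ex.entry 19 0 3 3).eq (.const p.1)).and
    ((Ex.const p.2).le (.entry 13 3 3 3)))))

/-- The formula for `InCore`. -/
def Ex.inCore (T : Template) (x : ℕ) : Ex :=
  ((Ex.entry 12 x x x).lt (.const 4)).and
    (Ex.any (T.first.map fun c => (Ex.code x).eq (.const c)))

/-- The formula for `CoreArc`. -/
def Ex.coreArc (T : Template) (c : ℕ) : Ex :=
  (Ex.entry 4 1 2 2).and ((((Ex.inCore T 1).and (Ex.inCore T 2)).and
    (Ex.any (((T.walk c).zip (T.walk c).tail).map fun p =>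
      ((Ex.code 1).eq (.const p.1)).and ((Ex.code 2).eq (.const p.2))))).or
    ((Ex.entry 8 1 2 2).not.and (((Ex.inCore T 1).not.and ((Ex.entry 12 2 2 2).eq (.const c))).or
      ((Ex.inCore T 2).not.and ((Ex.entry 12 1 1 1).eq (.const c))))))

/-- The formula for `TemplateArc`. -/
def Ex.templateArc (c : ℕ) : List Template → Ex
  | [] => .const 0
  | T :: l => .cond (Ex.fits T) (Ex.coreArc T c) (templateArc c l)

variable {L : List (ℕ × Spec)}

theorem Ex.fits_says (h4 : (4, ind fun _ Q i j _ => Q.Adj i j) ∈ L)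
    (h8 : (8, ind fun _ Q i j _ => Q.SameBlock i j) ∈ L)
    (h13 : ((13, fun _ Q i _ _ => Q.blockSize i) : ℕ × Spec) ∈ L)
    (h19 : ((19, fun _ Q i j _ => Q.blockType i j) : ℕ × Spec) ∈ L) (T : Template) :
    (Ex.fits T).Says L fun _ Q i _ _ => Q.Fits i T := by
  intro n Q A hA ρ i j k r0 r1 r2
  have k4 := hA.ind_iff h4
  have k8 := hA.ind_iff h8
  have k13 := hA.eq h13
  have k19 := hA.eq h19
  simp only [Ex.fits, Ex.sat_all, List.forall_mem_map, Ex.sat_and, Ex.sat_ex, Ex.sat_entry,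
    Ex.sat_eq, Ex.sat_le, Ex.eval_entry, Ex.eval.eq_2, Function.update_apply, OfNat.zero_ne_ofNat,
    Nat.reduceEqDiff, if_true, if_false, r0, k4, k8, k13, k19, Fits]

theorem Ex.eval_code {n : ℕ} {Q : Digraph (Fin n)} {A : ℕ → ℕ → ℕ → ℕ → ℕ} (hA : Knows L n Q A)
    (h12 : ((12, fun _ Q i _ _ => Q.rank i) : ℕ × Spec) ∈ L)
    (h19 : ((19, fun _ Q i j _ => Q.blockType i j) : ℕ × Spec) ∈ L) {ρ : ℕ → ℕ} {x : ℕ} {b u : Fin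
        n} (r0 : ρ 0 = b) (rx : ρ x = u) :
    (Ex.code x).eval A n ρ = Q.code b u := by
  have k12 := hA.eq h12
  have k19 := hA.eq h19
  simp only [Ex.code, Ex.eval, Ex.entry, r0, rx, k12, k19, Digraph.code]
  ring

theorem Ex.sat_inCore {n : ℕ} {Q : Digraph (Fin n)} {A : ℕ → ℕ → ℕ → ℕ → ℕ} (hA : Knows L n Q A)
    (h12 : ((12, fun _ Q i _ _ => Q.rank i) : ℕ × Spec) ∈ L)
    (h19 : ((19, fun _ Q i j _ => Q.blockType i j) : ℕ × Spec) ∈ L)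
        (T : Template) {ρ : ℕ → ℕ} {x : ℕ} {b u : Fin n} (r0 : ρ 0 = b) (rx : ρ x = u) :
    (Ex.inCore T x).Sat A n ρ ↔ Q.InCore b T u := by
  have k12 := hA.eq h12
  have k19 := hA.eq h19
  have hc := Ex.eval_code hA h12 h19 r0 rx
  simp only [Ex.inCore, Ex.sat_and, Ex.sat_any_map, Ex.sat_lt, Ex.eval_entry, rx, k12, Ex.sat_eq,
    Ex.eval.eq_2, hc, InCore, exists_eq_right']

theorem Ex.coreArc_says (h4 : (4, ind fun _ Q i j _ => Q.Adj i j) ∈ L)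
    (h8 : (8, ind fun _ Q i j _ => Q.SameBlock i j) ∈ L)
    (h12 : ((12, fun _ Q i _ _ => Q.rank i) : ℕ × Spec) ∈ L)
    (h19 : ((19, fun _ Q i j _ => Q.blockType i j) : ℕ × Spec) ∈ L) (T : Template) (c : ℕ) :
    (Ex.coreArc T c).Says L fun _ Q i j k => Q.CoreArc i T c j k := by
  intro n Q A hA ρ i j k r0 r1 r2
  have k4 := hA.ind_iff h4
  have k8 := hA.ind_iff h8
  have k12 := hA.eq h12
  have k19 := hA.eq h19
  have c1 := Ex.eval_code hA h12 h19 r0 r1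
  have c2 := Ex.eval_code hA h12 h19 r0 r2
  have i1 := Ex.sat_inCore hA h12 h19 T r0 r1
  have i2 := Ex.sat_inCore hA h12 h19 T r0 r2
  simp only [Ex.coreArc, Ex.sat_any_map, Ex.sat_or, Ex.sat_and, Ex.sat_not, Ex.sat_entry, Ex.sat_eq,
    Ex.eval_entry, Ex.eval.eq_2, r1, r2, k4, k8, k12, c1, c2, i1, i2, CoreArc]
  refine and_congr_right fun _ => or_congr (and_congr_right fun _ => ?_) Iff.rfl
  exact ⟨fun ⟨p, hp, e1, e2⟩ => by rw [e1, e2]; exact hp, fun h => ⟨_, h, rfl, rfl⟩⟩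

theorem Ex.templateArc_says (h4 : (4, ind fun _ Q i j _ => Q.Adj i j) ∈ L)
    (h8 : (8, ind fun _ Q i j _ => Q.SameBlock i j) ∈ L)
    (h12 : ((12, fun _ Q i _ _ => Q.rank i) : ℕ × Spec) ∈ L)
    (h13 : ((13, fun _ Q i _ _ => Q.blockSize i) : ℕ × Spec) ∈ L)
    (h19 : ((19, fun _ Q i j _ => Q.blockType i j) : ℕ × Spec) ∈ L) (c : ℕ) (l : List Template) :
    (Ex.templateArc c l).Says L fun _ Q i j k => Q.TemplateArc i c j k l := by
  intro n Q A hA ρ i j k r0 r1 r2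
  induction l with
  | nil => simp [Ex.templateArc, Ex.Sat, Ex.eval, TemplateArc]
  | cons T l ih =>
    rw [Ex.templateArc, Ex.sat_cond, Ex.fits_says h4 h8 h13 h19 T n Q A hA ρ i j k r0 r1 r2,
      Ex.coreArc_says h4 h8 h12 h19 T c n Q A hA ρ i j k r0 r1 r2, ih]
    simp only [TemplateArc, ite_prop_iff_or]

/-- The list of templates is fixed, so unfolding it gives one formula of constant size. The colour
is a literal in it, and each of the two colours gets its own array. -/
theorem solves_templateArc (h4 : (4, ind fun _ Q i j _ => Q.Adj i j) ∈ L)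
    (h8 : (8, ind fun _ Q i j _ => Q.SameBlock i j) ∈ L)
    (h12 : ((12, fun _ Q i _ _ => Q.rank i) : ℕ × Spec) ∈ L)
    (h13 : ((13, fun _ Q i _ _ => Q.blockSize i) : ℕ × Spec) ∈ L)
    (h19 : ((19, fun _ Q i j _ => Q.blockType i j) : ℕ × Spec) ∈ L) (a c : ℕ)
        (ha : ∀ p ∈ L, p.1 ≠ a) :
    Solves L ((a, ind fun _ Q i j k => Q.TemplateArc i c j k templates) :: L) :=
  .fill_ind a _ _ ha (Ex.templateArc_says h4 h8 h12 h13 h19 c templates)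

theorem solves_exists_fits (h4 : (4, ind fun _ Q i j _ => Q.Adj i j) ∈ L)
    (h8 : (8, ind fun _ Q i j _ => Q.SameBlock i j) ∈ L)
    (h13 : ((13, fun _ Q i _ _ => Q.blockSize i) : ℕ × Spec) ∈ L)
    (h19 : ((19, fun _ Q i j _ => Q.blockType i j) : ℕ × Spec) ∈ L) (ha : ∀ p ∈ L, p.1 ≠ 28) :
    Solves L ((28, ind fun _ Q i _ _ => ∃ T ∈ templates, Q.Fits i T) :: L) := by
  refine .fill_ind 28 (Ex.any (templates.map Ex.fits)) _ ha ?_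
  intro n Q A hA ρ i j k r0 r1 r2
  simp only [Ex.sat_any_map]
  exact exists_congr fun T => and_congr_right fun _ =>
    Ex.fits_says h4 h8 h13 h19 T n Q A hA ρ i j k r0 r1 r2

theorem solves_isBase (h28 : (28, ind fun _ Q i _ _ => ∃ T ∈ templates, Q.Fits i T) ∈ L)
    (ha : ∀ p ∈ L, p.1 ≠ 26) : Solves L ((26, ind fun _ Q i _ _ => Q.IsBase i) :: L) := by
  refine .fill_ind 26 (((Ex.entry 28 0 0 0).and (.not (.ex 3 (((Ex.var 3).lt (.var 0)).and
    (.entry 28 3 3 3))))).or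
    (((Ex.var 0).eq (.const 0)).and (.not (.ex 3 (.entry 28 3 3 3))))) _ ha ?_
  intro n Q A hA ρ i j k r0 r1 r2
  have k28 := hA.ind_iff h28
  simp only [Ex.sat_or, Ex.sat_and, Ex.sat_not, Ex.sat_ex, Ex.sat_entry, Ex.sat_eq, Ex.sat_lt,
    Ex.eval.eq_2, Ex.eval.eq_3, Function.update_apply, OfNat.zero_ne_ofNat, if_true, if_false, r0,
    k28, IsBase, Fin.lt_def]

end Templates

section Family

variable {L : List (ℕ × Spec)}

/-- The formula for `ColourArc`. -/
def Ex.colourArc (e : Ex) : Ex :=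
  (Ex.entry 15 1 2 2).and ((((Ex.entry 12 1 1 1).lt (.entry 14 0 0 0)).and
    (((Ex.entry 12 2 2 2).lt (.entry 14 0 0 0)).and e)).or
    ((((Ex.entry 14 0 0 0).le (.entry 12 1 1 1)).and ((Ex.entry 12 2 2 2).eq (.var 0))).or
      (((Ex.entry 14 0 0 0).le (.entry 12 2 2 2)).and ((Ex.entry 12 1 1 1).eq (.var 0)))))

theorem Ex.sat_colourArc {n : ℕ} {Q : Digraph (Fin n)} {A : ℕ → ℕ → ℕ → ℕ → ℕ}
    (hA : Knows L n Q A) (h12 : ((12, fun _ Q i _ _ => Q.rank i) : ℕ × Spec) ∈ L)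
    (h14 : ((14, fun _ Q _ _ _ => Q.minBlock) : ℕ × Spec) ∈ L)
    (h15 : (15, ind fun _ Q i j _ => Q.BlockArc i j) ∈ L) {ρ : ℕ → ℕ} {i j k : Fin n}
        (r0 : ρ 0 = i) (r1 : ρ 1 = j)
    (r2 : ρ 2 = k) {e : Ex} {R : ℕ → Fin n → Fin n → Prop} (he : e.Sat A n ρ ↔ R i j k) :
    (Ex.colourArc e).Sat A n ρ ↔ Q.ColourArc Q.minBlock R i j k := by
  have k12 := hA.eq h12
  have k14 := hA.eq h14
  have k15 := hA.ind_iff h15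
  simp only [Ex.colourArc, Ex.sat_or, Ex.sat_and, Ex.sat_entry, Ex.sat_eq, Ex.sat_lt, Ex.sat_le,
    Ex.eval_entry, Ex.eval.eq_3, r0, r1, r2, k12, k14, k15, he, ColourArc]

/-- The formula for `goodRule`. -/
def Ex.goodRule : Ex :=
  .cong (.entry 14 0 0 0) ((Ex.entry 12 1 1 1).add (.entry 12 2 2 2))
    ((Ex.var 0).add (.entry 18 1 2 2))

theorem Ex.goodRule_says (h12 : ((12, fun _ Q i _ _ => Q.rank i) : ℕ × Spec) ∈ L)
    (h14 : ((14, fun _ Q _ _ _ => Q.minBlock) : ℕ × Spec) ∈ L)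
    (h18 : (18, ind fun _ Q i j _ => Q.Twisted i j) ∈ L) :
    Ex.goodRule.Says L fun _ Q i j k => Q.goodRule i j k := by
  intro n Q A hA ρ i j k r0 r1 r2
  have k12 := hA.eq h12
  have k14 := hA.eq h14
  have k18 := hA.eq h18
  simp only [Ex.goodRule, Ex.sat_cong, Ex.eval.eq_3, Ex.eval.eq_5, Ex.eval_entry, r0, r1, r2, k12,
    k14, k18]
  rfl

/-- The formula for `latinRule`. -/
def Ex.latinRule : Ex :=
  .latin (.entry 22 0 0 0) (.entry 23 0 0 0) (.entry 21 0 0 0) (.entry 20 0 0 0) (.entry 14 0 0 0)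
    (.var 0) (.entry 19 3 1 1) (.entry 12 1 1 1) (.entry 12 2 2 2)

theorem Ex.sat_latinRule {n : ℕ} {Q : Digraph (Fin n)} {A : ℕ → ℕ → ℕ → ℕ → ℕ}
    (hA : Knows L n Q A) (h12 : ((12, fun _ Q i _ _ => Q.rank i) : ℕ × Spec) ∈ L)
    (h14 : ((14, fun _ Q _ _ _ => Q.minBlock) : ℕ × Spec) ∈ L)
    (h19 : ((19, fun _ Q i j _ => Q.blockType i j) : ℕ × Spec) ∈ L)
    (h20 : ((20, fun _ Q _ _ _ => Q.minBlock / 2) : ℕ × Spec) ∈ L)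
    (h21 : (21, ind fun _ _ i _ _ => (i : ℕ) % 2 = 0) ∈ L)
    (h22 : (22, ind fun _ Q _ _ _ => Q.minBlock % 2 = 1) ∈ L)
    (h23 : (23, ind fun _ Q _ _ _ => Q.minBlock % 4 = 0) ∈ L) {ρ : ℕ → ℕ} {i j k b : Fin n}
        (r0 : ρ 0 = i) (r1 : ρ 1 = j)
    (r2 : ρ 2 = k) (r3 : ρ 3 = b) :
    Ex.latinRule.Sat A n ρ ↔ Q.latinRule (Q.blockType b) i j k := by
  have k12 := hA.eq h12
  have k14 := hA.eq h14
  have k19 := hA.eq h19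
  have k20 := hA.eq h20
  have k21 := hA.ind_iff h21
  have k22 := hA.ind_iff h22
  have k23 := hA.ind_iff h23
  rw [Ex.latinRule, Ex.sat_latin]
  · simp only [Ex.eval_entry, Ex.eval.eq_3, r0, r1, r2, r3, k12, k14, k19, Digraph.latinRule]
  all_goals simp only [Ex.sat_entry, Ex.eval_entry, Ex.eval.eq_3, r0, k14, k20, k21, k22, k23]

theorem solves_familyArc (h12 : ((12, fun _ Q i _ _ => Q.rank i) : ℕ × Spec) ∈ L)
    (h14 : ((14, fun _ Q _ _ _ => Q.minBlock) : ℕ × Spec) ∈ L)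
    (h15 : (15, ind fun _ Q i j _ => Q.BlockArc i j) ∈ L)
    (h18 : (18, ind fun _ Q i j _ => Q.Twisted i j) ∈ L)
    (h19 : ((19, fun _ Q i j _ => Q.blockType i j) : ℕ × Spec) ∈ L)
    (h20 : ((20, fun _ Q _ _ _ => Q.minBlock / 2) : ℕ × Spec) ∈ L)
    (h21 : (21, ind fun _ _ i _ _ => (i : ℕ) % 2 = 0) ∈ L)
    (h22 : (22, ind fun _ Q _ _ _ => Q.minBlock % 2 = 1) ∈ L)
    (h23 : (23, ind fun _ Q _ _ _ => Q.minBlock % 4 = 0) ∈ L)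
    (h24 : (24, ind fun _ Q i j k => Q.TemplateArc i 0 j k templates) ∈ L)
    (h25 : (25, ind fun _ Q i j k => Q.TemplateArc i 1 j k templates) ∈ L)
    (h26 : (26, ind fun _ Q i _ _ => Q.IsBase i) ∈ L)
    (h27 : (27, ind fun _ Q _ _ _ => ∃ z a, Q.GoodArc z a) ∈ L) (ha : ∀ p ∈ L, p.1 ≠ 3) :
    Solves L ((3, ind fun _ Q i j k => Q.FamilyArc i j k) :: L) := by
  refine .fill_ind 3 (((Ex.var 0).lt (.entry 14 0 0 0)).and
    (((Ex.entry 27 0 0 0).and (Ex.colourArc Ex.goodRule)).or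
      ((Ex.entry 27 0 0 0).not.and (.ex 3 ((Ex.entry 26 3 3 3).and
        ((((Ex.entry 14 0 0 0).eq (.const 2)).and
          (.cond ((Ex.var 0).eq (.const 0)) (.entry 24 3 1 2) (.entry 25 3 1 2))).or
        (((Ex.entry 14 0 0 0).eq (.const 2)).not.and (Ex.colourArc Ex.latinRule)))))))) _ ha ?_
  intro n Q A hA ρ i j k r0 r1 r2
  have hg := Ex.sat_colourArc hA h12 h14 h15 r0 r1 r2
    (Ex.goodRule_says h12 h14 h18 n Q A hA ρ i j k r0 r1 r2)
  have hu : ∀ (b : Fin n), ∀ x < 3, Function.update ρ 3 (b : ℕ) x = ρ x := fun b x hx =>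
    Function.update_of_ne (by omega) _ _
  have hl : ∀ b : Fin n, (Ex.colourArc Ex.latinRule).Sat A n (Function.update ρ 3 (b : ℕ)) ↔
      Q.ColourArc Q.minBlock (Q.latinRule (Q.blockType b)) i j k := by
    intro b
    have u0 := (hu b 0 (by decide)).trans r0
    have u1 := (hu b 1 (by decide)).trans r1
    have u2 := (hu b 2 (by decide)).trans r2
    exact Ex.sat_colourArc hA h12 h14 h15 u0 u1 u2
      (Ex.sat_latinRule hA h12 h14 h19 h20 h21 h22 h23 u0 u1 u2 (Function.update_self ..))
  have k14 := hA.eq h14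
  have k24 := hA.ind_iff h24
  have k25 := hA.ind_iff h25
  have k26 := hA.ind_iff h26
  have k27 := hA.ind_iff h27
  simp only [Ex.sat_or, Ex.sat_and, Ex.sat_not, Ex.sat_ex, Ex.sat_entry, Ex.sat_eq, Ex.sat_lt,
    Ex.eval_entry, Ex.eval.eq_2, Ex.eval.eq_3, Function.update_apply, OfNat.zero_ne_ofNat,
    OfNat.one_ne_ofNat, Nat.reduceEqDiff, if_true, if_false, r0, r1, r2, Ex.sat_cond, hg, hl, k14,
    k24, k25, k26, k27, FamilyArc]
  refine and_congr_right fun hk => or_congr Iff.rfl (and_congr_right fun _ =>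
    exists_congr fun b => and_congr_right fun _ => or_congr (and_congr_right fun hr => ?_) Iff.rfl)
  -- In this branch the smallest block has order two, so the two arrays cover all colours.
  have : (i : ℕ) = 0 ∨ (i : ℕ) = 1 := by omega
  rcases this with h | h <;> simp [h]

end Family

end RAM

/-! ### Assembling the algorithm -/

namespace RAM

open Digraph

/-- The family of subgraphs can be computed from the adjacency matrix. -/
theorem solves_family : ∃ L, Solves [(0, ind fun _ Q i j k => (k : ℕ) = 0 ∧ Q.Adj i j)] L ∧
    (2, fun _ _ _ _ _ => 1) ∈ L ∧ (3, ind fun _ Q i j k => Q.FamilyArc i j k) ∈ L ∧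
    (14, fun _ Q _ _ _ => Q.minBlock) ∈ L := by
  have s4 : Solves [(0, ind fun _ Q i j k => (k : ℕ) = 0 ∧ Q.Adj i j)] [(4, ind fun _ Q i j _ =>
    Q.Adj i j), (0, ind fun _ Q i j k => (k : ℕ) = 0 ∧ Q.Adj i j)] := by
    -- The input matrix is non-zero only at third index `0`. Its copy does not depend on the third
    -- index, so later look-ups may repeat any variable there.
    refine .fill_ind 4 (.cell 0 (.var 0) (.var 1) (.const 0)) _ (by simp) ?_
    intro n Q A hA ρ i j k r0 r1 r2
    have h := hA.ind_iff (.head _) i j ⟨0, by omega⟩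
    simp only [true_and] at h
    rw [← r0, ← r1] at h
    exact h
  have s5 := s4.trans (solves_closure (by simp) (by simp) (by simp))
  have s7 := s5.trans (solves_reach (by simp) (by simp) (by simp) (by simp))
  have s8 := s7.trans (solves_sameBlock (by simp) (by simp))
  have s9 := s8.trans (solves_isTail (by simp) (by simp) (by simp))
  have s10 := s9.trans (solves_isHead (by simp) (by simp) (by simp) (by simp))
  have s11 := s10.trans (solves_key (by simp) (by simp) (by simp))
  have s12 := s11.trans (solves_rank (by simp) (by simp) (by simp))
  have s13 := s12.trans (solves_blockSize (by simp) (by simp))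
  have s14 := s13.trans (solves_minBlock (by simp) (by simp))
  have s15 := s14.trans (solves_blockArc (by simp) (by simp) (by simp))
  have s16 := s15.trans (solves_goodArc (by simp) (by simp))
  have s17 := s16.trans (solves_firstGoodArc (by simp) (by simp))
  have s18 := s17.trans (solves_twisted (by simp) (by simp) (by simp))
  have s19 := s18.trans (solves_blockType (by simp) (by simp) (by simp))
  have s20 := s19.trans (solves_half (by simp) (by simp))
  have s21 := s20.trans (solves_even (by simp))
  have s22 := s21.trans (solves_odd (by simp) (by simp))
  have s23 := s22.trans (solves_four (by simp) (by simp))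
  have s27 := s23.trans (solves_exists_goodArc (by simp) (by simp))
  have s24 := s27.trans (solves_templateArc (by simp) (by simp) (by simp) (by simp) (by simp) 24 0
    (by simp))
  have s25 := s24.trans (solves_templateArc (by simp) (by simp) (by simp) (by simp) (by simp) 25 1
    (by simp))
  have s28 := s25.trans (solves_exists_fits (by simp) (by simp) (by simp) (by simp) (by simp))
  have s26 := s28.trans (solves_isBase (by simp) (by simp))
  have s3 := s26.trans (solves_familyArc (by simp) (by simp) (by simp) (by simp) (by simp)
    (by simp) (by simp) (by simp) (by simp) (by simp) (by simp) (by simp) (by simp) (by simp))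
  refine ⟨_, s3.trans (.fill 2 (.const 1) _ (by simp) fun _ _ _ _ _ _ _ _ _ _ _ => rfl), .head _,
    .tail _ (.head _), by simp⟩

theorem knows_input {n : ℕ} (Q : Digraph (Fin n)) (S : Finset (Fin n)) :
    Knows [(0, ind fun _ Q i j k => (k : ℕ) = 0 ∧ Q.Adj i j)] n Q (input Q S).cell := by
  classical
  intro p hp i j k
  obtain rfl := List.mem_singleton.1 hp
  have key : (0 = 0 ∧ (k : ℕ) = 0 ∧ ∃ u v : Fin n, (i : ℕ) = u ∧ (j : ℕ) = v ∧ Q.Adj u v) ∨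
      (0 = 1 ∧ (j : ℕ) = 0 ∧ (k : ℕ) = 0 ∧ ∃ u ∈ S, (i : ℕ) = (u : ℕ)) ↔
      (k : ℕ) = 0 ∧ Q.Adj i j := by
    constructor
    · rintro (⟨-, h, u, v, h1, h2, h3⟩ | ⟨h, -⟩)
      · rw [Fin.ext h1, Fin.ext h2]
        exact ⟨h, h3⟩
      · exact absurd h (by decide)
    · exact fun h => .inl ⟨rfl, h.1, i, j, rfl, rfl, h.2⟩
  by_cases h : (k : ℕ) = 0 ∧ Q.Adj i j
  · exact (if_pos (key.2 h)).trans (if_pos h).symm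
  · exact (if_neg fun h' => h (key.1 h')).trans (if_neg h).symm

end RAM

theorem corollary4p9 :
    ∃ (c : RAM.Program) (p : Polynomial ℕ),
      ∀ (n : ℕ) (Q : Digraph (Fin n)),
        Q.IsLoopless → Q.IsStrong → Q.IsQuasiTransitive → ¬ Q.IsExceptional →
        ∀ S : Finset (Fin n), 2 ≤ S.card →
          Nonempty Q.CanonicalDecomposition ∧
          ∃ (s : RAM.State) (T : ℕ), RAM.Run c (RAM.input Q S) s T ∧ T ≤ p.eval n ∧
            ∃ (m : ℕ) (H : Fin m → Q.Subdigraph), RAM.Displays s H ∧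
              (∀ k, (H k).IsStrongOn (S : Set (Fin n))) ∧
              (∀ k l, k ≠ l → (H k).ArcDisjoint (H l)) ∧
              ∀ C : Q.CanonicalDecomposition, C.minSize ≤ m := by
  classical
  obtain ⟨L, hL, h2, h3, h14⟩ := RAM.solves_family
  obtain ⟨c, p, hc⟩ := hL.finish h14
  refine ⟨c, p, fun n Q hl hs hq he S hS => ⟨Digraph.nonempty_canonicalDecomposition hl hs hq, ?_⟩⟩
  have hn : 2 ≤ n := hS.trans ((card_le_univ S).trans (by simp))
  obtain ⟨s, T, hr, hT, hk, h1⟩ := hc n (by omega) Q (RAM.input Q S) rfl (RAM.knows_input Q S)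
  have hle := RAM.minBlock_le Q
  -- All members are spanning, so they contain every `S`; the set serves only to ensure `2 ≤ n`.
  let H : Fin Q.minBlock → Q.Subdigraph := fun k =>
    { verts := Set.univ
      Adj := Q.FamilyArc k
      adj_sub := Digraph.FamilyArc.adj
      fst_mem := fun _ => Set.mem_univ _
      snd_mem := fun _ => Set.mem_univ _ }
  refine ⟨s, T, hr, hT, Q.minBlock, H, ⟨h1, fun k u => ?_, fun k u v => ?_⟩, fun k => ?_,
    fun k l hkl u v h => ?_, fun C => ?_⟩
  -- The arrays are indexed by `Fin n`, which covers the colours since the smallest block has at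
  -- most `n` vertices.
  · exact iff_of_true (hk.eq h2 (Fin.castLE hle k) u ⟨0, by omega⟩) (Set.mem_univ u)
  · have h := hk.eq h3 (Fin.castLE hle k) u v
    have h' := hk.ind_iff h3 (Fin.castLE hle k) u v
    rw [← show Q.FamilyArc (Fin.castLE hle k : Fin n) u v ↔ (H k).Adj u v from Iff.rfl, ← h']
    have h'' : s.cell 3 (Fin.castLE hle k : Fin n) u v = 0 ∨
        s.cell 3 (Fin.castLE hle k : Fin n) u v = 1 := by
      rw [h, RAM.ind]
      split_ifs <;> simp
    rw [Fin.val_castLE] at h'' ⊢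
    omega
  · exact ⟨Set.subset_univ _, fun u _ v _ =>
      Digraph.familyArc_reflTransGen hl hs hq hn he k.2 u v⟩
  · exact hkl (Fin.ext (h.1.unique hl hs hq hn he h.2))
  -- For any canonical decomposition, the part of a vertex `u` of a smallest block is contained in
  -- that block.
  · obtain ⟨u, hu⟩ := (Digraph.minBlock_spec (Q := Q) (by omega)).2
    refine (C.minSize_le u).trans_eq ?_
    rw [hu, Digraph.blockSize, Set.ncard_eq_toFinset_card']
    congr 1
    ext x
    simp
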